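/- **Setting.** Let $V=\coprod_{n\in\frac12\mathbb{Z}}V_{(n)}$ be a $\frac12\mathbb{Z}$-graded complex vector space with $V_{(n)}=0$ for $n$ sufficiently negative and $\dim V_{(n)}<\infty$ for all $n$. Put $V'=\coprod_n V_{(n)}^*$, $\overline V=\prod_n V_{(n)}$, $V^0=\coprod_{n\in\mathbb{Z}}V_{(n)}$, $V^1=\coprod_{n\in\mathbb{Z}+\frac12}V_{(n)}$, and let $L_V(0)$ act on $V_{(n)}$ (and on $\overline V$) as multiplication by $n$. Analyticity, derivatives and limits of $\overline V$-valued functions are taken in the topology of the dual pair $(V',\overline V)$, and an operator on $V$ is applied to an element of $\overline V$ by applying it to the homogeneous components and summing in this topology. **Definition.** A *grading-restricted vertex superalgebra structure* on $V$ with vacuum $\mathbf 1\in V_{(0)}$ is an analytic map $Y:\mathbb{C}^\times\to\mathrm{Hom}(V\otimes V,\overline V)$, $z\mapsto Y(\cdot,z)\cdot$, such that for all $u\in V$: $[L_V(0),Y(u,z)]=z\frac{d}{dz}Y(u,z)+Y(L_V(0)u,z)$; $Y(\mathbf 1,z)=1_V$; $\lim_{z\to0}Y(u,z)\mathbf 1=u$;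 the limits $L(-1)u=\lim_{z\to 0}\frac{d}{dz}Y(u,z)\mathbf 1$ define an operator on $V$ and $\frac{d}{dz}Y(u,z)=Y(L(-1)u,z)=[L(-1),Y(u,z)]$; and for $u_1\in V^{|u_1|}$, $u_2\in V^{|u_2|}$, $v\in V$, $v'\in V'$ the series $\langle v',Y(u_1,z_1)Y(u_2,z_2)v\rangle$, $(-1)^{|u_1||u_2|}\langle v',Y(u_2,z_2)Y(u_1,z_1)v\rangle$ and $\langle v',Y(Y(u_1,z_1-z_2)u_2,z_2)v\rangle$ converge absolutely for $|z_1|>|z_2|>0$, $|z_2|>|z_1|>0$ and $|z_2|>|z_1-z_2|>0$, respectively, to a common rational function with poles at most at $z_1=0$, $z_2=0$, $z_1=z_2$. It is a *grading-restricted vertex algebra* if $V^1=0$. **Corollary.** Let $\mathbf 1\in V_{(0)}$, let $L_V(-1)$ be an operator on $V$, and let $\phi^i:\mathbb{C}^\times\to\mathrm{Hom}(V,\overline V)$, $i\in I$, be analytic maps, with Laurent expansions $\phi^i(z)=\sum_{n\in\mathbb{Z}}\phi^i_nz^{-n-1}$, such that 1. for each $i$ there is $\mathrm{wt}\,\phi^i\in\frac12\mathbb{Z}$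 with $[L_V(0),\phi^i(z)]=z\frac{d}{dz}\phi^i(z)+(\mathrm{wt}\,\phi^i)\phi^i(z)$; 2. $L_V(-1)\mathbf 1=0$ and $[L_V(-1),\phi^i(z)]=\frac{d}{dz}\phi^i(z)$; 3. $\lim_{z\to0}\phi^i(z)\mathbf 1=\phi^i_{-1}\mathbf 1$ exists and lies in $V^0$ or in $V^1$; $|\phi^i|$ is $0$ or $1$ accordingly (and $0$ if the limit is $0$); 4. $V$ is spanned by the elements $\phi^{i_1}_{n_1}\cdots\phi^{i_k}_{n_k}\mathbf 1$; 5. (weak commutativity) for $i,j\in I$ there is a positive integer $N_{ij}$ such that, as formal Laurent series, $(z_1-z_2)^{N_{ij}}\phi^i(z_1)\phi^j(z_2)=(-1)^{|\phi^i||\phi^j|}(z_1-z_2)^{N_{ij}}\phi^j(z_2)\phi^i(z_1)$. Then, for $v\in V$, $v'\in V'$, the series $\langle v',\phi^{i_1}(z_1)\cdots\phi^{i_k}(z_k)v\rangle$ converges absolutely for $|z_1|>\cdots>|z_k|>0$ to a rational function $R(\langle v',\phi^{i_1}(z_1)\cdots\phi^{i_k}(z_k)v\rangle)$ with poles at most at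 $z_j=0$ and $z_j=z_l$ ($j\neq l$), and there is exactly one map $Y_V:\mathbb{C}^\times\to\mathrm{Hom}(V\otimes V,\overline V)$ with $$\langle v',Y_V(\phi^{i_1}_{m_1}\cdots\phi^{i_k}_{m_k}\mathbf 1,z)v\rangle=\mathrm{Res}_{\xi_1=0}\cdots\mathrm{Res}_{\xi_k=0}\,\xi_1^{m_1}\cdots\xi_k^{m_k}R(\langle v',\phi^{i_1}(\xi_1+z)\cdots\phi^{i_k}(\xi_k+z)v\rangle).$$ $(V,Y_V,\mathbf 1)$ is a grading-restricted vertex superalgebra, and a grading-restricted vertex algebra if all $\mathrm{wt}\,\phi^i$ are integers. It is generated by the $\phi^i_{-1}\mathbf 1$, $i\in I$, that is, $V$ is spanned by the vectors $(a_1)_{n_1}\cdots(a_k)_{n_k}\mathbf 1$ with $a_j\in\{\phi^i_{-1}\mathbf 1\}_{i\in I}$, where $Y_V(a,z)=\sum_n a_nz^{-n-1}$. Moreover $Y_V(\phi^i_{-1}\mathbf 1,z)=\phi^i(z)$ for $i\in I$, and $Y_V$ is the unique grading-restricted vertex superalgebra structure on $V$ with vacuum $\mathbf 1$ with this property. Finally,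 $Y_V$ coincides with the vertex operator map of Meurman and Primc, i.e. with the unique map such that $Y(\mathbf 1,z)=1_V$ and, for $i\in I$, $n\in\mathbb{Z}$ and $a\in V^{|a|}$, $$Y(\phi^i_na,z)=\mathrm{Res}_{x}\big((x-z)^n\phi^i(x)Y(a,z)-(-1)^{|\phi^i||a|}(-z+x)^nY(a,z)\phi^i(x)\big),$$ where $\mathrm{Res}_x$ is the coefficient of $x^{-1}$, and $(x-z)^n$, $(-z+x)^n$ are expanded in nonnegative powers of $z$ and of $x$, respectively. -/

import Mathlib

open scoped DirectSum Topology
open Filter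

noncomputable section

namespace HalfGraded

universe u v

section Spaces

variable (V : ℤ → Type u) [∀ k, AddCommGroup (V k)] [∀ k, Module ℂ (V k)]

/-- The `(1/2)ℤ`-graded space `∐ V_(n)`. The index is doubled:
`V k` is the space of elements of weight `k / 2`. -/
abbrev Total : Type u := ⨁ k, V k

/-- The algebraic completion `∏ V_(n)`. -/
abbrev Completion : Type u := ∀ k, V k

/-- The graded dual `∐ V_(n)^*`. -/
abbrev GradedDual : Type u := ⨁ k, Module.Dual ℂ (V k)

/-- The even part (`p = 0`, integral weights) and the odd part (`p = 1`, weights in `ℤ + 1/2`). -/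
def parityPart (p : ZMod 2) : Submodule ℂ (Total V) where
  carrier := {v | ∀ k : ℤ, (k : ZMod 2) ≠ p → v k = 0}
  zero_mem' := fun _ _ => rfl
  add_mem' := fun {a b} ha hb k hk => by
    simp [ha k hk, hb k hk]
  smul_mem' := fun c a ha k hk => by
    rw [DirectSum.smul_apply, ha k hk, smul_zero]

variable {V}

/-- The pairing `⟨v', w⟩` of the graded dual with the completion. -/
def pair : GradedDual V →ₗ[ℂ] Completion V →ₗ[ℂ] ℂ :=
  DirectSum.toModule ℂ ℤ (Completion V →ₗ[ℂ] ℂ)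
    fun k => (LinearMap.proj k : Completion V →ₗ[ℂ] V k).dualMap

/-- The inclusion of a graded space in its completion. -/
def incl (v : Total V) : Completion V := fun k => v k

/-- The component of weight `k / 2` of an element of the completion, as an element of the
graded space. -/
def comp (k : ℤ) (w : Completion V) : Total V := DirectSum.lof ℂ ℤ V k (w k)

/-- The operator `L(0)` on the completion: multiplication by the weight. -/
def weightCompl (w : Completion V) : Completion V := fun k => ((k : ℂ) / 2) • w k

/-- The operator `L(0)` on the graded space. -/
def weight : Module.End ℂ (Total V) :=
  DirectSum.lmap fun k => ((k : ℂ) / 2) • (LinearMap.id : V k →ₗ[ℂ] V k)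

/-- A map from `ℂ ∖ {0}` to the completion is analytic (for the topology of the dual pair) if all
its matrix coefficients are. -/
def IsAnalytic (f : ℂ → Completion V) : Prop :=
  ∀ v' : GradedDual V, DifferentiableOn ℂ (fun z => pair v' (f z)) {0}ᶜ

/-- `f z` tends to `l` as `z → 0`, in the topology of the dual pair. -/
def TendstoAtZero (f : ℂ → Completion V) (l : Completion V) : Prop :=
  ∀ v' : GradedDual V, Tendsto (fun z => pair v' (f z)) (𝓝[≠] 0) (𝓝 (pair v' l))

/-- `⟨v', (d/dz) f(z)⟩`. -/
def dcoeff (f : ℂ → Completion V) (v' : GradedDual V) (z : ℂ) : ℂ :=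
  deriv (fun x => pair v' (f x)) z

open Classical in
/-- The coefficient of `z ^ (-n-1)` in the Laurent expansion of `f` on `ℂ ∖ {0}`: the element `w`
of the graded space with `⟨v', w⟩ = (2πi)⁻¹ ∮ z ^ n ⟨v', f(z)⟩ dz` for all `v'`. (It is `0` by
convention if the coefficient lies in the completion only.) -/
def laurentCoeff (f : ℂ → Completion V) (n : ℤ) : Total V :=
  if h : ∃ w : Total V, ∀ v' : GradedDual V,
      pair v' (incl w) = (2 * Real.pi * Complex.I)⁻¹ * ∮ z in C(0, 1), z ^ n * pair v' (f z)
  then h.choose else 0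

/-- The mode `φ_n`, where `φ(z) = ∑ φ_n z ^ (-n-1)`. -/
def mode (φ : ℂ → Total V →ₗ[ℂ] Completion V) (n : ℤ) (v : Total V) : Total V :=
  laurentCoeff (fun z => φ z v) n

/-- The vector `φ^{i₁}_{n₁} ⋯ φ^{i_k}_{n_k} v` for the list `(i₁, n₁), …, (i_k, n_k)`. -/
def word {I : Type v} (φ : I → ℂ → Total V →ₗ[ℂ] Completion V) (l : List (I × ℤ))
    (v : Total V) : Total V :=
  l.foldr (fun p w => mode (φ p.1) p.2 w) v

/-- `1` as an element of the graded space. -/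
def vacuum (vac : V 0) : Total V := DirectSum.lof ℂ ℤ V 0 vac

end Spaces

/-- The sign `(-1)^{pq}`. -/
def sign (p q : ZMod 2) : ℂ := (-1) ^ (p.val * q.val)

/-- The rational function `P / (∏ z_i ∏_{i<j} (z_i - z_j)) ^ N`: the general rational function in
`z_1, …, z_k` whose only possible poles are `z_i = 0` and `z_i = z_j`. -/
def ratFun {k : ℕ} (P : MvPolynomial (Fin k) ℂ) (N : ℕ) (z : Fin k → ℂ) : ℂ :=
  MvPolynomial.eval z P /
    ((∏ i, z i) * ∏ i, ∏ j ∈ Finset.Ioi i, (z i - z j)) ^ N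

/-- The residue at `0` of a function that is meromorphic at `0`. -/
def residueAtZero (f : ℂ → ℂ) : ℂ :=
  limUnder (𝓝[>] (0 : ℝ)) fun r => (2 * Real.pi * Complex.I)⁻¹ * ∮ z in C(0, r), f z

/-- `Res_{ξ₁=0} ⋯ Res_{ξ_k=0} ξ₁^{m₁} ⋯ ξ_k^{m_k} F(ξ₁, …, ξ_k)`; the residue in `ξ_k` is taken
first, with the other variables fixed, and the one in `ξ₁` last. -/
def iterRes : (k : ℕ) → (Fin k → ℤ) → ((Fin k → ℂ) → ℂ) → ℂ
  | 0, _, F => F Fin.elim0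
  | k + 1, m, F => residueAtZero fun ξ =>
      ξ ^ m 0 * iterRes k (Fin.tail m) fun ξs => F (Fin.cons ξ ξs)

/-- Multiplication of the formal Laurent series `∑ A m n z₁ ^ (-m-1) z₂ ^ (-n-1)` by `z₁ - z₂`. -/
def mulDiff {X : Type u} [AddCommGroup X] (A : ℤ → ℤ → X) : ℤ → ℤ → X :=
  fun m n => A (m + 1) n - A m (n + 1)

section Structures

variable {V : ℤ → Type u} [∀ k, AddCommGroup (V k)] [∀ k, Module ℂ (V k)]

/-- A grading-restricted vertex superalgebra structure on `V = ∐ V_(n)` with vacuum `vac`.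
Only the values of `Y` on `ℂ ∖ {0}` matter. -/
structure IsVertexSuperalgebra (vac : V 0)
    (Y : ℂ → Total V →ₗ[ℂ] Total V →ₗ[ℂ] Completion V) : Prop where
  analytic : ∀ u v, IsAnalytic fun z => Y z u v
  lower_bounded : ∃ k₀ : ℤ, ∀ k < k₀, Subsingleton (V k)
  finite_dim : ∀ k, Module.Finite ℂ (V k)
  /-- `[L(0), Y(u,z)] = z (d/dz) Y(u,z) + Y(L(0)u,z)` -/
  weight_bracket : ∀ u v (v' : GradedDual V) (z : ℂ), z ≠ 0 →
    pair v' (weightCompl (Y z u v)) - pair v' (Y z u (weight v))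
      = z * dcoeff (fun x => Y x u v) v' z + pair v' (Y z (weight u) v)
  identity : ∀ v (z : ℂ), z ≠ 0 → Y z (vacuum vac) v = incl v
  creation : ∀ u, TendstoAtZero (fun z => Y z u (vacuum vac)) (incl u)
  /-- `L(-1)u = lim (d/dz) Y(u,z)1` is an operator `D` on `V`, and
  `(d/dz) Y(u,z) = Y(L(-1)u,z) = [L(-1), Y(u,z)]`. Here `L(-1)` is applied to an element of the
  completion by applying it to the homogeneous components and summing in the topology of the
  completion. -/
  translation : ∃ D : Module.End ℂ (Total V),
    (∀ u (v' : GradedDual V),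
      Tendsto (dcoeff (fun x => Y x u (vacuum vac)) v') (𝓝[≠] 0) (𝓝 (pair v' (incl (D u))))) ∧
    ∀ u v (v' : GradedDual V) (z : ℂ), z ≠ 0 →
      dcoeff (fun x => Y x u v) v' z = pair v' (Y z (D u) v) ∧
      HasSum (fun k : ℤ => pair v' (incl (D (comp k (Y z u v)))))
        (dcoeff (fun x => Y x u v) v' z + pair v' (Y z u (D v)))
  duality : ∀ (p q : ZMod 2), ∀ u₁ ∈ parityPart V p, ∀ u₂ ∈ parityPart V q,
    ∀ (v : Total V) (v' : GradedDual V), ∃ (P : MvPolynomial (Fin 2) ℂ) (N : ℕ),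
      (∀ z₁ z₂ : ℂ, ‖z₂‖ < ‖z₁‖ → 0 < ‖z₂‖ →
        HasSum (fun k : ℤ => pair v' (Y z₁ u₁ (comp k (Y z₂ u₂ v)))) (ratFun P N ![z₁, z₂])) ∧
      (∀ z₁ z₂ : ℂ, ‖z₁‖ < ‖z₂‖ → 0 < ‖z₁‖ →
        HasSum (fun k : ℤ => sign p q * pair v' (Y z₂ u₂ (comp k (Y z₁ u₁ v))))
          (ratFun P N ![z₁, z₂])) ∧
      (∀ z₁ z₂ : ℂ, ‖z₁ - z₂‖ < ‖z₂‖ → 0 < ‖z₁ - z₂‖ →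
        HasSum (fun k : ℤ => pair v' (Y z₂ (comp k (Y (z₁ - z₂) u₁ u₂)) v))
          (ratFun P N ![z₁, z₂]))

/-- A grading-restricted vertex algebra: a grading-restricted vertex superalgebra without odd
part. -/
def IsVertexAlgebra (vac : V 0) (Y : ℂ → Total V →ₗ[ℂ] Total V →ₗ[ℂ] Completion V) : Prop :=
  IsVertexSuperalgebra vac Y ∧ parityPart V 1 = ⊥

/-- `V` is generated by the family `a`: it is spanned by the vectors
`(a^{i₁})_{n₁} ⋯ (a^{i_k})_{n_k} 1`, where `Y(a,z) = ∑ a_n z ^ (-n-1)`. -/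
def IsGeneratedBy {I : Type v} (vac : V 0) (Y : ℂ → Total V →ₗ[ℂ] Total V →ₗ[ℂ] Completion V)
    (a : I → Total V) : Prop :=
  Submodule.span ℂ
    (Set.range fun l : List (I × ℤ) => word (fun i z => Y z (a i)) l (vacuum vac)) = ⊤

open Classical in
/-- `|φ|`: the parity of `φ_{-1} 1` (taken to be `0` if this vector vanishes). -/
def fieldParity (vac : V 0) (φ : ℂ → Total V →ₗ[ℂ] Completion V) : ZMod 2 :=
  if mode φ (-1) (vacuum vac) ∈ parityPart V 0 then 0 else 1

/-- The conditions on the generating fields `φ^i`, of weight `wt i / 2`, on the operator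
`L = L(-1)` and on the vacuum. -/
structure IsGeneratingData {I : Type v} (vac : V 0)
    (φ : I → ℂ → Total V →ₗ[ℂ] Completion V) (wt : I → ℤ)
    (L : Module.End ℂ (Total V)) : Prop where
  lower_bounded : ∃ k₀ : ℤ, ∀ k < k₀, Subsingleton (V k)
  finite_dim : ∀ k, Module.Finite ℂ (V k)
  analytic : ∀ i v, IsAnalytic fun z => φ i z v
  /-- `[L(0), φ^i(z)] = z (d/dz) φ^i(z) + (wt φ^i) φ^i(z)` -/
  weight_bracket : ∀ i v (v' : GradedDual V) (z : ℂ), z ≠ 0 →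
    pair v' (weightCompl (φ i z v)) - pair v' (φ i z (weight v))
      = z * dcoeff (fun x => φ i x v) v' z + ((wt i : ℂ) / 2) * pair v' (φ i z v)
  L_vacuum : L (vacuum vac) = 0
  /-- `[L(-1), φ^i(z)] = (d/dz) φ^i(z)` -/
  L_bracket : ∀ i v (v' : GradedDual V) (z : ℂ), z ≠ 0 →
    HasSum (fun k : ℤ => pair v' (incl (L (comp k (φ i z v)))))
      (dcoeff (fun x => φ i x v) v' z + pair v' (φ i z (L v)))
  /-- `lim φ^i(z) 1` exists and is an element of the even or of the odd part of `V`. -/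
  creation : ∀ i, ∃ a : Total V, TendstoAtZero (fun z => φ i z (vacuum vac)) (incl a) ∧
    (a ∈ parityPart V 0 ∨ a ∈ parityPart V 1)
  spanning : Submodule.span ℂ
    (Set.range fun l : List (I × ℤ) => word φ l (vacuum vac)) = ⊤
  /-- Weak commutativity, an identity of formal Laurent series in `z₁`, `z₂`:
  `(z₁ - z₂)^N φ^i(z₁) φ^j(z₂) = (-1)^{|φ^i||φ^j|} (z₁ - z₂)^N φ^j(z₂) φ^i(z₁)`. -/
  weak_comm : ∀ i j, ∃ N : ℕ, 0 < N ∧ ∀ v : Total V,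
    mulDiff^[N] (fun m n => mode (φ i) m (mode (φ j) n v)) =
    mulDiff^[N] (fun m n => sign (fieldParity vac (φ i)) (fieldParity vac (φ j)) •
      mode (φ j) n (mode (φ i) m v))

/-- `Y` is the vertex operator map defined from products of the generating fields: the series
`⟨v', φ^{i₁}(z₁) ⋯ φ^{i_k}(z_k) v⟩` converges absolutely for `|z₁| > ⋯ > |z_k| > 0` to a rational
function `R` with poles at most at `z_j = 0` and `z_j = z_l`, and
`⟨v', Y(φ^{i₁}_{m₁} ⋯ φ^{i_k}_{m_k} 1, z) v⟩
  = Res_{ξ₁=0} ⋯ Res_{ξ_k=0} ξ₁^{m₁} ⋯ ξ_k^{m_k} R(ξ₁ + z, …, ξ_k + z)`. -/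
def IsProductResidueMap {I : Type v} (vac : V 0) (φ : I → ℂ → Total V →ₗ[ℂ] Completion V)
    (Y : ℂ → Total V →ₗ[ℂ] Total V →ₗ[ℂ] Completion V) : Prop :=
  ∀ (k : ℕ) (i : Fin k → I) (v : Total V) (v' : GradedDual V),
    ∃ (P : MvPolynomial (Fin k) ℂ) (N : ℕ),
      (∀ z : Fin k → ℂ, (∀ j, z j ≠ 0) → StrictAnti (fun j => ‖z j‖) →
        HasSum (fun n : Fin k → ℤ =>
          pair v' (incl (word φ (List.ofFn fun j => (i j, n j)) v)) * ∏ j, z j ^ (-n j - 1))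
          (ratFun P N z)) ∧
      ∀ (m : Fin k → ℤ) (z : ℂ), z ≠ 0 →
        pair v' (Y z (word φ (List.ofFn fun j => (i j, m j)) (vacuum vac)) v)
          = iterRes k m fun ξ => ratFun P N fun j => ξ j + z

/-- `Y` is the vertex operator map defined recursively by `Y(1,z) = 1` and the residue in `x` of
the Jacobi identity:
`Y(φ^i_n a, z) = Res_x ((x - z)^n φ^i(x) Y(a,z) - (-1)^{|φ^i||a|} (-z + x)^n Y(a,z) φ^i(x))`,
where `(x - z)^n` and `(-z + x)^n` are expanded in nonnegative powers of their second terms.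
Operators on `V` are applied to elements of the completion componentwise. -/
def IsJacobiResidueMap {I : Type v} (vac : V 0) (φ : I → ℂ → Total V →ₗ[ℂ] Completion V)
    (Y : ℂ → Total V →ₗ[ℂ] Total V →ₗ[ℂ] Completion V) : Prop :=
  (∀ v (z : ℂ), z ≠ 0 → Y z (vacuum vac) v = incl v) ∧
  ∀ (i : I) (n : ℤ) (p : ZMod 2), ∀ a ∈ parityPart V p, ∀ (v : Total V) (v' : GradedDual V)
    (z : ℂ), z ≠ 0 →
    HasSum (fun j : ℕ => (Ring.choose n j : ℂ) *
        ((-z) ^ j * (∑' k : ℤ, pair v' (incl (mode (φ i) (n - j) (comp k (Y z a v)))))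
          - sign (fieldParity vac (φ i)) p * ((-z) ^ (n - j) *
            pair v' (Y z a (mode (φ i) j v)))))
      (pair v' (Y z (mode (φ i) n a) v))

end Structures

end HalfGraded

end

/-! The bracket with `L(0)` is an Euler equation, so a matrix coefficient of a field between a
homogeneous vector and a homogeneous functional is a single power of `z`, and it vanishes when the
exponent would be half-integral (`eq_zpow_of_euler`). An analytic field is therefore the same thing
as a sequence of homogeneous operators, its modes, and the hypotheses become algebraic
(`IsFormalData`).

State-field correspondence. Call a homogeneous, `L`-covariant sequence of modes that is local with
respect to all generators a field (`IsField`). Dong's lemma (`dong_core`, `IsLocal.nprod`) shows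
that fields are closed under the residue products `nprod`, and the `m`-th product of `a` and `b`
creates `a_m b_{-1} 1` from the vacuum (`nprod_vacuum`). Iterated products of generators thus create
all words; as words span, every vector is created by a field. Goddard's theorem (`goddard`) gives
uniqueness: the values of a field on the vacuum follow from `a_{-1} 1` by covariance, and locality
carries them to all words. The resulting linear map is `vertexOp`. All axioms except duality are
read off from the modes.

Rationality. In a product of fields, a high power of the Vandermonde product allows any factor to be
moved to the far right, where truncation bounds its index from above; the grading bounds the sum of
the indices from below. Hence that multiple of the series is a finite Laurent sum
(`coeffs_isRational`). Dividing by one difference at a time, each in its geometric expansion, gives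
absolute convergence to the rational function (`hasSum_ratEval`).

Associativity. Near `x = z` the rational function of `⋯ a(x) b(z)` expands in powers of `ξ = x - z`,
and the coefficient of `ξ ^ (-m-1)` is the rational function of `⋯ (a_(m) b)(z)` (`hasSum_ope`). For
two fields the expansion holds on the whole disc `|ξ| < |z|` (`hasSum_ope_two`), which with
rationality and locality yields duality. For many fields, iterating residues onto an identity field
placed at `z` yields the product-residue formula (`vertexOp_prodL`). The Jacobi-residue formula is
the definition of `nprod` summed over modes (`hasSum_nprod`).

Uniqueness. The residue formulas determine a map on words. If another vertex superalgebra structure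
extends the generators, its translation operator agrees with `L` on words, and its fields are weakly
local with the generators, because two expansions of one rational function agree after its pole at
`z₁ = z₂` is cleared (`exists_mulDiff_iterate_eq`). Goddard's theorem then identifies the fields. -/

noncomputable section

namespace HalfGraded

universe u v
set_option linter.unusedSectionVars false
set_option linter.unusedVariables false
set_option linter.unusedSimpArgs false

/-! ### Homogeneous operators, modes and the completion -/

section Basic

variable {V : ℤ → Type u} [∀ k, AddCommGroup (V k)] [∀ k, Module ℂ (V k)]

/-- The inclusion of homogeneous elements. -/
abbrev ofDeg (k : ℤ) : V k →ₗ[ℂ] Total V := DirectSum.lof ℂ ℤ V k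

/-- The inclusion of homogeneous functionals. -/
abbrev dualOf (k : ℤ) : Module.Dual ℂ (V k) →ₗ[ℂ] GradedDual V :=
  DirectSum.lof ℂ ℤ (fun k => Module.Dual ℂ (V k)) k

lemma pair_dualOf (k : ℤ) (f : Module.Dual ℂ (V k)) (w : Completion V) :
    pair (dualOf k f) w = f (w k) := by
  simp [pair, dualOf]

lemma gradedDual_induction {p : GradedDual V → Prop} (v' : GradedDual V) (h0 : p 0)
    (h1 : ∀ k f, p (dualOf k f)) (h2 : ∀ x y, p x → p y → p (x + y)) : p v' :=
  DirectSum.induction_on v' h0 h1 h2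

lemma total_induction {p : Total V → Prop} (v : Total V) (h0 : p 0)
    (h1 : ∀ k f, p (ofDeg k f)) (h2 : ∀ x y, p x → p y → p (x + y)) : p v :=
  DirectSum.induction_on v h0 h1 h2

lemma completion_ext {w w' : Completion V} (h : ∀ v', pair v' w = pair v' w') : w = w' := by
  funext k
  rw [← sub_eq_zero, ← Module.forall_dual_apply_eq_zero_iff ℂ]
  intro f
  have := h (dualOf k f)
  rw [pair_dualOf, pair_dualOf] at this
  simp [this]

/-- The inclusion of the graded space in its completion, as a linear map. -/
def inclL : Total V →ₗ[ℂ] Completion V where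
  toFun := incl
  map_add' _ _ := rfl
  map_smul' c v := by funext k; exact DirectSum.smul_apply c v k

lemma incl_add (v w : Total V) : incl (v + w) = incl v + incl w := rfl

lemma incl_smul (c : ℂ) (v : Total V) : incl (c • v) = c • incl v := inclL.map_smul c v

lemma incl_sub (v w : Total V) : incl (v - w) = incl v - incl w := inclL.map_sub v w

@[simp] lemma incl_zero : incl (0 : Total V) = 0 := rfl

lemma total_ext {w w' : Total V} (h : ∀ v', pair v' (incl w) = pair v' (incl w')) : w = w' :=
  DFinsupp.ext fun k => congrFun (completion_ext h) k

lemma total_eq_zero {w : Total V} (h : ∀ v', pair v' (incl w) = 0) : w = 0 :=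
  total_ext fun v' => by simp [h]

lemma ofDeg_same (k : ℤ) (x : V k) : ofDeg k x k = x := DirectSum.lof_apply ℂ k x

lemma ofDeg_ne {k j : ℤ} (x : V k) (h : j ≠ k) : ofDeg k x j = 0 :=
  DirectSum.of_eq_of_ne k j x h

lemma comp_incl_ofDeg_same (k : ℤ) (x : V k) : comp k (incl (ofDeg k x)) = ofDeg k x := by
  simp [comp, incl]

lemma comp_incl_ofDeg_ne {k j : ℤ} (x : V k) (h : j ≠ k) : comp j (incl (ofDeg k x)) = 0 := by
  simp [comp, incl, ofDeg_ne x h]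

/-- The projection to the homogeneous component as a linear map. -/
def compL (k : ℤ) : Completion V →ₗ[ℂ] Total V := ofDeg k ∘ₗ LinearMap.proj k

lemma comp_add (k : ℤ) (w w' : Completion V) : comp k (w + w') = comp k w + comp k w' :=
  (compL k).map_add w w'

lemma comp_zero (k : ℤ) : comp k (0 : Completion V) = 0 := (compL k).map_zero

lemma weight_ofDeg (k : ℤ) (x : V k) : weight (ofDeg k x) = ((k : ℂ) / 2) • ofDeg k x := by
  simp [weight, ofDeg]

lemma ofDeg_mem_parityPart (k : ℤ) (x : V k) : ofDeg k x ∈ parityPart V (k : ZMod 2) := by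
  intro j hj
  exact ofDeg_ne x (by rintro rfl; exact hj rfl)

lemma parityPart_induction {q : ZMod 2} {p : Total V → Prop} (v : Total V)
    (hv : v ∈ parityPart V q) (h0 : p 0)
    (h1 : ∀ k : ℤ, (k : ZMod 2) = q → ∀ f, p (ofDeg k f)) (h2 : ∀ x y, p x → p y → p (x + y)) :
    p v := by
  classical
  rw [← DirectSum.sum_support_of v]
  refine Finset.sum_induction _ p h2 h0 fun k hk => ?_
  refine h1 k ?_ _
  by_contra hkq
  exact (DFinsupp.mem_support_iff.1 hk) (hv k hkq)

/-- `M` maps `V_(k)` to `V_(k + δ)` (doubled indices). -/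
def IsHomogOp (δ : ℤ) (M : Module.End ℂ (Total V)) : Prop :=
  ∀ (k : ℤ) (x : V k) (j : ℤ), j ≠ k + δ → M (ofDeg k x) j = 0

variable (V) in
/-- Sequences of operators, thought of as the modes of a field `∑ a_n z ^ (-n-1)`. -/
abbrev Modes := ℤ → Module.End ℂ (Total V)

/-- The field with modes `a` has weight `d / 2`. -/
def IsHomog (d : ℤ) (a : Modes V) : Prop := ∀ n, IsHomogOp (d - 2 * n - 2) (a n)

lemma eq_ofDeg_of_forall {w : Total V} {k : ℤ} (h : ∀ j, j ≠ k → w j = 0) :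
    w = ofDeg k (w k) := by
  refine DFinsupp.ext fun j => ?_
  by_cases hj : j = k
  · subst hj; exact (ofDeg_same _ _).symm
  · rw [h j hj]; exact (ofDeg_ne _ hj).symm

lemma IsHomogOp.eq {δ : ℤ} {M : Module.End ℂ (Total V)} (h : IsHomogOp δ M) (k : ℤ) (x : V k) :
    M (ofDeg k x) = ofDeg (k + δ) (M (ofDeg k x) (k + δ)) :=
  eq_ofDeg_of_forall (h k x)

lemma IsHomogOp.comp {δ ε : ℤ} {M N : Module.End ℂ (Total V)} (h : IsHomogOp δ M)
    (h' : IsHomogOp ε N) : IsHomogOp (δ + ε) (M * N) := by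
  intro k x j hj
  rw [Module.End.mul_apply, h'.eq k x]
  exact h _ _ _ (by omega)

lemma IsHomogOp.add {δ : ℤ} {M N : Module.End ℂ (Total V)} (h : IsHomogOp δ M)
    (h' : IsHomogOp δ N) : IsHomogOp δ (M + N) := by
  intro k x j hj
  rw [LinearMap.add_apply, DirectSum.add_apply, h k x j hj, h' k x j hj, add_zero]

lemma IsHomogOp.smul {δ : ℤ} {M : Module.End ℂ (Total V)} (h : IsHomogOp δ M) (c : ℂ) :
    IsHomogOp δ (c • M) := by
  intro k x j hj
  rw [LinearMap.smul_apply, DirectSum.smul_apply, h k x j hj, smul_zero]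

lemma IsHomogOp.zero {δ : ℤ} : IsHomogOp δ (0 : Module.End ℂ (Total V)) := fun _ _ _ _ => rfl

/-- The value at `z` of the field of weight `d / 2` with modes `a`. -/
def evalAt (d : ℤ) (a : Modes V) (z : ℂ) : Total V →ₗ[ℂ] Completion V :=
  LinearMap.pi fun j => DirectSum.toModule ℂ ℤ (V j) fun l =>
    -- The mode `n` sends `V l` to `V (l + d - 2n - 2)`, so only `n + 1 = (d + l - j) / 2` reaches
    -- `V j`, with power `z ^ (-n-1)`; for odd `d + l - j` no mode does.
    if Even (d + l - j) then
      z ^ (-((d + l - j) / 2)) • (DirectSum.component ℂ ℤ V j ∘ₗ a ((d + l - j) / 2 - 1) ∘ₗ ofDeg l)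
    else 0

lemma evalAt_ofDeg (d : ℤ) (a : Modes V) (z : ℂ) (l : ℤ) (x : V l) (j : ℤ) :
    evalAt d a z (ofDeg l x) j = if Even (d + l - j) then
      z ^ (-((d + l - j) / 2)) • (a ((d + l - j) / 2 - 1) (ofDeg l x) j) else 0 := by
  simp only [evalAt, LinearMap.pi_apply, ofDeg, DirectSum.toModule_lof]
  split_ifs <;> rfl

/-- For a homogeneous vector and functional, at most one mode contributes. -/
lemma IsHomog.apply_eq_zero {d : ℤ} {a : Modes V} (h : IsHomog d a) {l j n : ℤ} (x : V l)
    (hn : j ≠ l + (d - 2 * n - 2)) : a n (ofDeg l x) j = 0 := h n l x j hn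

/-- Between a homogeneous vector and a homogeneous functional the series has at most one nonzero
term; the general case is a finite sum of such cases. This is the bridge between modes and values.
-/
lemma hasSum_evalAt {d : ℤ} {a : Modes V} (h : IsHomog d a) (z : ℂ) (v : Total V)
    (v' : GradedDual V) :
    HasSum (fun n : ℤ => pair v' (incl (a n v)) * z ^ (-n - 1)) (pair v' (evalAt d a z v)) := by
  induction v' using gradedDual_induction with
  | h0 => simp [hasSum_zero]
  | h2 x y hx hy => simpa only [map_add, LinearMap.add_apply, add_mul] using hx.add hy
  | h1 j f =>
    induction v using total_induction with
    | h0 => simp [hasSum_zero]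
    | h2 x y hx hy =>
      simpa only [map_add, incl_add, LinearMap.add_apply, add_mul] using hx.add hy
    | h1 l x =>
      simp only [pair_dualOf, evalAt_ofDeg]
      split_ifs with he
      · obtain ⟨m, hm⟩ := he
        have h2 : (d + l - j) / 2 = m := by omega
        rw [h2]
        have := hasSum_single (f := fun n : ℤ => f (incl (a n (ofDeg l x)) j) * z ^ (-n - 1)) (m - 1)
          (fun n hn => by
            rw [show incl (a n (ofDeg l x)) j = 0 from h.apply_eq_zero x (by omega)]; simp)
        convert this using 1
        rw [map_smul, smul_eq_mul, mul_comm]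
        congr 2
        ring
      · convert hasSum_zero using 1
        · funext n
          rw [show incl (a n (ofDeg l x)) j = 0 from h.apply_eq_zero x (by
            rintro rfl; exact he ⟨n + 1, by ring⟩)]
          simp
        · simp

/-- High modes lower the weight below the lower bound of the grading. -/
lemma IsHomog.trunc {d : ℤ} {a : Modes V} (h : IsHomog d a) {k₀ : ℤ}
    (hk : ∀ k < k₀, Subsingleton (V k)) (v : Total V) : ∃ M : ℤ, ∀ n ≥ M, a n v = 0 := by
  induction v using total_induction with
  | h0 => exact ⟨0, by simp⟩
  | h2 x y hx hy =>
    obtain ⟨M, hM⟩ := hx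
    obtain ⟨M', hM'⟩ := hy
    refine ⟨max M M', fun n hn => ?_⟩
    rw [map_add, hM n (le_trans (le_max_left _ _) hn), hM' n (le_trans (le_max_right _ _) hn),
      add_zero]
  | h1 l x =>
    refine ⟨l + d - k₀ + |l + d - k₀| , fun n hn => ?_⟩
    rw [(h n).eq]
    have := hk (l + (d - 2 * n - 2)) (by
      rcases abs_cases (l + d - k₀) with _ | _ <;> omega)
    rw [Subsingleton.elim ((a n) (ofDeg l x) (l + (d - 2 * n - 2))) 0, map_zero]

/-- The extension of an operator of degree `δ` to the completion. -/
def extend (δ : ℤ) (M : Module.End ℂ (Total V)) : Completion V →ₗ[ℂ] Completion V :=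
  LinearMap.pi fun j => DirectSum.component ℂ ℤ V j ∘ₗ M ∘ₗ compL (j - δ)

lemma extend_apply (δ : ℤ) (M : Module.End ℂ (Total V)) (w : Completion V) (j : ℤ) :
    extend δ M w j = M (comp (j - δ) w) j := rfl

/-- A homogeneous functional sees only one component of `w`, so for homogeneous operators the
componentwise sums in the definitions are values of the linear map `extend`. -/
lemma hasSum_extend {δ : ℤ} {M : Module.End ℂ (Total V)} (h : IsHomogOp δ M) (w : Completion V)
    (v' : GradedDual V) :
    HasSum (fun k : ℤ => pair v' (incl (M (comp k w)))) (pair v' (extend δ M w)) := by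
  induction v' using gradedDual_induction with
  | h0 => simp [hasSum_zero]
  | h2 x y hx hy => simpa only [map_add, LinearMap.add_apply] using hx.add hy
  | h1 j f =>
    simp only [pair_dualOf, extend_apply]
    refine hasSum_single (f := fun k : ℤ => f (incl (M (comp k w)) j)) (j - δ) fun k hk => ?_
    rw [show incl (M (comp k w)) j = 0 from h k _ j (by omega), map_zero]

lemma extend_incl {δ : ℤ} {M : Module.End ℂ (Total V)} (h : IsHomogOp δ M) (v : Total V) :
    extend δ M (incl v) = incl (M v) := by
  induction v using total_induction with
  | h0 => simp
  | h2 x y hx hy => rw [incl_add, map_add, hx, hy, map_add, incl_add]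
  | h1 l x =>
    funext j
    rw [extend_apply]
    by_cases hj : j - δ = l
    · subst hj
      rw [comp_incl_ofDeg_same]; rfl
    · rw [comp_incl_ofDeg_ne _ hj, map_zero]
      exact (h l x j (by omega)).symm

/-- The functional `v' ∘ M`. -/
lemma exists_dual_comp {δ : ℤ} {M : Module.End ℂ (Total V)} (h : IsHomogOp δ M)
    (v' : GradedDual V) : ∃ w' : GradedDual V, ∀ w, pair w' w = pair v' (extend δ M w) := by
  induction v' using gradedDual_induction with
  | h0 => exact ⟨0, by simp⟩
  | h2 x y hx hy =>
    obtain ⟨x', hx⟩ := hx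
    obtain ⟨y', hy⟩ := hy
    exact ⟨x' + y', fun w => by simp [hx, hy]⟩
  | h1 j f =>
    refine ⟨dualOf (j - δ) (f ∘ₗ DirectSum.component ℂ ℤ V j ∘ₗ M ∘ₗ ofDeg (j - δ)), fun w => ?_⟩
    rw [pair_dualOf, pair_dualOf, extend_apply]
    rfl

end Basic

/-! ### Laurent coefficients and residues as circle integrals -/

section Laurent

lemma circleIntegral_zpow {r : ℝ} (hr : 0 < r) (n : ℤ) :
    (∮ z in C(0, r), z ^ n) = if n = -1 then 2 * Real.pi * Complex.I else 0 := by
  split_ifs with h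
  · subst h
    simpa using circleIntegral.integral_sub_center_inv 0 hr.ne'
  · simpa using circleIntegral.integral_sub_zpow_of_ne h 0 0 r

/-- The coefficients of an absolutely convergent Laurent series are given by circle integrals. -/
lemma circleIntegral_of_hasSum {r : ℝ} (hr : 0 < r) {c : ℤ → ℂ} {f : ℂ → ℂ}
    (h : ∀ z : ℂ, ‖z‖ = r → HasSum (fun n => c n * z ^ (-n - 1)) (f z)) (m : ℤ) :
    (2 * Real.pi * Complex.I)⁻¹ * ∮ z in C(0, r), z ^ m * f z = c m := by
  have hne : ∀ θ : ℝ, circleMap 0 r θ ≠ 0 := fun θ => circleMap_ne_center hr.ne'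
  have hnorm : ∀ θ : ℝ, ‖circleMap 0 r θ‖ = r := fun θ => by simp [abs_of_pos hr]
  -- The norms of the terms depend only on `|z| = r`, so summability at one point is a uniform bound
  -- on the circle and justifies termwise integration.
  have hs : Summable fun n : ℤ => ‖c n‖ * r ^ (-n - 1) := by
    have := (h (circleMap 0 r 0) (hnorm 0)).summable.norm
    refine this.congr fun n => ?_
    rw [norm_mul, norm_zpow, hnorm]
  let F : ℤ → C(ℝ, ℂ) := fun n =>
    ⟨fun θ => deriv (circleMap 0 r) θ • (circleMap 0 r θ ^ m * (c n * circleMap 0 r θ ^ (-n - 1))),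
      by
        have h1 : ∀ k : ℤ, Continuous fun θ : ℝ => circleMap 0 r θ ^ k := fun k =>
          (continuous_circleMap 0 r).zpow₀ k fun θ => Or.inl (hne θ)
        simp only [deriv_circleMap]
        have h2 := continuous_circleMap 0 r
        have h3 := h1 m
        have h4 := h1 (-n - 1)
        fun_prop⟩
  have hF : Summable fun n => ‖(F n).restrict
      (⟨Set.uIcc 0 (2 * Real.pi), isCompact_uIcc⟩ : TopologicalSpace.Compacts ℝ)‖ := by
    refine Summable.of_nonneg_of_le (fun _ => norm_nonneg _) (fun n => ?_)
      (hs.mul_left (r * r ^ m))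
    rw [ContinuousMap.norm_le _ (by positivity)]
    rintro ⟨θ, hθ⟩
    simp only [F, ContinuousMap.restrict_apply, ContinuousMap.coe_mk, deriv_circleMap, norm_smul,
      norm_mul, norm_zpow, hnorm, Complex.norm_I]
    apply le_of_eq
    ring
  have key := intervalIntegral.hasSum_intervalIntegral_of_summable_norm hF
  have e1 : ∀ n, (∫ x in (0 : ℝ)..2 * Real.pi, F n x)
      = if n = m then c m * (2 * Real.pi * Complex.I) else 0 := by
    intro n
    have : (∫ x in (0 : ℝ)..2 * Real.pi, F n x) = ∮ z in C(0, r), c n * z ^ (m - n - 1) := by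
      rw [circleIntegral]
      refine intervalIntegral.integral_congr fun θ _ => ?_
      simp only [F, ContinuousMap.coe_mk]
      rw [show m - n - 1 = m + (-n - 1) by ring, zpow_add₀ (hne θ)]
      simp only [smul_eq_mul]
      ring
    rw [this, circleIntegral.integral_const_mul, circleIntegral_zpow hr]
    by_cases hn : n = m
    · subst hn; simp
    · rw [if_neg (by omega), if_neg hn, mul_zero]
  have e2 : (∫ x in (0 : ℝ)..2 * Real.pi, ∑' n, F n x) = ∮ z in C(0, r), z ^ m * f z := by
    rw [circleIntegral]
    refine intervalIntegral.integral_congr fun θ _ => ?_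
    simp only [F, ContinuousMap.coe_mk]
    exact (((h _ (hnorm θ)).mul_left _).const_smul _).tsum_eq
  rw [e2] at key
  simp only [e1] at key
  have := (hasSum_ite_eq m (c m * (2 * Real.pi * Complex.I))).unique key
  rw [← this]
  have hpi : (2 * Real.pi * Complex.I : ℂ) ≠ 0 := Complex.two_pi_I_ne_zero
  field_simp

/-- Uniqueness of Laurent coefficients. -/
lemma laurent_unique {r : ℝ} (hr : 0 < r) {c c' : ℤ → ℂ} {f : ℂ → ℂ}
    (h : ∀ z : ℂ, ‖z‖ = r → HasSum (fun n => c n * z ^ (-n - 1)) (f z))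
    (h' : ∀ z : ℂ, ‖z‖ = r → HasSum (fun n => c' n * z ^ (-n - 1)) (f z)) : c = c' := by
  funext m
  rw [← circleIntegral_of_hasSum hr h m, circleIntegral_of_hasSum hr h' m]

/-- The residue of `z ^ m f(z)` for a Laurent series converging on a punctured disk. -/
lemma residueAtZero_of_hasSum {ε : ℝ} (hε : 0 < ε) {c : ℤ → ℂ} {f : ℂ → ℂ}
    (h : ∀ z : ℂ, z ≠ 0 → ‖z‖ < ε → HasSum (fun n => c n * z ^ (-n - 1)) (f z)) (m : ℤ) :
    residueAtZero (fun z => z ^ m * f z) = c m := by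
  refine Tendsto.limUnder_eq ?_
  refine tendsto_const_nhds.congr' ?_
  filter_upwards [Ioo_mem_nhdsGT hε] with r hr
  refine (circleIntegral_of_hasSum hr.1 (fun z hz => h z ?_ ?_) m).symm
  · rintro rfl; simp at hz; exact hr.1.ne hz
  · rw [hz]; exact hr.2

lemma residueAtZero_congr {ε : ℝ} (hε : 0 < ε) {f g : ℂ → ℂ}
    (h : ∀ z : ℂ, z ≠ 0 → ‖z‖ < ε → f z = g z) : residueAtZero f = residueAtZero g := by
  have : ∀ᶠ r in 𝓝[>] (0 : ℝ), (2 * Real.pi * Complex.I)⁻¹ * (∮ z in C(0, r), f z) =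
      (2 * Real.pi * Complex.I)⁻¹ * ∮ z in C(0, r), g z := by
    filter_upwards [Ioo_mem_nhdsGT hε] with r hr
    congr 1
    refine circleIntegral.integral_congr hr.1.le fun z hz => h z ?_ ?_
    · rintro rfl; simp at hz; exact hr.1.ne hz
    · simp at hz; rw [hz]; exact hr.2
  unfold residueAtZero limUnder
  rw [Filter.map_congr this]

end Laurent

/-! ### From analytic fields to modes -/

section Modes

variable {V : ℤ → Type u} [∀ k, AddCommGroup (V k)] [∀ k, Module ℂ (V k)]

/-- Under `z = exp w` the operator `z d/dz` becomes `d/dw`, and `g (exp w) exp (-e w / 2)` has zero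
derivative. -/
lemma eq_exp_of_euler {g : ℂ → ℂ} {e : ℤ} (hg : DifferentiableOn ℂ g {0}ᶜ)
    (h : ∀ z, z ≠ 0 → z * deriv g z = ((e : ℂ) / 2) * g z) (w : ℂ) :
    g (Complex.exp w) = g 1 * Complex.exp ((e : ℂ) / 2 * w) := by
  have hd : ∀ w, HasDerivAt (fun w => g (Complex.exp w) * Complex.exp (-((e : ℂ) / 2 * w))) 0 w := by
    intro w
    have h0 := Complex.exp_ne_zero w
    have h1 : HasDerivAt g (deriv g (Complex.exp w)) (Complex.exp w) :=
      (hg.differentiableAt (isOpen_compl_singleton.mem_nhds h0)).hasDerivAt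
    have h2 := h1.comp w (Complex.hasDerivAt_exp w)
    have h3 : HasDerivAt (fun w : ℂ => -((e : ℂ) / 2 * w)) (-((e : ℂ) / 2)) w := by
      simpa using ((hasDerivAt_id w).const_mul ((e : ℂ) / 2)).fun_neg
    refine (h2.fun_mul h3.cexp).congr_deriv ?_
    simp only [Function.comp]
    have := h _ h0
    linear_combination (Complex.exp (-((e : ℂ) / 2 * w))) * this
  have := is_const_of_deriv_eq_zero (fun w => (hd w).differentiableAt) (fun w => (hd w).deriv) w 0
  simp only [Complex.exp_zero, mul_zero, neg_zero, mul_one] at this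
  rw [← this, mul_assoc, ← Complex.exp_add]
  simp

/-- For odd `e` the solution changes sign along a loop around the origin (`w = 2πi`), whereas `g` is
single-valued; hence `g 1 = 0`. -/
lemma eq_zpow_of_euler {g : ℂ → ℂ} {e : ℤ} (hg : DifferentiableOn ℂ g {0}ᶜ)
    (h : ∀ z, z ≠ 0 → z * deriv g z = ((e : ℂ) / 2) * g z) {z : ℂ} (hz : z ≠ 0) :
    g z = if Even e then g 1 * z ^ (e / 2) else 0 := by
  have h1 := eq_exp_of_euler hg h (Complex.log z)
  rw [Complex.exp_log hz] at h1
  split_ifs with he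
  · obtain ⟨m, rfl⟩ := he
    rw [h1, show (m + m) / 2 = m by omega]
    congr 1
    rw [show (((m + m : ℤ) : ℂ) / 2 * Complex.log z) = m * Complex.log z by push_cast; ring,
      Complex.exp_int_mul, Complex.exp_log hz]
  · have h2 := eq_exp_of_euler hg h (2 * Real.pi * Complex.I)
    rw [Complex.exp_two_pi_mul_I] at h2
    obtain ⟨m, rfl⟩ := Int.not_even_iff_odd.1 he
    rw [show (((2 * m + 1 : ℤ) : ℂ) / 2 * (2 * Real.pi * Complex.I))
      = m * (2 * Real.pi * Complex.I) + Real.pi * Complex.I by push_cast; ring, Complex.exp_add,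
      Complex.exp_int_mul_two_pi_mul_I, Complex.exp_pi_mul_I] at h2
    have h3 : g 1 = 0 := by linear_combination h2 / 2
    rw [h1, h3, zero_mul]

/-- The modes of an analytic field of weight `d / 2`. -/
def modesOf (d : ℤ) (ψ : ℂ → Total V →ₗ[ℂ] Completion V) : Modes V := fun n =>
  -- At `z = 1` all powers of `z` are `1`, so the modes are the homogeneous components of `ψ 1`.
  DirectSum.toModule ℂ ℤ _ fun l => compL (l + (d - 2 * n - 2)) ∘ₗ ψ 1 ∘ₗ ofDeg l

lemma modesOf_ofDeg (d : ℤ) (ψ : ℂ → Total V →ₗ[ℂ] Completion V) (n l : ℤ) (x : V l) :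
    modesOf d ψ n (ofDeg l x) = comp (l + (d - 2 * n - 2)) (ψ 1 (ofDeg l x)) := by
  simp only [modesOf, ofDeg, DirectSum.toModule_lof]
  rfl

lemma isHomog_modesOf (d : ℤ) (ψ : ℂ → Total V →ₗ[ℂ] Completion V) : IsHomog d (modesOf d ψ) := by
  intro n l x j hj
  rw [modesOf_ofDeg]
  exact ofDeg_ne _ hj

variable {ψ : ℂ → Total V →ₗ[ℂ] Completion V} {d : ℤ}

/-- An analytic map with the `L(0)`-bracket of a field of weight `d / 2` is determined by its
modes. -/
lemma eq_evalAt_modesOf (han : ∀ v, IsAnalytic fun z => ψ z v)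
    (hbr : ∀ v (v' : GradedDual V) (z : ℂ), z ≠ 0 →
      pair v' (weightCompl (ψ z v)) - pair v' (ψ z (weight v))
        = z * dcoeff (fun x => ψ x v) v' z + ((d : ℂ) / 2) * pair v' (ψ z v))
    {z : ℂ} (hz : z ≠ 0) : ψ z = evalAt d (modesOf d ψ) z := by
  refine DirectSum.linearMap_ext ℂ fun l => ?_
  refine LinearMap.ext fun x => ?_
  change ψ z (ofDeg l x) = evalAt d (modesOf d ψ) z (ofDeg l x)
  funext j
  rw [← sub_eq_zero, ← Module.forall_dual_apply_eq_zero_iff ℂ]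
  intro f
  rw [map_sub, sub_eq_zero]
  have h1 := han (ofDeg l x) (dualOf j f)
  have h2 := fun z hz => hbr (ofDeg l x) (dualOf j f) z hz
  simp only [dcoeff, pair_dualOf, weight_ofDeg, map_smul, Pi.smul_apply, weightCompl] at h1 h2
  have h3 := eq_zpow_of_euler (e := j - l - d) h1 (fun z hz => by
    have := h2 z hz
    push_cast
    simp only [smul_eq_mul] at this
    linear_combination -this) hz
  rw [h3, evalAt_ofDeg]
  by_cases he : Even (d + l - j)
  · obtain ⟨m, hm⟩ := he
    have he1 : Even (j - l - d) := ⟨-m, by omega⟩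
    have he2 : Even (d + l - j) := ⟨m, hm⟩
    rw [if_pos he1, if_pos he2, modesOf_ofDeg, map_smul, smul_eq_mul, mul_comm]
    have e1 : (j - l - d) / 2 = -((d + l - j) / 2) := by omega
    have e2 : l + (d - 2 * ((d + l - j) / 2 - 1) - 2) = j := by omega
    rw [e1, e2]
    congr 2
    exact (ofDeg_same j _).symm
  · rw [if_neg he, if_neg (by rintro ⟨m, hm⟩; exact he ⟨-m, by omega⟩), map_zero]

/-- The vector `a n v` lies in the graded space and satisfies the defining integral identity, so the
default value in `laurentCoeff` is not taken and the chosen vector must be this one. -/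
lemma mode_eq_of_evalAt {a : Modes V} (ha : IsHomog d a)
    (h : ∀ z : ℂ, z ≠ 0 → ψ z = evalAt d a z) (n : ℤ) (v : Total V) : mode ψ n v = a n v := by
  have key : ∀ v' : GradedDual V, pair v' (incl (a n v)) =
      (2 * Real.pi * Complex.I)⁻¹ * ∮ z in C(0, 1), z ^ n * pair v' (ψ z v) := by
    intro v'
    refine (circleIntegral_of_hasSum (c := fun n => pair v' (incl (a n v))) one_pos
      (fun z hz => ?_) n).symm
    have : z ≠ 0 := by rintro rfl; simp at hz
    rw [h z this]
    exact hasSum_evalAt ha z v v'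
  unfold mode laurentCoeff
  have hex : ∃ w : Total V, ∀ v' : GradedDual V, pair v' (incl w) =
      (2 * Real.pi * Complex.I)⁻¹ * ∮ z in C(0, 1), z ^ n * pair v' (ψ z v) := ⟨_, key⟩
  rw [dif_pos hex]
  exact total_ext fun v' => by rw [hex.choose_spec v', key v']

lemma mode_congr {ψ' : ℂ → Total V →ₗ[ℂ] Completion V}
    (h : ∀ z : ℂ, z ≠ 0 → ψ z = ψ' z) (n : ℤ) (v : Total V) : mode ψ n v = mode ψ' n v := by
  unfold mode laurentCoeff
  have : (fun v' : GradedDual V => (2 * Real.pi * Complex.I)⁻¹ *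
      ∮ z in C(0, 1), z ^ n * pair v' (ψ z v)) = fun v' => (2 * Real.pi * Complex.I)⁻¹ *
      ∮ z in C(0, 1), z ^ n * pair v' (ψ' z v) := by
    funext v'
    congr 1
    refine circleIntegral.integral_congr zero_le_one fun z hz => ?_
    simp only [h z (by rintro rfl; simp at hz)]
  classical
  change (if h : ∃ w : Total V, ∀ v' : GradedDual V, pair v' (incl w) =
    (fun v' : GradedDual V => (2 * Real.pi * Complex.I)⁻¹ *
      ∮ z in C(0, 1), z ^ n * pair v' (ψ z v)) v' then h.choose else 0) = _
  rw [this]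

/-- The derivative of a field is given by the modes `-n a_{n-1}`. -/
def derivModes (a : Modes V) : Modes V := fun n => (-n : ℂ) • a (n - 1)

lemma isHomog_derivModes {a : Modes V} (ha : IsHomog d a) : IsHomog (d + 2) (derivModes a) := by
  intro n l x j hj
  rw [derivModes, LinearMap.smul_apply, DirectSum.smul_apply, ha (n - 1) l x j (by omega),
    smul_zero]

lemma dcoeff_evalAt {a : Modes V} (ha : IsHomog d a) (v : Total V) (v' : GradedDual V) {z : ℂ}
    (hz : z ≠ 0) : HasDerivAt (fun x => pair v' (evalAt d a x v))
      (pair v' (evalAt (d + 2) (derivModes a) z v)) z := by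
  induction v' using gradedDual_induction with
  | h0 => simpa using hasDerivAt_const z (0 : ℂ)
  | h2 x y hx hy => simpa only [map_add, LinearMap.add_apply] using hx.fun_add hy
  | h1 j f =>
    induction v using total_induction with
    | h0 => simpa using hasDerivAt_const z (0 : ℂ)
    | h2 x y hx hy => simpa only [map_add, LinearMap.add_apply] using hx.fun_add hy
    | h1 l x =>
      simp only [pair_dualOf, evalAt_ofDeg]
      by_cases he : Even (d + l - j)
      · obtain ⟨m, hm⟩ := id he
        have he2 : Even (d + 2 + l - j) := ⟨m + 1, by omega⟩
        simp only [if_pos he, if_pos he2, map_smul, smul_eq_mul]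
        rw [show (d + l - j) / 2 = m by omega, show (d + 2 + l - j) / 2 = m + 1 by omega]
        refine ((hasDerivAt_zpow (-m) z (Or.inl hz)).mul_const
          (f ((a (m - 1)) (ofDeg l x) j))).congr_deriv ?_
        simp only [derivModes, LinearMap.smul_apply, DirectSum.smul_apply, map_smul, smul_eq_mul]
        rw [show m + 1 - 1 - 1 = m - 1 by ring, show -(m + 1) = -m - 1 by ring]
        push_cast
        ring
      · have h2 : ¬ Even (d + 2 + l - j) := by
          rintro ⟨m, hm⟩; exact he ⟨m - 1, by omega⟩
        simp only [if_neg he, if_neg h2, map_zero]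
        exact hasDerivAt_const z (0 : ℂ)

lemma isAnalytic_evalAt {a : Modes V} (ha : IsHomog d a) (v : Total V) :
    IsAnalytic fun z => evalAt d a z v := fun v' z hz =>
  (dcoeff_evalAt ha v v' hz).differentiableAt.differentiableWithinAt

lemma weight_bracket_evalAt {a : Modes V} (ha : IsHomog d a) (v : Total V) (v' : GradedDual V)
    {z : ℂ} (hz : z ≠ 0) :
    pair v' (weightCompl (evalAt d a z v)) - pair v' (evalAt d a z (weight v))
      = z * dcoeff (fun x => evalAt d a x v) v' z + ((d : ℂ) / 2) * pair v' (evalAt d a z v) := by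
  rw [dcoeff, (dcoeff_evalAt ha v v' hz).deriv]
  induction v' using gradedDual_induction with
  | h0 => simp
  | h2 x y hx hy => simp only [map_add, LinearMap.add_apply]; linear_combination hx + hy
  | h1 j f =>
    induction v using total_induction with
    | h0 => simp [pair_dualOf, weightCompl]
    | h2 x y hx hy =>
      simp only [map_add, pair_dualOf, weightCompl, Pi.add_apply, smul_add] at *
      linear_combination hx + hy
    | h1 l x =>
      simp only [pair_dualOf, weightCompl, weight_ofDeg, map_smul, Pi.smul_apply, evalAt_ofDeg,
        smul_eq_mul]
      by_cases he : Even (d + l - j)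
      · obtain ⟨m, hm⟩ := id he
        have he2 : Even (d + 2 + l - j) := ⟨m + 1, by omega⟩
        rw [if_pos he, if_pos he2]
        rw [show (d + l - j) / 2 = m by omega, show (d + 2 + l - j) / 2 = m + 1 by omega]
        simp only [derivModes, LinearMap.smul_apply, DirectSum.smul_apply, map_smul, smul_eq_mul]
        rw [show m + 1 - 1 - 1 = m - 1 by ring, show -(m + 1) = -m - 1 by ring, zpow_sub_one₀ hz]
        have hm' : (d : ℂ) + l - j = m + m := by exact_mod_cast hm
        push_cast
        field_simp
        linear_combination (-f ((a (m - 1)) (ofDeg l x) j)) * hm'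
      · have h2 : ¬ Even (d + 2 + l - j) := by
          rintro ⟨m, hm⟩; exact he ⟨m - 1, by omega⟩
        simp [if_neg he, if_neg h2]

/-- `[L, a_n] = -n a_{n-1}`. -/
def IsCovariant (L : Module.End ℂ (Total V)) (a : Modes V) : Prop :=
  ∀ n v, L (a n v) - a n (L v) = (-n : ℂ) • a (n - 1) v

/-- The formal version of `[L(-1), φ(z)] = (d/dz) φ(z)`. -/
lemma isCovariant_of_hasSum {L : Module.End ℂ (Total V)} {a : Modes V} (ha : IsHomog d a)
    (h : ∀ v (v' : GradedDual V) (z : ℂ), z ≠ 0 →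
      HasSum (fun k : ℤ => pair v' (incl (L (comp k (evalAt d a z v)))))
        (dcoeff (fun x => evalAt d a x v) v' z + pair v' (evalAt d a z (L v)))) :
    IsCovariant L a := by
  intro n v
  induction v using total_induction with
  | h0 => simp
  | h2 x y hx hy => simp only [map_add, smul_add]; rw [← hx, ← hy]; abel
  | h1 l x =>
    refine total_ext fun v' => ?_
    have key : (fun n => pair v' (incl (L (a n (ofDeg l x))))) = fun n =>
        pair v' (incl (derivModes a n (ofDeg l x))) + pair v' (incl (a n (L (ofDeg l x)))) := by
      refine laurent_unique one_pos (f := fun z => dcoeff (fun x_1 => evalAt d a x_1 (ofDeg l x)) v' z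
        + pair v' (evalAt d a z (L (ofDeg l x)))) (fun z hz => ?_) (fun z hz => ?_)
      · have hz0 : z ≠ 0 := by rintro rfl; simp at hz
        have h1 := h (ofDeg l x) v' z hz0
        -- On a homogeneous vector the component of weight index `l + d - 2n - 2` is `z ^ (-n-1)
        -- a_n`, so the sum over components is a Laurent series in disguise.
        have hinj : Function.Injective fun n : ℤ => l + (d - 2 * n - 2) := fun n m hnm => by
          simp only at hnm; omega
        rw [← hinj.hasSum_iff] at h1
        · convert h1 using 2 with m
          have : comp (l + (d - 2 * m - 2)) (evalAt d a z (ofDeg l x))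
              = z ^ (-m - 1) • a m (ofDeg l x) := by
            rw [comp, evalAt_ofDeg, if_pos (⟨m + 1, by ring⟩),
              show (d + l - (l + (d - 2 * m - 2))) / 2 = m + 1 by omega, map_smul,
              show -(m + 1) = -m - 1 by ring, show m + 1 - 1 = m by ring]
            rw [← (ha m).eq]
          simp only [Function.comp]
          rw [this, map_smul, incl_smul, map_smul, smul_eq_mul, mul_comm]
        · intro k hk
          have : comp k (evalAt d a z (ofDeg l x)) = 0 := by
            rw [comp, evalAt_ofDeg, if_neg, map_zero]
            rintro ⟨m, hm⟩
            exact hk ⟨m - 1, by simp only; omega⟩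
          rw [this, map_zero, incl_zero, map_zero]
      · have hz0 : z ≠ 0 := by rintro rfl; simp at hz
        simp only [add_mul]
        refine HasSum.add ?_ (hasSum_evalAt ha z _ v')
        rw [dcoeff, (dcoeff_evalAt ha _ v' hz0).deriv]
        exact hasSum_evalAt (isHomog_derivModes ha) z _ v'
    have := congrFun key n
    simp only [derivModes, LinearMap.smul_apply] at this
    rw [incl_sub, map_sub, this, add_sub_cancel_right]

end Modes

lemma _root_.HasSum.of_eq {ι : Type*} {f g : ι → ℂ} {s : ℂ} (h : HasSum f s)
    (e : ∀ i, g i = f i) : HasSum g s := by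
  rwa [funext e]

/-! ### Generalized binomial coefficients -/

section Binomial

lemma choose_succ_mul (m : ℂ) (j : ℕ) :
    ((j : ℂ) + 1) * Ring.choose m (j + 1) = (m - j) * Ring.choose m j := by
  have h : ∀ j : ℕ, (j.factorial : ℂ) * Ring.choose m j = (descPochhammer ℂ j).eval m := by
    intro j
    have := Ring.descPochhammer_eq_factorial_smul_choose m j
    rw [← Polynomial.aeval_eq_smeval, Polynomial.aeval_def, Polynomial.eval₂_eq_eval_map,
      descPochhammer_map] at this
    rw [this, nsmul_eq_mul]
  have h1 := h (j + 1)
  rw [descPochhammer_succ_eval, ← h j, Nat.factorial_succ] at h1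
  have : (j.factorial : ℂ) ≠ 0 := by exact_mod_cast j.factorial_ne_zero
  apply mul_left_cancel₀ this
  push_cast at h1
  linear_combination h1

lemma choose_neg_nat (k j : ℕ) :
    Ring.choose (-(k : ℂ) - 1) j = (-1) ^ j * ((k + j).choose k : ℂ) := by
  have := Ring.choose_neg ((k : ℂ) + 1) j
  rw [show -((k : ℂ) + 1) = -(k : ℂ) - 1 by ring] at this
  rw [this, show (k : ℂ) + 1 + j - 1 = ((k + j : ℕ) : ℂ) by push_cast; ring, Ring.choose_natCast,
    Nat.choose_symm_add]
  simp [Units.smul_def, Int.negOnePow_def]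

end Binomial

/-! ### The formal residue defining products of fields -/

section FormalProduct

variable {X : Type*} [AddCommGroup X] [Module ℂ X]

/-- The coefficients of `(x-z)^m A(x,z) - (-z+x)^m B(x,z)` that contribute to the residue. -/
def resTerm (m n : ℤ) (A B : ℤ → ℤ → X) (j : ℕ) : X :=
  (-1 : ℂ) ^ j • A (m - j) (n + j) - (-1 : ℂ) ^ (m - j) • B j (m + n - j)

/-- The coefficient of `z ^ (-n-1)` in `Res_x ((x-z)^m A(x,z) - (-z+x)^m B(x,z))`. -/
def resCoeff (m n : ℤ) (A B : ℤ → ℤ → X) : X :=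
  ∑ᶠ j : ℕ, Ring.choose (m : ℂ) j • resTerm m n A B j

/-- On each antidiagonal, `A` vanishes in one direction and `B` in the other. -/
def Truncated (A B : ℤ → ℤ → X) : Prop :=
  ∀ s : ℤ, ∃ J : ℤ, ∀ j ≥ J, A (s - j) j = 0 ∧ B j (s - j) = 0

/-- Both arguments stay on the antidiagonal of sum `m + n`, where truncation leaves finitely many
terms; the `finsum` in `resCoeff` is then an honest finite sum. -/
lemma Truncated.resTerm_eq_zero {A B : ℤ → ℤ → X} (h : Truncated A B) (m n : ℤ) :
    ∃ K : ℕ, ∀ j ≥ K, resTerm m n A B j = 0 := by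
  obtain ⟨J, hJ⟩ := h (m + n)
  refine ⟨(|J| + |n|).toNat, fun j hj => ?_⟩
  have hj' : |J| + |n| ≤ (j : ℤ) := by
    have := abs_nonneg J; have := abs_nonneg n; omega
  have h1 := (hJ (n + j) (by have := le_abs_self J; have := neg_abs_le n; omega)).1
  have h2 := (hJ j (by have := le_abs_self J; have := abs_nonneg n; omega)).2
  rw [show m + n - (n + j) = m - j by ring] at h1
  simp [resTerm, h1, h2]

lemma resCoeff_eq_sum {A B : ℤ → ℤ → X} {m n : ℤ} {K : ℕ}
    (h : ∀ j ≥ K, resTerm m n A B j = 0) :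
    resCoeff m n A B = ∑ j ∈ Finset.range K, Ring.choose (m : ℂ) j • resTerm m n A B j := by
  refine finsum_eq_sum_of_support_subset _ fun j hj => ?_
  simp only [Finset.coe_range, Set.mem_Iio]
  by_contra hj'
  exact hj (by simp [h j (not_lt.1 hj')])

lemma resCoeff_add {A B A' B' : ℤ → ℤ → X} (h : Truncated A B) (h' : Truncated A' B') (m n : ℤ) :
    resCoeff m n (A + A') (B + B') = resCoeff m n A B + resCoeff m n A' B' := by
  obtain ⟨K, hK⟩ := h.resTerm_eq_zero m n
  obtain ⟨K', hK'⟩ := h'.resTerm_eq_zero m n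
  have e : ∀ j, resTerm m n (A + A') (B + B') j = resTerm m n A B j + resTerm m n A' B' j := by
    intro j
    simp only [resTerm, Pi.add_apply, smul_add]
    abel
  rw [resCoeff_eq_sum (K := max K K') fun j hj => hK j (le_trans (le_max_left _ _) hj),
    resCoeff_eq_sum (K := max K K') fun j hj => hK' j (le_trans (le_max_right _ _) hj),
    resCoeff_eq_sum (K := max K K') fun j hj => by
      rw [e, hK j (le_trans (le_max_left _ _) hj), hK' j (le_trans (le_max_right _ _) hj), add_zero],
    ← Finset.sum_add_distrib]
  exact Finset.sum_congr rfl fun j _ => by rw [e, smul_add]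

lemma map_resCoeff {X' : Type*} [AddCommGroup X'] [Module ℂ X'] (f : X →ₗ[ℂ] X')
    {A B : ℤ → ℤ → X} (h : Truncated A B) (m n : ℤ) :
    f (resCoeff m n A B) = resCoeff m n (fun p q => f (A p q)) (fun p q => f (B p q)) := by
  obtain ⟨K, hK⟩ := h.resTerm_eq_zero m n
  have e : ∀ j, resTerm m n (fun p q => f (A p q)) (fun p q => f (B p q)) j
      = f (resTerm m n A B j) := by
    intro j
    simp only [resTerm, map_sub, map_smul]
  rw [resCoeff_eq_sum hK, map_sum, resCoeff_eq_sum (K := K) fun j hj => by rw [e, hK j hj, map_zero]]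
  exact Finset.sum_congr rfl fun j _ => by rw [e, map_smul]

lemma Truncated.map {X' : Type*} [AddCommGroup X'] [Module ℂ X'] (f g : X →ₗ[ℂ] X')
    {A B : ℤ → ℤ → X} (h : Truncated A B) :
    Truncated (fun p q => f (A p q)) (fun p q => g (B p q)) := by
  intro s
  obtain ⟨J, hJ⟩ := h s
  exact ⟨J, fun j hj => ⟨by simp [(hJ j hj).1], by simp [(hJ j hj).2]⟩⟩

lemma Truncated.mulDiff {A B : ℤ → ℤ → X} (h : Truncated A B) :
    Truncated (mulDiff A) (mulDiff B) := by
  intro s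
  obtain ⟨J, hJ⟩ := h (s + 1)
  refine ⟨J, fun j hj => ⟨?_, ?_⟩⟩
  · have h1 := (hJ j hj).1
    have h2 := (hJ (j + 1) (by omega)).1
    rw [show s + 1 - j = s - j + 1 by ring] at h1
    rw [show s + 1 - (j + 1) = s - j by ring] at h2
    rw [HalfGraded.mulDiff, h1, h2, sub_zero]
  · have h1 := (hJ j hj).2
    have h2 := (hJ (j + 1) (by omega)).2
    rw [show s + 1 - j = s - j + 1 by ring] at h1
    rw [show s + 1 - (j + 1) = s - j by ring] at h2
    rw [HalfGraded.mulDiff, h1, h2, sub_zero]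

lemma Truncated.mulDiff_iterate {A B : ℤ → ℤ → X} (h : Truncated A B) (N : ℕ) :
    Truncated (HalfGraded.mulDiff^[N] A) (HalfGraded.mulDiff^[N] B) := by
  induction N with
  | zero => exact h
  | succ N ih => rw [Function.iterate_succ_apply', Function.iterate_succ_apply']; exact ih.mulDiff

/-- A factor `x - z` can be absorbed into `(x - z)^m`. In coefficients this is Pascal's rule
together with a shift of the summation index. -/
lemma resCoeff_mulDiff {A B : ℤ → ℤ → X} (h : Truncated A B) (m n : ℤ) :
    resCoeff m n (mulDiff A) (mulDiff B) = resCoeff (m + 1) n A B := by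
  obtain ⟨K, hK⟩ := h.resTerm_eq_zero (m + 1) n
  have hm1 : (-1 : ℂ) ≠ 0 := by norm_num
  have e : ∀ j, resTerm m n (mulDiff A) (mulDiff B) j
      = resTerm (m + 1) n A B j + resTerm (m + 1) n A B (j + 1) := by
    intro j
    simp only [resTerm, HalfGraded.mulDiff]
    rw [show m + 1 - (j : ℤ) = m - j + 1 by ring,
      show m + 1 - ((j + 1 : ℕ) : ℤ) = m - j by push_cast; ring,
      show m + 1 + n - (j : ℤ) = m + n - j + 1 by ring,
      show m + 1 + n - ((j + 1 : ℕ) : ℤ) = m + n - j by push_cast; ring,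
      zpow_add_one₀ hm1, pow_succ]
    push_cast
    rw [show n + ((j : ℤ) + 1) = n + j + 1 by ring]
    module
  rw [resCoeff_eq_sum (K := K) fun j hj => by rw [e, hK j hj, hK (j + 1) (by omega), add_zero],
    resCoeff_eq_sum (K := K + 1) fun j hj => hK j (by omega), Finset.sum_range_succ']
  simp only [e, smul_add, Finset.sum_add_distrib]
  push_cast
  simp only [Ring.choose_succ_succ, add_smul, Finset.sum_add_distrib, Ring.choose_zero_right]
  have : ∑ j ∈ Finset.range K, Ring.choose (m : ℂ) j • resTerm (m + 1) n A B j =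
      (∑ j ∈ Finset.range K, Ring.choose (m : ℂ) (j + 1) • resTerm (m + 1) n A B (j + 1))
        + (1 : ℂ) • resTerm (m + 1) n A B 0 := by
    have h1 := Finset.sum_range_succ' (fun j => Ring.choose (m : ℂ) j • resTerm (m + 1) n A B j) K
    rw [Finset.sum_range_succ, hK K le_rfl, smul_zero, add_zero] at h1
    rw [h1, Ring.choose_zero_right]
  rw [this]
  abel

lemma resCoeff_mulDiff_iterate {A B : ℤ → ℤ → X} (h : Truncated A B) (N : ℕ) (m n : ℤ) :
    resCoeff m n (mulDiff^[N] A) (mulDiff^[N] B) = resCoeff (m + N) n A B := by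
  induction N generalizing m with
  | zero => simp
  | succ N ih =>
    rw [Function.iterate_succ_apply', Function.iterate_succ_apply',
      resCoeff_mulDiff (h.mulDiff_iterate N), ih]
    congr 1
    push_cast; ring

/-- For `m ≥ 0` the two expansions of `(x - z)^m` are the same polynomial, so the two halves cancel
under the reflection `j ↦ m - j`. -/
lemma resCoeff_self_nat (m : ℕ) (n : ℤ) (H : ℤ → ℤ → X) : resCoeff (m : ℤ) n H H = 0 := by
  have hm1 : (-1 : ℂ) ≠ 0 := by norm_num
  have h1 : resCoeff (m : ℤ) n H H = ∑ j ∈ Finset.range (m + 1),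
      Ring.choose ((m : ℤ) : ℂ) j • resTerm m n H H j := by
    refine finsum_eq_sum_of_support_subset _ fun j hj => ?_
    simp only [Finset.coe_range, Set.mem_Iio]
    by_contra hj'
    refine hj ?_
    simp only [Int.cast_natCast, Ring.choose_natCast,
      Nat.choose_eq_zero_of_lt (show m < j by omega), Nat.cast_zero, zero_smul]
  rw [h1]
  simp only [resTerm, smul_sub, Finset.sum_sub_distrib, sub_eq_zero]
  rw [← Finset.sum_range_reflect]
  refine Finset.sum_congr rfl fun j hj => ?_
  have hj : j ≤ m := by simpa [Nat.lt_succ_iff] using hj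
  simp only [Int.cast_natCast, Ring.choose_natCast]
  rw [show m + 1 - 1 - j = m - j by omega, Nat.choose_symm hj,
    show ((m - j : ℕ) : ℤ) = (m : ℤ) - j by omega, ← zpow_natCast,
    show ((m - j : ℕ) : ℤ) = (m : ℤ) - j by omega]
  congr 3 <;> ring

/-- Of `(x - z)^m`, the factor `(x - z)^N` makes `A` and `B` equal and the remaining power is
nonnegative, so the residue cancels. -/
lemma resCoeff_eq_zero_of_iterate_eq {A B : ℤ → ℤ → X} (h : Truncated A B) {N : ℕ}
    (hN : mulDiff^[N] A = mulDiff^[N] B) {m : ℤ} (hm : N ≤ m) (n : ℤ) : resCoeff m n A B = 0 := by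
  obtain ⟨k, rfl⟩ : ∃ k : ℕ, m = k + N := ⟨(m - N).toNat, by omega⟩
  rw [← resCoeff_mulDiff_iterate h, hN, resCoeff_self_nat]

/-- For a series that is truncated in both directions, the residue is a derivative on the
diagonal. -/
lemma hasSum_resCoeff_neg {H : ℤ → ℤ → ℂ} (h : Truncated H H) (k : ℕ) (n : ℤ) :
    HasSum (fun p : ℤ => Ring.choose (-p - 1 : ℂ) k * H p (n - k - 1 - p))
      (resCoeff (-k - 1) n H H) := by
  obtain ⟨J, hJ⟩ := h (n - k - 1)
  have hm1 : (-1 : ℂ) ≠ 0 := by norm_num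
  set a : ℕ → ℂ := fun j => Ring.choose ((-k - 1 : ℤ) : ℂ) j *
    ((-1 : ℂ) ^ j * H (-k - 1 - j) (n + j)) with ha
  set b : ℕ → ℂ := fun j => -(Ring.choose ((-k - 1 : ℤ) : ℂ) j *
    ((-1 : ℂ) ^ ((-k - 1 : ℤ) - j) * H j (-k - 1 + n - j))) with hb
  obtain ⟨K, hK⟩ : ∃ K : ℕ, ∀ j ≥ K, a j = 0 ∧ b j = 0 := by
    refine ⟨(|J| + |n|).toNat, fun j hj => ?_⟩
    have hj' : |J| + |n| ≤ (j : ℤ) := by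
      have := abs_nonneg J; have := abs_nonneg n; omega
    have h1 := (hJ (n + j) (by have := le_abs_self J; have := neg_abs_le n; omega)).1
    have h2 := (hJ j (by have := le_abs_self J; have := abs_nonneg n; omega)).2
    rw [show n - k - 1 - (n + j) = -k - 1 - j by ring] at h1
    rw [show n - k - 1 - (j : ℤ) = -k - 1 + n - j by ring] at h2
    simp [ha, hb, h1, h2]
  have hsa : HasSum a (∑ j ∈ Finset.range K, a j) :=
    hasSum_sum_of_ne_finset_zero fun j hj => (hK j (by simpa using hj)).1
  have hsb : HasSum b (∑ j ∈ Finset.range K, b j) :=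
    hasSum_sum_of_ne_finset_zero fun j hj => (hK j (by simpa using hj)).2
  have hsum : resCoeff (-k - 1) n H H = (∑ j ∈ Finset.range K, b j) +
      ∑ j ∈ Finset.range K, a j := by
    rw [← Finset.sum_add_distrib]
    have : ∀ j, Ring.choose ((-k - 1 : ℤ) : ℂ) j • resTerm (-k - 1) n H H j = b j + a j := by
      intro j
      simp only [resTerm, ha, hb, smul_eq_mul]
      ring
    rw [resCoeff]
    simp only [this]
    refine finsum_eq_sum_of_support_subset _ fun j hj => ?_
    simp only [Finset.coe_range, Set.mem_Iio]
    by_contra hj'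
    exact hj (by simp [hK j (not_lt.1 hj')])
  rw [hsum]
  have hcast : ((-k - 1 : ℤ) : ℂ) = -(k : ℂ) - 1 := by push_cast; ring
  refine HasSum.of_nat_of_neg_add_one ?_ ?_
  · convert hsb using 2 with j
    simp only [hb]
    rw [hcast, choose_neg_nat, show -(((j : ℕ) : ℤ) : ℂ) - 1 = -(j : ℂ) - 1 by push_cast; ring,
      choose_neg_nat, show n - k - 1 - (j : ℤ) = -k - 1 + n - j by ring,
      show (-k - 1 : ℤ) - j = -((k : ℤ) + j + 1) by ring, zpow_neg,
      ← inv_zpow, show (-1 : ℂ)⁻¹ = -1 by norm_num, zpow_add_one₀ hm1, zpow_add₀ hm1,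
      zpow_natCast, zpow_natCast, add_comm j k, Nat.choose_symm_add]
    have : ((-1 : ℂ) ^ j) * (-1) ^ j = 1 := by rw [← mul_pow]; norm_num
    linear_combination (-((k + j).choose j : ℂ) * (-1) ^ k * H j (-k - 1 + n - j)) * this
  -- Indices `p ≥ 0` come from the second expansion and `p < 0` from the first. With `p = -(i+1)`
  -- the binomial is `choose i k`, which vanishes for `i < k`; this accounts for the shift by `k`.
  · rw [← hasSum_nat_add_iff' k]
    have e0 : ∑ i ∈ Finset.range k, Ring.choose (-((-((i : ℤ) + 1) : ℤ) : ℂ) - 1) k *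
        H (-((i : ℤ) + 1)) (n - k - 1 - -((i : ℤ) + 1)) = 0 := by
      refine Finset.sum_eq_zero fun j hj => ?_
      rw [show -(((-((j : ℤ) + 1)) : ℤ) : ℂ) - 1 = (j : ℂ) by push_cast; ring,
        Ring.choose_natCast, Nat.choose_eq_zero_of_lt (by simpa using hj)]
      simp
    rw [e0, sub_zero]
    refine hsa.of_eq fun j => ?_
    simp only [ha]
    rw [hcast, choose_neg_nat]
    rw [show -(((-(((j + k : ℕ) : ℤ) + 1)) : ℤ) : ℂ) - 1 = ((k + j : ℕ) : ℂ) by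
      push_cast; ring, Ring.choose_natCast]
    have : ((-1 : ℂ) ^ j) * (-1) ^ j = 1 := by rw [← mul_pow]; norm_num
    rw [show -(((j + k : ℕ) : ℤ) + 1) = -k - 1 - (j : ℤ) by push_cast; ring,
      show n - k - 1 - (-k - 1 - (j : ℤ)) = n + j by ring]
    linear_combination (-((k + j).choose k : ℂ) * H (-k - 1 - j) (n + j)) * this

end FormalProduct

/-! ### Multiplication by differences of variables -/

section MulDiff

variable {X : Type*} [AddCommGroup X]

lemma mulDiff_add (A B : ℤ → ℤ → X) : mulDiff (A + B) = mulDiff A + mulDiff B := by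
  funext m n; simp only [mulDiff, Pi.add_apply]; abel

lemma mulDiff_zero : mulDiff (0 : ℤ → ℤ → X) = 0 := by
  funext m n; simp [mulDiff]

lemma mulDiff_iterate_zero (N : ℕ) : mulDiff^[N] (0 : ℤ → ℤ → X) = 0 := by
  induction N with
  | zero => rfl
  | succ N ih => rw [Function.iterate_succ_apply, mulDiff_zero, ih]

lemma mulDiff_iterate_add (N : ℕ) (A B : ℤ → ℤ → X) :
    mulDiff^[N] (A + B) = mulDiff^[N] A + mulDiff^[N] B := by
  induction N generalizing A B with
  | zero => rfl
  | succ N ih => rw [Function.iterate_succ_apply, mulDiff_add, ih]; rfl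

lemma mulDiff_iterate_map {X' : Type*} [AddCommGroup X'] (f : X →+ X') (N : ℕ) (A : ℤ → ℤ → X) :
    mulDiff^[N] (fun m n => f (A m n)) = fun m n => f (mulDiff^[N] A m n) := by
  induction N generalizing A with
  | zero => rfl
  | succ N ih =>
    rw [Function.iterate_succ_apply, Function.iterate_succ_apply, ← ih]
    congr 1
    funext m n
    simp [mulDiff]

lemma mulDiff_iterate_neg (N : ℕ) (A : ℤ → ℤ → X) : mulDiff^[N] (-A) = -mulDiff^[N] A :=
  mulDiff_iterate_map (-AddMonoidHom.id X) N A

lemma mulDiff_iterate_sub (N : ℕ) (A B : ℤ → ℤ → X) :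
    mulDiff^[N] (A - B) = mulDiff^[N] A - mulDiff^[N] B := by
  rw [sub_eq_add_neg, mulDiff_iterate_add, mulDiff_iterate_neg, sub_eq_add_neg]

lemma mulDiff_iterate_le {N N' : ℕ} (h : N ≤ N') {A B : ℤ → ℤ → X}
    (hN : mulDiff^[N] A = mulDiff^[N] B) : mulDiff^[N'] A = mulDiff^[N'] B := by
  obtain ⟨k, rfl⟩ := Nat.exists_eq_add_of_le' h
  rw [Function.iterate_add_apply, Function.iterate_add_apply, hN]

/-- A series killed by `z₁ - z₂` is constant along antidiagonals, and far enough along each of them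
it vanishes by truncation in the second index. Powers follow by induction. -/
lemma eq_zero_of_mulDiff_iterate {D : ℤ → ℤ → X} {N : ℕ} (h : mulDiff^[N] D = 0) {M : ℤ}
    (hM : ∀ m, ∀ n ≥ M, D m n = 0) : D = 0 := by
  induction N generalizing D with
  | zero => exact h
  | succ N ih =>
    have h1 : mulDiff D = 0 := by
      refine ih h fun m n hn => ?_
      rw [mulDiff, hM _ n hn, hM _ (n + 1) (by omega), sub_zero]
    have h2 : ∀ (k : ℕ) (m n : ℤ), D m n = D (m - k) (n + k) := by
      intro k
      induction k with
      | zero => simp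
      | succ k ih =>
        intro m n
        have := congrFun (congrFun h1 (m - k - 1)) (n + k)
        simp only [mulDiff, Pi.zero_apply, sub_eq_zero] at this
        rw [ih m n]
        push_cast
        rw [show m - ((k : ℤ) + 1) = m - k - 1 by ring, ← add_assoc, ← this]
        congr 1; ring
    funext m n
    rw [h2 (M - n).toNat m n, hM _ _ (by omega)]
    rfl

/-- Multiplication by the difference of the first and the third variable. -/
def mulDiff₁₃ (A : ℤ → ℤ → ℤ → X) : ℤ → ℤ → ℤ → X :=
  fun l p q => A (l + 1) p q - A l p (q + 1)

/-- Multiplication by the difference of the second and the third variable. -/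
def mulDiff₂₃ (A : ℤ → ℤ → ℤ → X) : ℤ → ℤ → ℤ → X := fun l => mulDiff (A l)

lemma mulDiff₂₃_iterate (N : ℕ) (A : ℤ → ℤ → ℤ → X) (l : ℤ) :
    mulDiff₂₃^[N] A l = mulDiff^[N] (A l) := by
  induction N generalizing A with
  | zero => rfl
  | succ N ih => rw [Function.iterate_succ_apply, ih]; rfl

lemma mulDiff_comm₂₃ : Function.Commute (mulDiff (X := ℤ → X)) mulDiff₂₃ := by
  intro A
  funext l p q
  simp only [mulDiff, mulDiff₂₃, Pi.sub_apply]
  abel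

lemma mulDiff_comm₁₃ : Function.Commute (mulDiff (X := ℤ → X)) mulDiff₁₃ := by
  intro A
  funext l p q
  simp only [mulDiff, mulDiff₁₃, Pi.sub_apply]
  abel

lemma mulDiff₁₃_comm₂₃ : Function.Commute (mulDiff₁₃ (X := X)) mulDiff₂₃ := by
  intro A
  funext l p q
  simp only [mulDiff, mulDiff₁₃, mulDiff₂₃, Pi.sub_apply]
  abel

lemma mulDiff₁₃_iterate (N : ℕ) (A : ℤ → ℤ → ℤ → X) (l p q : ℤ) :
    mulDiff₁₃^[N] A l p q = mulDiff^[N] (fun l q => A l p q) l q := by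
  induction N generalizing A with
  | zero => rfl
  | succ N ih => rw [Function.iterate_succ_apply, ih]; rfl

lemma mulDiff_iterate₁₂ (N : ℕ) (A : ℤ → ℤ → ℤ → X) (l p q : ℤ) :
    (mulDiff (X := ℤ → X))^[N] A l p q = mulDiff^[N] (fun l p => A l p q) l p := by
  induction N generalizing A with
  | zero => rfl
  | succ N ih => rw [Function.iterate_succ_apply, ih]; rfl

variable [Module ℂ X]

lemma truncated_mulDiff₁₃ {A B : ℤ → ℤ → ℤ → X} (hT : ∀ l, Truncated (A l) (B l)) (l : ℤ) :
    Truncated (mulDiff₁₃ A l) (mulDiff₁₃ B l) := by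
  intro s
  obtain ⟨J, hJ⟩ := hT (l + 1) s
  obtain ⟨J', hJ'⟩ := hT l (s + 1)
  refine ⟨max J J', fun j hj => ?_⟩
  have h1 := hJ j (le_trans (le_max_left _ _) hj)
  have h2 := hJ' j (le_trans (le_max_right _ _) hj)
  have h3 := hJ' (j + 1) (le_trans (le_trans (le_max_right _ _) hj) (by omega))
  rw [show s + 1 - j = s - j + 1 by ring] at h2
  rw [show s + 1 - (j + 1) = s - j by ring] at h3
  simp [mulDiff₁₃, h1, h2, h3]

lemma resCoeff_sub {A B A' B' : ℤ → ℤ → X} (h : Truncated A B) (h' : Truncated A' B') (m n : ℤ) :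
    resCoeff m n (A - A') (B - B') = resCoeff m n A B - resCoeff m n A' B' := by
  have hT : Truncated (A - A') (B - B') := by
    intro s
    obtain ⟨J, hJ⟩ := h s
    obtain ⟨J', hJ'⟩ := h' s
    refine ⟨max J J', fun j hj => ?_⟩
    have h1 := hJ j (le_trans (le_max_left _ _) hj)
    have h2 := hJ' j (le_trans (le_max_right _ _) hj)
    simp [h1, h2]
  rw [eq_sub_iff_add_eq, ← resCoeff_add hT h', sub_add_cancel, sub_add_cancel]

/-- The residue is taken in the middle variable, so multiplication by the difference of the two
outer ones commutes with it. -/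
lemma mulDiff_resCoeff {A B : ℤ → ℤ → ℤ → X} (hT : ∀ l, Truncated (A l) (B l)) (m : ℤ) :
    mulDiff (fun l n => resCoeff m n (A l) (B l)) =
      fun l n => resCoeff m n (mulDiff₁₃ A l) (mulDiff₁₃ B l) := by
  funext l n
  have hTs : Truncated (fun p q => A l p (q + 1)) fun p q => B l p (q + 1) := by
    intro s
    obtain ⟨J, hJ⟩ := hT l (s + 1)
    refine ⟨J, fun j hj => ?_⟩
    have h2 := hJ j hj
    have h3 := hJ (j + 1) (by omega)
    rw [show s + 1 - j = s - j + 1 by ring] at h2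
    rw [show s + 1 - (j + 1) = s - j by ring] at h3
    exact ⟨h3.1, h2.2⟩
  have e3 : resCoeff m (n + 1) (A l) (B l) =
      resCoeff m n (fun p q => A l p (q + 1)) fun p q => B l p (q + 1) := by
    unfold resCoeff resTerm
    refine finsum_congr fun j => ?_
    rw [show n + 1 + (j : ℤ) = n + j + 1 by ring,
      show m + (n + 1) - (j : ℤ) = m + n - j + 1 by ring]
  rw [mulDiff, e3, ← resCoeff_sub (hT (l + 1)) hTs]
  rfl

lemma mulDiff_iterate_resCoeff {A B : ℤ → ℤ → ℤ → X} (hT : ∀ l, Truncated (A l) (B l)) (m : ℤ)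
    (L : ℕ) : (∀ l, Truncated (mulDiff₁₃^[L] A l) (mulDiff₁₃^[L] B l)) ∧
    mulDiff^[L] (fun l n => resCoeff m n (A l) (B l)) =
      fun l n => resCoeff m n (mulDiff₁₃^[L] A l) (mulDiff₁₃^[L] B l) := by
  induction L with
  | zero => exact ⟨hT, rfl⟩
  | succ L ih =>
    simp only [Function.iterate_succ_apply']
    exact ⟨truncated_mulDiff₁₃ ih.1, by rw [ih.2, mulDiff_resCoeff ih.1]⟩

/-- The core of Dong's lemma: if `(u-x)^l` kills `A` and `B`, and `(x-w)^N A = (x-w)^N B`, then a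
power of `u-w` kills `Res_x ((x-w)^m A - (-w+x)^m B)`. -/
lemma dong_core (t : ℕ) : ∀ (l N : ℕ) (m : ℤ) (A B : ℤ → ℤ → ℤ → X), N ≤ m + t →
    (∀ l, Truncated (A l) (B l)) → mulDiff₂₃^[N] A = mulDiff₂₃^[N] B →
    mulDiff^[l] A = 0 → mulDiff^[l] B = 0 →
    mulDiff^[t + l] (fun l n => resCoeff m n (A l) (B l)) = 0 := by
  induction t with
  | zero =>
    intro l N m A B hm hT hN _ _
    -- With `t = 0` the exponent `m` is at least the order `N` of locality, and no extra factor is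
    -- needed. In general `t` bounds how far `m` lies below `N`.
    have : (fun l n => resCoeff m n (A l) (B l)) = 0 := by
      funext l n
      refine resCoeff_eq_zero_of_iterate_eq (hT l) (N := N) ?_ (by simpa using hm) n
      rw [← mulDiff₂₃_iterate, hN, mulDiff₂₃_iterate]
    rw [this, mulDiff_iterate_zero]
  | succ t iht =>
    intro l
    induction l with
    | zero =>
      intro N m A B _ _ _ hA hB
      simp only [Function.iterate_zero, id] at hA hB
      subst hA hB
      have : (fun l n => resCoeff m n ((0 : ℤ → ℤ → ℤ → X) l) ((0 : ℤ → ℤ → ℤ → X) l)) = 0 := by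
        funext l n
        simp [resCoeff, resTerm]
      rw [this, mulDiff_iterate_zero]
    | succ l ihl =>
      intro N m A B hm hT hN hA hB
      have e : ∀ A : ℤ → ℤ → ℤ → X, mulDiff A = mulDiff₁₃ A - mulDiff₂₃ A := by
        intro A
        funext l p q
        simp [mulDiff, mulDiff₁₃, mulDiff₂₃]
      have hT' : ∀ l, Truncated (mulDiff A l) (mulDiff B l) := by
        intro l s
        obtain ⟨J, hJ⟩ := truncated_mulDiff₁₃ hT l s
        obtain ⟨J', hJ'⟩ := (hT l).mulDiff s
        refine ⟨max J J', fun j hj => ?_⟩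
        have h1 := hJ j (le_trans (le_max_left _ _) hj)
        have h2 := hJ' j (le_trans (le_max_right _ _) hj)
        simp [e, mulDiff₂₃, h1, h2]
      have hK := ihl N m (mulDiff A) (mulDiff B) hm hT' (by
        rw [← (mulDiff_comm₂₃.iterate_right N).eq, ← (mulDiff_comm₂₃.iterate_right N).eq, hN])
        (by rw [← Function.iterate_succ_apply]; exact hA)
        (by rw [← Function.iterate_succ_apply]; exact hB)
      have hK' := iht (l + 1) N (m + 1) A B (by push_cast at hm; omega) hT hN hA hB
      -- Since `u - w = (u - x) + (x - w)`, one factor `u - w` either lowers the power of `u - x`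
      -- needed to kill the series (induction on `l`) or raises the exponent `m` (induction on `t`).
      have key : mulDiff (fun l n => resCoeff m n (A l) (B l)) =
          (fun l n => resCoeff m n (mulDiff A l) (mulDiff B l)) +
            fun l n => resCoeff (m + 1) n (A l) (B l) := by
        rw [mulDiff_resCoeff hT]
        funext l n
        simp only [Pi.add_apply]
        rw [← resCoeff_mulDiff (hT l), ← resCoeff_add (hT' l) (hT l).mulDiff]
        congr 1 <;> simp [e, mulDiff₂₃]
      rw [show t + 1 + (l + 1) = (t + 1 + l) + 1 by ring, Function.iterate_succ_apply, key,
        mulDiff_iterate_add, hK, show t + 1 + l = t + (l + 1) by ring, hK', add_zero]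

end MulDiff

/-! ### Locality, products of fields and Dong's lemma -/

section Fields

variable {V : ℤ → Type u} [∀ k, AddCommGroup (V k)] [∀ k, Module ℂ (V k)]

/-- The modes of a field are lower truncated. -/
def IsTrunc (a : Modes V) : Prop := ∀ v, ∃ M : ℤ, ∀ n ≥ M, a n v = 0

/-- Two fields are mutually local with sign `s`. -/
def IsLocal (s : ℂ) (a b : Modes V) : Prop := ∃ N : ℕ, ∀ v,
  mulDiff^[N] (fun m n => a m (b n v)) = mulDiff^[N] (fun m n => s • b n (a m v))

/-- Locality of matrix coefficients, with an order that may depend on the vectors. -/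
def IsWeakLocal (s : ℂ) (a b : Modes V) : Prop := ∀ v (v' : GradedDual V), ∃ N : ℕ,
  mulDiff^[N] (fun m n => pair v' (incl (a m (b n v)))) =
    mulDiff^[N] (fun m n => s * pair v' (incl (b n (a m v))))

lemma IsLocal.isWeakLocal {s : ℂ} {a b : Modes V} (h : IsLocal s a b) : IsWeakLocal s a b := by
  intro v v'
  obtain ⟨N, hN⟩ := h
  refine ⟨N, ?_⟩
  have h1 := mulDiff_iterate_map ((pair v' ∘ₗ inclL).toAddMonoidHom) N (fun m n => a m (b n v))
  have h2 := mulDiff_iterate_map ((pair v' ∘ₗ inclL).toAddMonoidHom) N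
    (fun m n => s • b n (a m v))
  rw [hN v] at h1
  simp only [map_smul, LinearMap.toAddMonoidHom_coe, LinearMap.comp_apply, smul_eq_mul] at h1 h2
  exact h1.trans h2.symm

lemma mulDiff_iterate_swap {X : Type*} [AddCommGroup X] (N : ℕ) (A : ℤ → ℤ → X) :
    mulDiff^[N] (fun m n => A n m) = fun m n => (-1 : ℤ) ^ N • mulDiff^[N] A n m := by
  induction N generalizing A with
  | zero => simp
  | succ N ih =>
    have h1 : mulDiff (fun m n => A n m) = fun m n => (-mulDiff A) n m := by
      funext m n; simp [mulDiff]
    rw [Function.iterate_succ_apply, h1, ih, mulDiff_iterate_neg]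
    funext m n
    rw [pow_succ, Function.iterate_succ_apply]
    simp

lemma mulDiff_iterate_smul {X : Type*} [AddCommGroup X] [Module ℂ X] (N : ℕ) (s : ℂ)
    (A : ℤ → ℤ → X) :
    mulDiff^[N] (fun m n => s • A m n) = fun m n => s • mulDiff^[N] A m n :=
  mulDiff_iterate_map (LinearMap.lsmul ℂ X s).toAddMonoidHom N A

lemma IsLocal.symm {s : ℂ} {a b : Modes V} (h : IsLocal s a b) (hs : s * s = 1) :
    IsLocal s b a := by
  obtain ⟨N, hN⟩ := h
  refine ⟨N, fun v => ?_⟩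
  have h1 := mulDiff_iterate_swap N fun m n => a m (b n v)
  have h2 := mulDiff_iterate_swap N fun m n => s • b n (a m v)
  rw [← hN v, ← h1] at h2
  rw [mulDiff_iterate_smul, ← h2, mulDiff_iterate_smul]
  funext m n
  rw [smul_smul, hs, one_smul]

lemma isLocal_add {s : ℂ} {a a' b : Modes V} (h : IsLocal s a b) (h' : IsLocal s a' b) :
    IsLocal s (a + a') b := by
  obtain ⟨N, hN⟩ := h
  obtain ⟨N', hN'⟩ := h'
  refine ⟨max N N', fun v => ?_⟩
  have h1 := mulDiff_iterate_le (le_max_left N N') (hN v)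
  have h2 := mulDiff_iterate_le (le_max_right N N') (hN' v)
  simp only [Pi.add_apply, LinearMap.add_apply, map_add, smul_add]
  refine (mulDiff_iterate_add _ _ _).trans ?_
  rw [h1, h2]
  exact (mulDiff_iterate_add _ _ _).symm

lemma isLocal_smul {s : ℂ} {a b : Modes V} (h : IsLocal s a b) (c : ℂ) : IsLocal s (c • a) b := by
  obtain ⟨N, hN⟩ := h
  refine ⟨N, fun v => ?_⟩
  simp only [Pi.smul_apply, LinearMap.smul_apply, map_smul]
  rw [mulDiff_iterate_smul, hN v, ← mulDiff_iterate_smul]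
  congr 1
  funext m n
  rw [smul_comm]

lemma isLocal_zero (s : ℂ) (b : Modes V) : IsLocal s 0 b := ⟨0, fun v => by simp⟩

lemma truncated_products {a b : Modes V} (ha : IsTrunc a) (hb : IsTrunc b) (s : ℂ) (v : Total V) :
    Truncated (fun p q => a p (b q v)) (fun p q => s • b q (a p v)) := by
  intro t
  obtain ⟨M, hM⟩ := ha v
  obtain ⟨M', hM'⟩ := hb v
  refine ⟨max M M', fun j hj => ⟨?_, ?_⟩⟩
  · simp [hM' j (le_trans (le_max_right _ _) hj)]
  · simp [hM j (le_trans (le_max_left _ _) hj)]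

/-- The `m`-th product of the fields `a` and `b`, with the sign `s` in the commuted term. -/
def nprod (s : ℂ) {a b : Modes V} (ha : IsTrunc a) (hb : IsTrunc b) (m : ℤ) : Modes V := fun n =>
  { toFun := fun v => resCoeff m n (fun p q => a p (b q v)) (fun p q => s • b q (a p v))
    map_add' := fun v w => by
      rw [← resCoeff_add (truncated_products ha hb s v) (truncated_products ha hb s w)]
      congr 1 <;> funext p q <;> simp
    map_smul' := fun c v => by
      refine Eq.trans ?_ (map_resCoeff (LinearMap.lsmul ℂ (Total V) c)
        (truncated_products ha hb s v) m n).symm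
      congr 1 <;> funext p q
      · simp
      · simp only [map_smul, LinearMap.lsmul_apply] }

lemma nprod_apply (s : ℂ) {a b : Modes V} (ha : IsTrunc a) (hb : IsTrunc b) (m n : ℤ)
    (v : Total V) : nprod s ha hb m n v
      = resCoeff m n (fun p q => a p (b q v)) (fun p q => s • b q (a p v)) := rfl

/-- Dong's lemma. -/
lemma IsLocal.nprod {s s₁ s₂ : ℂ} {a b c : Modes V} (ha : IsTrunc a) (hb : IsTrunc b)
    (hab : IsLocal s a b) (hca : IsLocal s₁ c a) (hcb : IsLocal s₂ c b) (m : ℤ) :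
    IsLocal (s₁ * s₂) c (nprod s ha hb m) := by
  obtain ⟨N, hN⟩ := hab
  obtain ⟨L₁, hL₁⟩ := hca
  obtain ⟨L₂, hL₂⟩ := hcb
  refine ⟨L₂ + ((N + m.natAbs) + L₁), fun v => ?_⟩
  -- In `T` the operator `c` passes `a` and then `b`; in `U`, with `a` and `b` interchanged, it
  -- passes `b` and then `a`. Passing `a` costs `(u - x)^L₁` and passing `b` costs `(u - w)^L₂`.
  set T₁ : ℤ → ℤ → ℤ → Total V := fun l p q => c l (a p (b q v))
  set T₂ : ℤ → ℤ → ℤ → Total V := fun l p q => s₁ • a p (c l (b q v))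
  set T₃ : ℤ → ℤ → ℤ → Total V := fun l p q => (s₁ * s₂) • a p (b q (c l v))
  set U₁ : ℤ → ℤ → ℤ → Total V := fun l p q => s • c l (b q (a p v))
  set U₂ : ℤ → ℤ → ℤ → Total V := fun l p q => s • s₂ • b q (c l (a p v))
  set U₃ : ℤ → ℤ → ℤ → Total V := fun l p q => s • (s₁ * s₂) • b q (a p (c l v))
  have hT₁₂ : mulDiff^[L₁] T₁ = mulDiff^[L₁] T₂ := by
    funext l p q
    rw [mulDiff_iterate₁₂, mulDiff_iterate₁₂]
    exact congrFun (congrFun (hL₁ (b q v)) l) p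
  have hT₂₃ : mulDiff₁₃^[L₂] T₂ = mulDiff₁₃^[L₂] T₃ := by
    funext l p q
    rw [mulDiff₁₃_iterate, mulDiff₁₃_iterate]
    have h1 := mulDiff_iterate_map (s₁ • a p).toAddMonoidHom L₂ fun m n => c m (b n v)
    have h2 := mulDiff_iterate_map (s₁ • a p).toAddMonoidHom L₂ fun m n => s₂ • b n (c m v)
    rw [hL₂ v, ← h2] at h1
    have h := congrFun (congrFun h1 l) q
    simp only [LinearMap.toAddMonoidHom_coe, LinearMap.smul_apply, map_smul, smul_smul] at h
    simp only [T₂, T₃, mul_comm s₁ s₂]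
    exact h
  have hU₁₂ : mulDiff₁₃^[L₂] U₁ = mulDiff₁₃^[L₂] U₂ := by
    funext l p q
    rw [mulDiff₁₃_iterate, mulDiff₁₃_iterate, mulDiff_iterate_smul, mulDiff_iterate_smul]
    exact congrArg (s • ·) (congrFun (congrFun (hL₂ (a p v)) l) q)
  have hU₂₃ : mulDiff^[L₁] U₂ = mulDiff^[L₁] U₃ := by
    funext l p q
    rw [mulDiff_iterate₁₂, mulDiff_iterate₁₂]
    have h1 := mulDiff_iterate_map (s • s₂ • b q).toAddMonoidHom L₁ fun m n => c m (a n v)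
    have h2 := mulDiff_iterate_map (s • s₂ • b q).toAddMonoidHom L₁ fun m n => s₁ • a n (c m v)
    rw [hL₁ v, ← h2] at h1
    have h := congrFun (congrFun h1 l) p
    simp only [LinearMap.toAddMonoidHom_coe, LinearMap.smul_apply, map_smul, smul_smul] at h
    simp only [U₂, U₃, smul_smul]
    rw [show s * (s₁ * s₂) = s₁ * (s * s₂) by ring]
    exact h
  have hsub : ∀ A B : ℤ → ℤ → ℤ → Total V,
      mulDiff₁₃^[L₂] (A - B) = mulDiff₁₃^[L₂] A - mulDiff₁₃^[L₂] B := by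
    intro A B
    funext l p q
    simp only [Pi.sub_apply, mulDiff₁₃_iterate]
    exact congrFun (congrFun (mulDiff_iterate_sub L₂ (fun l q => A l p q) fun l q => B l p q) l) q
  have hcomm := (mulDiff_comm₁₃ (X := Total V)).iterate_iterate L₁ L₂
  have hTr : ∀ l, Truncated (T₁ l) (U₁ l) := fun l => by
    have := (truncated_products ha hb s v).map (c l) (c l)
    simpa only [map_smul] using this
  have hTr' : ∀ l, Truncated (T₃ l) (U₃ l) := fun l => by
    have := (truncated_products ha hb s (c l v)).map (LinearMap.lsmul ℂ (Total V) (s₁ * s₂))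
      (LinearMap.lsmul ℂ (Total V) (s₁ * s₂))
    simpa only [LinearMap.lsmul_apply, smul_comm _ s] using this
  have hTrs : ∀ l, Truncated ((T₁ - T₃) l) ((U₁ - U₃) l) := by
    intro l t
    obtain ⟨J, hJ⟩ := hTr l t
    obtain ⟨J', hJ'⟩ := hTr' l t
    refine ⟨max J J', fun j hj => ?_⟩
    have h1 := hJ j (le_trans (le_max_left _ _) hj)
    have h2 := hJ' j (le_trans (le_max_right _ _) hj)
    simp [h1, h2]
  have key := mulDiff_iterate_resCoeff hTrs m L₂
  have hN' : mulDiff₂₃^[N] (mulDiff₁₃^[L₂] (T₁ - T₃)) = mulDiff₂₃^[N] (mulDiff₁₃^[L₂] (U₁ - U₃)) := by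
    rw [← (mulDiff₁₃_comm₂₃.iterate_iterate L₂ N).eq, ← (mulDiff₁₃_comm₂₃.iterate_iterate L₂ N).eq]
    congr 1
    funext l
    rw [mulDiff₂₃_iterate, mulDiff₂₃_iterate]
    have h1 := mulDiff_iterate_map (c l).toAddMonoidHom N fun m n => a m (b n v)
    have h2 := mulDiff_iterate_map (c l).toAddMonoidHom N fun m n => s • b n (a m v)
    have h3 := mulDiff_iterate_map (LinearMap.lsmul ℂ (Total V) (s₁ * s₂)).toAddMonoidHom N
      fun m n => a m (b n (c l v))
    have h4 := mulDiff_iterate_map (LinearMap.lsmul ℂ (Total V) (s₁ * s₂)).toAddMonoidHom N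
      fun m n => s • b n (a m (c l v))
    rw [hN v, ← h2] at h1
    rw [hN (c l v), ← h4] at h3
    have h5 : mulDiff^[N] (T₁ l) = mulDiff^[N] (U₁ l) := by simpa using h1
    have h6 : mulDiff^[N] (T₃ l) = mulDiff^[N] (U₃ l) := by
      simpa [smul_comm _ s] using h3
    rw [Pi.sub_apply, Pi.sub_apply, mulDiff_iterate_sub, mulDiff_iterate_sub, h5, h6]
  have hz : ∀ A B C : ℤ → ℤ → ℤ → Total V, mulDiff^[L₁] (mulDiff₁₃^[L₂] A) =
      mulDiff^[L₁] (mulDiff₁₃^[L₂] B) → mulDiff^[L₁] (mulDiff₁₃^[L₂] B) =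
      mulDiff^[L₁] (mulDiff₁₃^[L₂] C) → mulDiff^[L₁] (mulDiff₁₃^[L₂] (A - C)) = 0 := by
    intro A B C h1 h2
    rw [hsub, mulDiff_iterate_sub, h1, h2, sub_self]
  -- The factor `(u - w)^L₂` is applied beforehand, so that `(u - x)^L₁` alone kills both
  -- differences, as `dong_core` requires. The choice `t = N + |m|` ensures `N ≤ m + t` for every
  -- sign of `m`.
  have h0 := dong_core (N + m.natAbs) L₁ N m _ _ (by omega) key.1 hN'
    (hz T₁ T₂ T₃ (by rw [hcomm.eq, hcomm.eq, hT₁₂]) (by rw [hT₂₃]))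
    (hz U₁ U₂ U₃ (by rw [hU₁₂]) (by rw [hcomm.eq, hcomm.eq, hU₂₃]))
  rw [← key.2, ← Function.iterate_add_apply, add_comm _ L₂] at h0
  have e : (fun l n => resCoeff m n ((T₁ - T₃) l) ((U₁ - U₃) l)) =
      (fun l n => c l (HalfGraded.nprod s ha hb m n v)) -
        fun l n => (s₁ * s₂) • HalfGraded.nprod s ha hb m n (c l v) := by
    funext l n
    simp only [Pi.sub_apply]
    rw [resCoeff_sub (hTr l) (hTr' l), nprod_apply, nprod_apply,
      map_resCoeff _ (truncated_products ha hb s v)]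
    have := map_resCoeff (LinearMap.lsmul ℂ (Total V) (s₁ * s₂))
      (truncated_products ha hb s (c l v)) m n
    simp only [LinearMap.lsmul_apply] at this
    rw [this]
    simp only [T₁, T₃, U₁, U₃, map_smul, smul_comm _ s]
  rw [e, mulDiff_iterate_sub, sub_eq_zero] at h0
  exact h0

end Fields

/-! ### Residues and derivatives -/

section Derivation

variable {X : Type*} [AddCommGroup X] [Module ℂ X]

/-- Compatibility of the residue with derivatives. -/
lemma resCoeff_deriv {A B : ℤ → ℤ → X} (h : Truncated A B) (m n : ℤ) :
    resCoeff m n (fun p q => (-p : ℂ) • A (p - 1) q + (-q : ℂ) • A p (q - 1))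
      (fun p q => (-p : ℂ) • B (p - 1) q + (-q : ℂ) • B p (q - 1)) =
      (-n : ℂ) • resCoeff m (n - 1) A B := by
  have hm1 : (-1 : ℂ) ≠ 0 := by norm_num
  set c : ℕ → ℂ := fun j => Ring.choose (m : ℂ) j with hc
  set α : ℕ → X := fun j => (-1 : ℂ) ^ j • A (m - j) (n - 1 + j) with hα
  set β : ℕ → X := fun j => (-1 : ℂ) ^ (m - j) • B j (m + (n - 1) - j) with hβ
  set β' : ℕ → X := fun j => (-1 : ℂ) ^ (m - j + 1) • B (j - 1) (m + n - j) with hβ'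
  have hββ' : ∀ j, β' (j + 1) = β j := by
    intro j
    simp only [hβ, hβ']
    congr 2
    · push_cast; ring
    · push_cast; ring
    · push_cast; ring
  -- This recursion shifts the sums over `α (j + 1)` and `β'` back to index `j`; there the
  -- contributions of `j` and `m` cancel and only `-n (α j - β j)` survives.
  have hrec : ∀ j, ((m : ℂ) - j) * c j = ((j : ℂ) + 1) * c (j + 1) := fun j =>
    (choose_succ_mul m j).symm
  have hterm : ∀ j, resTerm m n (fun p q => (-p : ℂ) • A (p - 1) q + (-q : ℂ) • A p (q - 1))
      (fun p q => (-p : ℂ) • B (p - 1) q + (-q : ℂ) • B p (q - 1)) j =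
      ((m : ℂ) - j) • α (j + 1) - ((n : ℂ) + j) • α j - (j : ℂ) • β' j + ((m : ℂ) + n - j) • β j := by
    intro j
    simp only [resTerm, hα, hβ, hβ']
    rw [show n - 1 + ((j + 1 : ℕ) : ℤ) = n + j by push_cast; ring,
      show m - ((j + 1 : ℕ) : ℤ) = m - j - 1 by push_cast; ring,
      show n - 1 + (j : ℤ) = n + j - 1 by ring, show m + (n - 1) - (j : ℤ) = m + n - j - 1 by ring,
      zpow_add_one₀ hm1, pow_succ]
    push_cast
    module
  obtain ⟨J, hJ⟩ := h (m + n - 1)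
  obtain ⟨K, hK⟩ : ∃ K : ℕ, ∀ j ≥ K, α j = 0 ∧ β j = 0 := by
    refine ⟨(|J| + |n| + 1).toNat, fun j hj => ?_⟩
    have hj' : |J| + |n| + 1 ≤ (j : ℤ) := by
      have := abs_nonneg J; have := abs_nonneg n; omega
    have h1 := (hJ (n - 1 + j) (by have := le_abs_self J; have := neg_abs_le n; omega)).1
    have h2 := (hJ j (by have := le_abs_self J; have := abs_nonneg n; omega)).2
    rw [show m + n - 1 - (n - 1 + j) = m - j by ring] at h1
    rw [show m + n - 1 - (j : ℤ) = m + (n - 1) - j by ring] at h2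
    simp [hα, hβ, h1, h2]
  rw [resCoeff_eq_sum (K := K + 1) (A := fun p q => (-p : ℂ) • A (p - 1) q + (-q : ℂ) • A p (q - 1))
    fun j hj => by
      obtain ⟨i, rfl⟩ : ∃ i, j = i + 1 := ⟨j - 1, by omega⟩
      rw [hterm, (hK (i + 1 + 1) (by omega)).1, (hK (i + 1) (by omega)).1,
        (hK (i + 1) (by omega)).2, hββ', (hK i (by omega)).2]
      simp,
    resCoeff_eq_sum (K := K) (A := A) fun j hj => by
      rw [resTerm]
      have := hK j hj
      simp only [hα, hβ] at this
      rw [this.1, this.2, sub_zero]]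
  have e1 : ∑ j ∈ Finset.range (K + 1), (c j * ((m : ℂ) - j)) • α (j + 1) =
      ∑ j ∈ Finset.range K, ((j : ℂ) * c j) • α j := by
    have := Finset.sum_range_succ' (fun j => ((j : ℂ) * c j) • α j) (K + 1)
    rw [Finset.sum_range_succ, Finset.sum_range_succ, (hK K le_rfl).1, (hK (K + 1) (by omega)).1] at this
    simp only [smul_zero, add_zero, Nat.cast_zero, zero_mul, zero_smul] at this
    rw [this]
    refine Finset.sum_congr rfl fun j _ => ?_
    rw [mul_comm, hrec]
    push_cast
    rfl
  have e2 : ∑ j ∈ Finset.range (K + 1), (c j * (j : ℂ)) • β' j =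
      ∑ j ∈ Finset.range K, (((m : ℂ) - j) * c j) • β j := by
    rw [Finset.sum_range_succ']
    simp only [Nat.cast_zero, mul_zero, zero_smul, add_zero]
    refine Finset.sum_congr rfl fun j _ => ?_
    rw [hββ', hrec, mul_comm]
    push_cast
    rfl
  have e3 : ∑ j ∈ Finset.range (K + 1), (c j * ((n : ℂ) + j)) • α j =
      ∑ j ∈ Finset.range K, (c j * ((n : ℂ) + j)) • α j := by
    rw [Finset.sum_range_succ, (hK K le_rfl).1, smul_zero, add_zero]
  have e4 : ∑ j ∈ Finset.range (K + 1), (c j * ((m : ℂ) + n - j)) • β j =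
      ∑ j ∈ Finset.range K, (c j * ((m : ℂ) + n - j)) • β j := by
    rw [Finset.sum_range_succ, (hK K le_rfl).2, smul_zero, add_zero]
  have e5 : ∀ j, Ring.choose (m : ℂ) j • resTerm m n
      (fun p q => (-p : ℂ) • A (p - 1) q + (-q : ℂ) • A p (q - 1))
      (fun p q => (-p : ℂ) • B (p - 1) q + (-q : ℂ) • B p (q - 1)) j =
      (c j * ((m : ℂ) - j)) • α (j + 1) - (c j * ((n : ℂ) + j)) • α j - (c j * (j : ℂ)) • β' j
        + (c j * ((m : ℂ) + n - j)) • β j := by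
    intro j
    rw [hterm]
    simp only [hc, smul_add, smul_sub, smul_smul]
  rw [Finset.sum_congr rfl fun j _ => e5 j, Finset.sum_add_distrib, Finset.sum_sub_distrib,
    Finset.sum_sub_distrib, e1, e2, e3, e4, Finset.smul_sum, ← Finset.sum_sub_distrib,
    ← Finset.sum_sub_distrib, ← Finset.sum_add_distrib]
  refine Finset.sum_congr rfl fun j _ => ?_
  have : resTerm m (n - 1) A B j = α j - β j := rfl
  rw [this]
  simp only [hc]
  module

end Derivation

/-! ### Goddard's uniqueness theorem and the space of fields -/

section Fields

variable {V : ℤ → Type u} [∀ k, AddCommGroup (V k)] [∀ k, Module ℂ (V k)]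

lemma isHomog_nprod {d e : ℤ} {a b : Modes V} (hda : IsHomog d a) (hdb : IsHomog e b) (s : ℂ)
    (ha : IsTrunc a) (hb : IsTrunc b) (m : ℤ) :
    IsHomog (d + e - 2 * m - 2) (nprod s ha hb m) := by
  intro n k x j hj
  have h1 := map_resCoeff (DirectSum.component ℂ ℤ V j) (truncated_products ha hb s (ofDeg k x)) m n
  refine (h1 : nprod s ha hb m n (ofDeg k x) j = _).trans ?_
  have hA : ∀ p q : ℤ, p + q = m + n → DirectSum.component ℂ ℤ V j (a p (b q (ofDeg k x))) = 0 := fun p q hpq =>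
    ((hda p).comp (hdb q)) k x j (by omega)
  have hB : ∀ p q : ℤ, p + q = m + n → DirectSum.component ℂ ℤ V j (b q (a p (ofDeg k x))) = 0 := fun p q hpq =>
    ((hdb q).comp (hda p)) k x j (by omega)
  refine finsum_eq_zero_of_forall_eq_zero fun i => ?_
  simp only [resTerm, map_smul]
  rw [hA _ _ (by ring), hB _ _ (by ring)]
  simp

/-- Commutation with `L` is a derivation, so on a product of two fields it is the sum of the
derivatives in both variables, and `resCoeff_deriv` pulls that sum out of the residue. -/
lemma isCovariant_nprod {L : Module.End ℂ (Total V)} {a b : Modes V} (hla : IsCovariant L a)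
    (hlb : IsCovariant L b) (s : ℂ) (ha : IsTrunc a) (hb : IsTrunc b) (m : ℤ) :
    IsCovariant L (nprod s ha hb m) := by
  intro n v
  have hT := truncated_products ha hb s v
  rw [nprod_apply, nprod_apply, nprod_apply, map_resCoeff L hT,
    ← resCoeff_sub (hT.map L L) (truncated_products ha hb s (L v)), ← resCoeff_deriv hT]
  have e : ∀ (a b : Modes V), IsCovariant L a → IsCovariant L b → ∀ p q,
      L (a p (b q v)) - a p (b q (L v)) =
        (-p : ℂ) • a (p - 1) (b q v) + (-q : ℂ) • a p (b (q - 1) v) := by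
    intro a b hla hlb p q
    rw [← hla p (b q v), ← map_smul (a p), ← hlb q v, map_sub]
    abel
  congr 1
  · funext p q
    exact e a b hla hlb p q
  · funext p q
    simp only [Pi.sub_apply, map_smul]
    rw [← smul_sub, e b a hlb hla q p, smul_add, smul_comm s, smul_comm s, add_comm]

/-- Because `L w = 0`, covariance reads `L a_{n+1} w = -(n+1) a_n w`: vanishing passes from `n + 1`
to `n`. Truncation starts the descent, which stops at `n = 0`, where the next factor would be zero.
-/
lemma covariant_vacuum {L : Module.End ℂ (Total V)} {a : Modes V} {w : Total V} (hL : L w = 0)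
    (hla : IsCovariant L a) (ha : IsTrunc a) : ∀ n : ℕ, a n w = 0 := by
  obtain ⟨M, hM⟩ := ha w
  have key : ∀ k n : ℕ, M ≤ n + k → a n w = 0 := by
    intro k
    induction k with
    | zero => intro n hn; exact hM n (by simpa using hn)
    | succ k ih =>
      intro n hn
      have h1 := ih (n + 1) (by push_cast at hn ⊢; omega)
      have h2 := hla (n + 1) w
      push_cast at h1
      rw [h1, hL, map_zero, map_zero, sub_zero] at h2
      have h3 : (-((n + 1 : ℤ) : ℂ)) ≠ 0 := by
        rw [neg_ne_zero]; exact_mod_cast (by omega : (n + 1 : ℤ) ≠ 0)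
      rw [add_sub_cancel_right] at h2
      exact (smul_eq_zero.1 h2.symm).resolve_left h3
  exact fun n => key M.toNat n (by omega)

/-- Covariance recovers `a_{n-1} w` from `L a_n w` for `n < 0`; formally `a(z) w = exp (zL) a_{-1}
w`. -/
lemma covariant_vacuum_eq {L : Module.End ℂ (Total V)} {a b : Modes V} {w : Total V} (hL : L w = 0)
    (hla : IsCovariant L a) (ha : IsTrunc a) (hlb : IsCovariant L b) (hb : IsTrunc b)
    (h : a (-1) w = b (-1) w) (n : ℤ) : a n w = b n w := by
  rcases n with n | n
  · rw [Int.ofNat_eq_natCast, covariant_vacuum hL hla ha n, covariant_vacuum hL hlb hb n]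
  · induction n with
    | zero => exact h
    | succ n ih =>
      have h1 := hla (Int.negSucc n) w
      have h2 := hlb (Int.negSucc n) w
      rw [ih, hL, map_zero, sub_zero, ] at h1
      rw [hL, map_zero, sub_zero, h1] at h2
      have h3 : (-((Int.negSucc n : ℤ) : ℂ)) ≠ 0 := by
        rw [neg_ne_zero]; exact_mod_cast (by omega : Int.negSucc n ≠ 0)
      have := smul_right_injective (Total V) h3 h2
      simpa [Int.negSucc_eq, sub_eq_add_neg, add_comm, add_left_comm] using this

variable {I : Type v}

/-- The vector `M^{i₁}_{n₁} ⋯ M^{i_k}_{n_k} v`. -/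
def wordM (M : I → Modes V) (l : List (I × ℤ)) (v : Total V) : Total V :=
  l.foldr (fun p w => M p.1 p.2 w) v

/-- By locality a power of `z₁ - z₂` kills `(a - b)(z₁) M(z₂) w`, since `(a - b)(z₁) w = 0`. As
`M(z₂) w` is truncated, that power can be cancelled. An order depending on `w` and `v'` is enough.
-/
lemma IsTrunc.sub_unique {M : I → Modes V} (hM : ∀ i, IsTrunc (M i)) {a b : Modes V} {s : I → ℂ}
    (hla : ∀ i, IsWeakLocal (s i) a (M i)) (hlb : ∀ i, IsWeakLocal (s i) b (M i)) {w : Total V}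
    (h : ∀ n, a n w = b n w) (i : I) (m n : ℤ) : a n (M i m w) = b n (M i m w) := by
  refine total_ext fun v' => ?_
  obtain ⟨N, hN⟩ := hla i w v'
  obtain ⟨N', hN'⟩ := hlb i w v'
  have h1 := mulDiff_iterate_le (le_max_left N N') hN
  have h2 := mulDiff_iterate_le (le_max_right N N') hN'
  simp only [h] at h1
  rw [← h2, ← sub_eq_zero, ← mulDiff_iterate_sub] at h1
  obtain ⟨K, hK⟩ := hM i w
  have h3 := eq_zero_of_mulDiff_iterate h1 (M := K) fun m n hn => by
    simp [hK n hn]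
  exact sub_eq_zero.1 (congrFun (congrFun h3 n) m)

/-- Goddard's uniqueness theorem. -/
lemma goddard {M : I → Modes V} (hM : ∀ i, IsTrunc (M i)) {L : Module.End ℂ (Total V)}
    {w : Total V} (hL : L w = 0)
    (hspan : Submodule.span ℂ (Set.range fun l : List (I × ℤ) => wordM M l w) = ⊤)
    {a b : Modes V} {s : I → ℂ} (ha : IsTrunc a) (hb : IsTrunc b) (hca : IsCovariant L a)
    (hcb : IsCovariant L b) (hla : ∀ i, IsWeakLocal (s i) a (M i))
    (hlb : ∀ i, IsWeakLocal (s i) b (M i)) (h : a (-1) w = b (-1) w) : a = b := by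
  have key : ∀ l : List (I × ℤ), ∀ n, a n (wordM M l w) = b n (wordM M l w) := by
    intro l
    induction l with
    | nil => exact covariant_vacuum_eq hL hca ha hcb hb h
    | cons p l ih => exact fun n => IsTrunc.sub_unique hM hla hlb ih p.1 p.2 n
  funext n
  refine LinearMap.ext_on_range hspan fun l => key l n

/-- The sign `(-1)^{de}`. -/
def sg (d e : ℤ) : ℂ := (-1) ^ (d * e)

lemma sg_add_left (d d' e : ℤ) : sg (d + d') e = sg d e * sg d' e := by
  rw [sg, add_mul, zpow_add₀ (by norm_num)]; rfl

lemma sg_comm (d e : ℤ) : sg d e = sg e d := by rw [sg, mul_comm]; rfl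

lemma sg_mul_self (d e : ℤ) : sg d e * sg d e = 1 := by
  rw [sg, ← mul_zpow]; norm_num

lemma sg_two_mul (d e : ℤ) : sg (2 * d) e = 1 := by
  rw [two_mul, sg_add_left, sg_mul_self]

/-- Weight indices are doubled, so the parity of a vector is the parity of its index; signs can be
computed with integers. -/
lemma sg_parity (d e : ℤ) : sign (d : ZMod 2) (e : ZMod 2) = sg d e := by
  have h : ∀ d : ℤ, (Even d ∧ (d : ZMod 2) = 0) ∨ (Odd d ∧ (d : ZMod 2) = 1) := by
    intro d
    rcases Int.even_or_odd d with h | h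
    · exact Or.inl ⟨h, (ZMod.intCast_zmod_eq_zero_iff_dvd d 2).2 h.two_dvd⟩
    · refine Or.inr ⟨h, ?_⟩
      obtain ⟨m, rfl⟩ := h
      push_cast
      rw [show (2 : ZMod 2) = 0 from rfl]
      simp
  have hv : (1 : ZMod 2).val = 1 := rfl
  rcases h d with ⟨hd, hd'⟩ | ⟨hd, hd'⟩ <;> rcases h e with ⟨he, he'⟩ | ⟨he, he'⟩ <;>
    rw [hd', he', sign, sg]
  · rw [(hd.mul_right e).neg_one_zpow]; simp
  · rw [(hd.mul_right e).neg_one_zpow]; simp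
  · rw [(he.mul_left d).neg_one_zpow]; simp
  · rw [(hd.mul he).neg_one_zpow]; simp [hv]

/-- The algebraic form of the hypotheses on the generating fields. -/
structure IsFormalData (vac : V 0) (M : I → Modes V) (wt : I → ℤ) (L : Module.End ℂ (Total V)) :
    Prop where
  lower_bounded : ∃ k₀ : ℤ, ∀ k < k₀, Subsingleton (V k)
  homog : ∀ i, IsHomog (wt i) (M i)
  L_vacuum : L (vacuum vac) = 0
  covariant : ∀ i, IsCovariant L (M i)
  spanning : Submodule.span ℂ (Set.range fun l : List (I × ℤ) => wordM M l (vacuum vac)) = ⊤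
  isLocal : ∀ i j, IsLocal (sg (wt i) (wt j)) (M i) (M j)

/-- The fields of weight `d / 2` that are local with respect to the generating fields. -/
structure IsField (M : I → Modes V) (wt : I → ℤ) (L : Module.End ℂ (Total V)) (d : ℤ)
    (a : Modes V) : Prop where
  homog : IsHomog d a
  covariant : IsCovariant L a
  isLocal : ∀ i, IsLocal (sg d (wt i)) a (M i)

section

variable {vac : V 0} {M : I → Modes V} {wt : I → ℤ} {L : Module.End ℂ (Total V)}

lemma IsHomog.add {d : ℤ} {a b : Modes V} (ha : IsHomog d a) (hb : IsHomog d b) :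
    IsHomog d (a + b) := fun n => (ha n).add (hb n)

lemma IsHomog.smul {d : ℤ} {a : Modes V} (ha : IsHomog d a) (c : ℂ) : IsHomog d (c • a) :=
  fun n => (ha n).smul c

lemma IsField.add {d : ℤ} {a b : Modes V} (ha : IsField M wt L d a) (hb : IsField M wt L d b) :
    IsField M wt L d (a + b) where
  homog := ha.homog.add hb.homog
  covariant n v := by
    simp only [Pi.add_apply, LinearMap.add_apply, map_add, smul_add]
    rw [← ha.covariant n v, ← hb.covariant n v]; abel
  isLocal i := isLocal_add (ha.isLocal i) (hb.isLocal i)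

lemma IsField.smul {d : ℤ} {a : Modes V} (ha : IsField M wt L d a) (c : ℂ) :
    IsField M wt L d (c • a) where
  homog := ha.homog.smul c
  covariant n v := by
    simp only [Pi.smul_apply, LinearMap.smul_apply, map_smul]
    rw [← smul_sub, ha.covariant n v, smul_comm]
  isLocal i := isLocal_smul (ha.isLocal i) c

lemma isField_zero (d : ℤ) : IsField M wt L d 0 where
  homog n := IsHomogOp.zero
  covariant n v := by simp
  isLocal i := isLocal_zero _ _

/-- The modes of the identity field. -/
def idModes : Modes V := fun n => if n = -1 then 1 else 0

lemma isHomog_idModes : IsHomog 0 (idModes : Modes V) := by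
  intro n k x j hj
  unfold idModes
  split_ifs with h
  · subst h; exact ofDeg_ne _ (by simpa using hj)
  · rfl

lemma isLocal_idModes (b : Modes V) : IsLocal 1 idModes b := by
  refine ⟨0, fun v => ?_⟩
  funext m n
  simp only [Function.iterate_zero, id, idModes]
  split_ifs <;> simp

lemma isField_idModes : IsField M wt L 0 idModes where
  homog := isHomog_idModes
  covariant n v := by
    simp only [idModes]
    by_cases h : n = -1
    · subst h; simp
    · by_cases h' : n = 0
      · subst h'; simp
      · simp [h, show n - 1 ≠ -1 by omega]
  isLocal i := by
    rw [show sg 0 (wt i) = 1 by simp [sg]]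
    exact isLocal_idModes _

namespace IsFormalData

variable (D : IsFormalData vac M wt L)
include D

lemma isTrunc_of_homog {d : ℤ} {a : Modes V} (ha : IsHomog d a) : IsTrunc a := by
  obtain ⟨k₀, hk⟩ := D.lower_bounded
  exact fun v => ha.trunc hk v

lemma isTrunc {d : ℤ} {a : Modes V} (ha : IsField M wt L d a) : IsTrunc a :=
  D.isTrunc_of_homog ha.homog

lemma isField_gen (i : I) : IsField M wt L (wt i) (M i) :=
  ⟨D.homog i, D.covariant i, D.isLocal i⟩

/-- Goddard's theorem within the class of fields; it makes the state-field map single-valued. -/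
lemma field_unique {d : ℤ} {a b : Modes V} (ha : IsField M wt L d a) (hb : IsField M wt L d b)
    (h : a (-1) (vacuum vac) = b (-1) (vacuum vac)) : a = b :=
  goddard (fun i => D.isTrunc (D.isField_gen i)) D.L_vacuum D.spanning (D.isTrunc ha)
    (D.isTrunc hb) ha.covariant hb.covariant (fun i => (ha.isLocal i).isWeakLocal)
    (fun i => (hb.isLocal i).isWeakLocal) h

lemma sg_nprod (d e m f : ℤ) : sg (d + e - 2 * m - 2) f = sg d f * sg e f := by
  rw [show d + e - 2 * m - 2 = d + e + 2 * (-m - 1) by ring, sg_add_left, sg_two_mul, sg_add_left,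
    mul_one]

/-- The weight index of a product differs from `d + e` by an even number, so the signs multiply
exactly as Dong's lemma requires. -/
lemma isField_nprod {d e : ℤ} {a b : Modes V} (ha : IsField M wt L d a) (hb : IsField M wt L e b)
    (hab : IsLocal (sg d e) a b) (m : ℤ) :
    IsField M wt L (d + e - 2 * m - 2) (nprod (sg d e) (D.isTrunc ha) (D.isTrunc hb) m) where
  homog := isHomog_nprod ha.homog hb.homog _ _ _ m
  covariant := isCovariant_nprod ha.covariant hb.covariant _ _ _ m
  isLocal i := by
    rw [D.sg_nprod]
    exact (IsLocal.nprod (D.isTrunc ha) (D.isTrunc hb) hab ((ha.isLocal i).symm (sg_mul_self _ _))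
      ((hb.isLocal i).symm (sg_mul_self _ _)) m).symm (by
        rw [mul_mul_mul_comm, sg_mul_self, sg_mul_self, one_mul])

/-- Nonnegative modes kill the vacuum. This removes all the commuted terms and, of the others,
leaves only `j = 0`. -/
lemma nprod_vacuum {d e : ℤ} {a b : Modes V} (ha : IsField M wt L d a) (hb : IsField M wt L e b)
    (s : ℂ) (m : ℤ) : nprod s (D.isTrunc ha) (D.isTrunc hb) m (-1) (vacuum vac)
      = a m (b (-1) (vacuum vac)) := by
  rw [nprod_apply, resCoeff_eq_sum (K := 1), Finset.sum_range_one]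
  · have := covariant_vacuum D.L_vacuum ha.covariant (D.isTrunc ha) 0
    simp only [Nat.cast_zero] at this
    simp [resTerm, Ring.choose_zero_right, this]
  · intro j hj
    have h1 := covariant_vacuum D.L_vacuum ha.covariant (D.isTrunc ha) j
    have h2 := covariant_vacuum D.L_vacuum hb.covariant (D.isTrunc hb) (j - 1)
    rw [show ((j - 1 : ℕ) : ℤ) = -1 + j by omega] at h2
    simp [resTerm, h1, h2]

/-- The degree of a word. -/
def wordDeg (wt : I → ℤ) (l : List (I × ℤ)) : ℤ := (l.map fun p => wt p.1 - 2 * p.2 - 2).sum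

/-- The field is an iterated product of generators. Locality with arbitrary fields, and not only
with the generators, is carried through the induction, because uniqueness will transfer it to all
pairs of fields. -/
lemma exists_field_word (l : List (I × ℤ)) : ∃ a, IsField M wt L (wordDeg wt l) a ∧
    a (-1) (vacuum vac) = wordM M l (vacuum vac) ∧
    ∀ e b, IsField M wt L e b → IsLocal (sg (wordDeg wt l) e) a b := by
  induction l with
  | nil =>
    refine ⟨idModes, isField_idModes, by simp [idModes, wordM], fun e b _ => ?_⟩
    rw [show sg (wordDeg wt ([] : List (I × ℤ))) e = 1 by simp [wordDeg, sg]]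
    exact isLocal_idModes _
  | cons p l ih =>
    obtain ⟨b, hb, hb1, hbl⟩ := ih
    have hi := D.isField_gen p.1
    have hab := (hb.isLocal p.1).symm (sg_mul_self _ _)
    rw [sg_comm] at hab
    have hd : wordDeg wt (p :: l) = wt p.1 + wordDeg wt l - 2 * p.2 - 2 := by
      simp [wordDeg]; ring
    refine ⟨nprod (sg (wt p.1) (wordDeg wt l)) (D.isTrunc hi) (D.isTrunc hb) p.2, ?_, ?_, ?_⟩
    · rw [hd]; exact D.isField_nprod hi hb hab _
    · rw [D.nprod_vacuum hi hb, hb1]; rfl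
    · intro e c hc
      rw [hd, D.sg_nprod]
      have h1 := hc.isLocal p.1
      have h2 := (hbl e c hc).symm (sg_mul_self _ _)
      rw [sg_comm] at h1
      exact (IsLocal.nprod (D.isTrunc hi) (D.isTrunc hb) hab h1 h2 p.2).symm (by
        rw [mul_mul_mul_comm, sg_mul_self, sg_mul_self, one_mul])

lemma field_vacuum {d : ℤ} {a : Modes V} (ha : IsField M wt L d a) :
    ∀ j, j ≠ d → a (-1) (vacuum vac) j = 0 := fun j hj =>
  ha.homog (-1) 0 vac j (by omega)

/-- A word is homogeneous, so its component of index `k` is the word itself or zero; linear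
combinations then reach every vector. -/
lemma exists_field_aux (u : Total V) : ∀ k : ℤ, ∃ a, IsField M wt L k a ∧
    a (-1) (vacuum vac) = ofDeg k (u k) ∧ ∀ e b, IsField M wt L e b → IsLocal (sg k e) a b := by
  have hu : u ∈ Submodule.span ℂ (Set.range fun l : List (I × ℤ) => wordM M l (vacuum vac)) := by
    rw [D.spanning]; trivial
  induction hu using Submodule.span_induction with
  | mem x hx =>
    obtain ⟨l, rfl⟩ := hx
    obtain ⟨a, ha, ha1, hal⟩ := D.exists_field_word l
    intro k
    by_cases hk : k = wordDeg wt l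
    · subst hk
      refine ⟨a, ha, ?_, hal⟩
      rw [ha1]
      exact eq_ofDeg_of_forall (by rw [← ha1]; exact D.field_vacuum ha)
    · refine ⟨0, isField_zero k, ?_, fun e b _ => isLocal_zero _ _⟩
      simp only
      rw [← ha1, D.field_vacuum ha k hk]
      simp
  | zero => exact fun k => ⟨0, isField_zero k, by simp, fun e b _ => isLocal_zero _ _⟩
  | add x y _ _ hx hy =>
    intro k
    obtain ⟨a, ha, ha1, hal⟩ := hx k
    obtain ⟨b, hb, hb1, hbl⟩ := hy k
    exact ⟨a + b, ha.add hb, by simp [ha1, hb1], fun e c hc =>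
      isLocal_add (hal e c hc) (hbl e c hc)⟩
  | smul c x _ hx =>
    intro k
    obtain ⟨a, ha, ha1, hal⟩ := hx k
    exact ⟨c • a, ha.smul c, by simp [ha1, DirectSum.smul_apply], fun e b hb =>
      isLocal_smul (hal e b hb) c⟩

lemma exists_field {k : ℤ} (x : V k) : ∃ a, IsField M wt L k a ∧
    a (-1) (vacuum vac) = ofDeg k x := by
  obtain ⟨a, ha, ha1, _⟩ := D.exists_field_aux (ofDeg k x) k
  exact ⟨a, ha, by rw [ha1, ofDeg_same]⟩

/-- By uniqueness `a` is the field constructed from its own vector `a_{-1} 1`, and that one is local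
with everything. -/
lemma isLocal_fields {d e : ℤ} {a b : Modes V} (ha : IsField M wt L d a)
    (hb : IsField M wt L e b) : IsLocal (sg d e) a b := by
  obtain ⟨a', ha', h1, h2⟩ := D.exists_field_aux (a (-1) (vacuum vac)) d
  rw [← eq_ofDeg_of_forall (D.field_vacuum ha)] at h1
  rw [D.field_unique ha ha' h1.symm]
  exact h2 e b hb

lemma isField_deriv {d : ℤ} {a : Modes V} (ha : IsField M wt L d a) :
    IsField M wt L (d + 2) (derivModes a) where
  homog := isHomog_derivModes ha.homog
  covariant n v := by
    simp only [derivModes, LinearMap.smul_apply, map_smul]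
    rw [← smul_sub, ha.covariant (n - 1) v]
  isLocal i := by
    obtain ⟨N, hN⟩ := ha.isLocal i
    refine ⟨N + 1, fun v => ?_⟩
    -- Leibniz rule: `(z₁ - z₂)^(N+1) ∂₁A = ∂₁((z₁ - z₂)^(N+1) A) - (N+1) (z₁ - z₂)^N A`.
    -- Differentiation raises the order of locality by at most one.
    have key : ∀ (N : ℕ) (A : ℤ → ℤ → Total V), mulDiff^[N + 1] (fun m n : ℤ => (-m : ℂ) • A (m - 1) n)
        = fun m n : ℤ => (-m : ℂ) • mulDiff^[N + 1] A (m - 1) n - ((N : ℂ) + 1) • mulDiff^[N] A m n := by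
      intro N
      induction N with
      | zero =>
        intro A
        funext m n
        simp only [Function.iterate_succ_apply, Function.iterate_zero, id, mulDiff]
        push_cast
        rw [show m + 1 - 1 = m - 1 + 1 by ring]
        have : A (m - 1 + 1) n = A m n := by rw [sub_add_cancel]
        rw [this]
        module
      | succ N ih =>
        intro A
        rw [Function.iterate_succ_apply', ih]
        funext m n
        simp only [Function.iterate_succ_apply', mulDiff]
        push_cast
        rw [show m + 1 - 1 = m by ring, show m - 1 + 1 = m by ring]
        module
    simp only [derivModes, LinearMap.smul_apply, map_smul, smul_comm (sg (d + 2) (wt i))]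
    rw [key N fun m n => a m (M i n v), key N fun m n => sg (d + 2) (wt i) • M i n (a m v)]
    have hs : sg (d + 2) (wt i) = sg d (wt i) := by
      rw [sg_add_left, show (2 : ℤ) = 2 * 1 by norm_num, sg_two_mul, mul_one]
    rw [hs, mulDiff_iterate_le (Nat.le_succ N) (hN v), hN v]

end IsFormalData

end

end Fields

/-! ### Polynomials acting on formal Laurent series in several variables -/

section Action

variable {ι : Type*} [Fintype ι] [DecidableEq ι] {X : Type*} [AddCommGroup X] [Module ℂ X]

/-- Translation of a formal Laurent series in several variables. -/
def shift (s : ι → ℤ) : Module.End ℂ ((ι → ℤ) → X) where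
  toFun f n := f (n + s)
  map_add' _ _ := rfl
  map_smul' _ _ := rfl

/-- Multiplication of the formal series `∑ f(n) ∏ z_i ^ (-n_i-1)` by a polynomial. -/
def act : MvPolynomial ι ℂ →ₗ[ℂ] Module.End ℂ ((ι → ℤ) → X) :=
  -- The coefficient at `n` belongs to `∏ z_i ^ (-n_i-1)`, so multiplication by `z^s` reads the
  -- coefficient at `n + s`.
  (MvPolynomial.basisMonomials ι ℂ).constr ℂ fun s => shift fun i => (s i : ℤ)

lemma act_monomial (s : ι →₀ ℕ) (c : ℂ) :
    act (X := X) (MvPolynomial.monomial s c) = c • shift fun i => (s i : ℤ) := by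
  have h := (MvPolynomial.basisMonomials ι ℂ).constr_basis ℂ
    (fun s : ι →₀ ℕ => shift (X := X) fun i => (s i : ℤ)) s
  rw [MvPolynomial.coe_basisMonomials] at h
  rw [show MvPolynomial.monomial s c = c • MvPolynomial.monomial s (1 : ℂ) by
    rw [MvPolynomial.smul_monomial, smul_eq_mul, mul_one], map_smul, act, h]

lemma act_mul (P Q : MvPolynomial ι ℂ) : act (X := X) (P * Q) = act P * act Q := by
  induction P using MvPolynomial.induction_on' with
  | add p q hp hq => rw [add_mul, map_add, map_add, hp, hq, add_mul]
  | monomial s c =>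
    induction Q using MvPolynomial.induction_on' with
    | add p q hp hq => rw [mul_add, map_add, map_add, hp, hq, mul_add]
    | monomial t e =>
      rw [MvPolynomial.monomial_mul, act_monomial, act_monomial, act_monomial, smul_mul_smul_comm]
      congr 1
      refine LinearMap.ext fun f => funext fun n => ?_
      simp only [shift, LinearMap.coe_mk, AddHom.coe_mk, Module.End.mul_apply]
      congr 1
      funext i
      simp [add_assoc, add_comm, add_left_comm]

lemma act_one : act (X := X) (1 : MvPolynomial ι ℂ) = 1 := by
  rw [show (1 : MvPolynomial ι ℂ) = MvPolynomial.monomial 0 1 from rfl, act_monomial]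
  refine LinearMap.ext fun f => funext fun n => ?_
  simp only [shift, one_smul, LinearMap.coe_mk, AddHom.coe_mk, Module.End.one_apply]
  congr 1
  funext i
  simp

lemma act_X (i : ι) (f : (ι → ℤ) → X) (n : ι → ℤ) :
    act (MvPolynomial.X i) f n = f (n + Pi.single i 1) := by
  rw [MvPolynomial.X, act_monomial]
  simp only [shift, one_smul, LinearMap.coe_mk, AddHom.coe_mk]
  congr 2
  funext j
  by_cases h : j = i
  · subst h; simp
  · simp [h, Finsupp.single_apply, Ne.symm h, eq_comm]

lemma act_sub (i j : ι) (f : (ι → ℤ) → X) (n : ι → ℤ) :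
    act (MvPolynomial.X i - MvPolynomial.X j) f n
      = f (n + Pi.single i 1) - f (n + Pi.single j 1) := by
  rw [map_sub, LinearMap.sub_apply, Pi.sub_apply, act_X, act_X]

/-- A class of series closed under linear combinations and shifts is closed under multiplication by
polynomials. -/
lemma act_mem {S : ((ι → ℤ) → X) → Prop} (hadd : ∀ f g, S f → S g → S (f + g))
    (hsmul : ∀ (c : ℂ) f, S f → S (c • f))
    (hshift : ∀ i f, S f → S fun n => f (n + Pi.single i 1)) (P : MvPolynomial ι ℂ)
    {f : (ι → ℤ) → X} (hf : S f) : S (act P f) := by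
  induction P using MvPolynomial.induction_on generalizing f with
  | C c =>
    have : act (MvPolynomial.C c) f = c • f := by
      rw [← mul_one (MvPolynomial.C c), ← MvPolynomial.smul_eq_C_mul, map_smul, act_one]
      rfl
    rw [this]
    exact hsmul c f hf
  | add p q hp hq => rw [map_add]; exact hadd _ _ (hp hf) (hq hf)
  | mul_X p i hp =>
    rw [act_mul, Module.End.mul_apply]
    have : act (MvPolynomial.X i) f = fun n => f (n + Pi.single i 1) := funext (act_X i f)
    rw [this]
    exact hp (hshift i f hf)

lemma map_act {X' : Type*} [AddCommGroup X'] [Module ℂ X'] (φ : X →ₗ[ℂ] X') (P : MvPolynomial ι ℂ)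
    (f : (ι → ℤ) → X) (n : ι → ℤ) : φ (act P f n) = act P (fun n => φ (f n)) n := by
  induction P using MvPolynomial.induction_on' with
  | add p q hp hq => simp only [map_add, LinearMap.add_apply, Pi.add_apply, hp, hq]
  | monomial s c => simp [act_monomial, shift]

/-- The action of a power of a difference only involves two of the variables. -/
lemma act_sub_pow {i j : ι} (hij : i ≠ j) (N : ℕ) (f : (ι → ℤ) → X) (n : ι → ℤ) :
    act ((MvPolynomial.X i - MvPolynomial.X j) ^ N) f n =
      mulDiff^[N] (fun p q => f (Function.update (Function.update n i p) j q)) (n i) (n j) := by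
  induction N generalizing f with
  | zero => simp [act_one]
  | succ N ih =>
    rw [pow_succ, act_mul, Module.End.mul_apply, ih, Function.iterate_succ_apply]
    refine congrFun (congrFun (congrArg _ ?_) _) _
    funext p q
    rw [act_sub, mulDiff]
    congr 2 <;> funext k
    · by_cases hi : k = i
      · subst hi; simp [hij]
      · by_cases hj : k = j
        · subst hj; simp [hi]
        · simp [hi, hj]
    · by_cases hi : k = i
      · subst hi; simp [hij]
      · by_cases hj : k = j
        · subst hj; simp [hi]
        · simp [hi, hj]

/-- The series vanishes far out in the direction `e_j - e_i`. -/
def Vanishes (i j : ι) (f : (ι → ℤ) → X) : Prop :=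
  ∀ n : ι → ℤ, ∃ r₀ : ℕ, ∀ r : ℕ, r₀ ≤ r → f (n - Pi.single i (r : ℤ) + Pi.single j (r : ℤ) : ι → ℤ) = 0

lemma Vanishes.act {i j : ι} {f : (ι → ℤ) → X} (h : Vanishes i j f) (P : MvPolynomial ι ℂ) :
    Vanishes i j (act P f) := by
  refine act_mem (S := Vanishes i j) ?_ ?_ ?_ P h
  · intro f g hf hg n
    obtain ⟨r, hr⟩ := hf n
    obtain ⟨r', hr'⟩ := hg n
    refine ⟨max r r', fun k hk => ?_⟩
    rw [Pi.add_apply, hr k (le_trans (le_max_left _ _) hk), hr' k (le_trans (le_max_right _ _) hk),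
      add_zero]
  · intro c f hf n
    obtain ⟨r, hr⟩ := hf n
    exact ⟨r, fun k hk => by rw [Pi.smul_apply, hr k hk, smul_zero]⟩
  · intro k f hf n
    obtain ⟨r, hr⟩ := hf (n + Pi.single k 1)
    refine ⟨r, fun t ht => ?_⟩
    rw [← hr t ht]
    change f _ = f _
    congr 1
    abel

/-- The series is bounded above in the `i`-th index. -/
def BddAt (i : ι) (f : (ι → ℤ) → X) : Prop := ∃ M : ℤ, ∀ n, M ≤ n i → f n = 0

lemma BddAt.act {i : ι} {f : (ι → ℤ) → X} (h : BddAt i f) (P : MvPolynomial ι ℂ) :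
    BddAt i (act P f) := by
  refine act_mem (S := BddAt i) ?_ ?_ ?_ P h
  · rintro f g ⟨M, hM⟩ ⟨M', hM'⟩
    refine ⟨max M M', fun n hn => ?_⟩
    rw [Pi.add_apply, hM n (le_trans (le_max_left _ _) hn), hM' n (le_trans (le_max_right _ _) hn),
      add_zero]
  · rintro c f ⟨M, hM⟩
    exact ⟨M, fun n hn => by rw [Pi.smul_apply, hM n hn, smul_zero]⟩
  · rintro k f ⟨M, hM⟩
    refine ⟨M, fun n hn => hM _ ?_⟩
    by_cases hk : i = k
    · subst hk; simp; omega
    · simp [hk]; exact hn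

/-- The series is bounded below in the sum of the indices. -/
def BddTotal (f : (ι → ℤ) → X) : Prop := ∃ K : ℤ, ∀ n, ∑ i, n i < K → f n = 0

lemma BddTotal.act {f : (ι → ℤ) → X} (h : BddTotal f) (P : MvPolynomial ι ℂ) :
    BddTotal (act P f) := by
  refine act_mem (S := BddTotal) ?_ ?_ ?_ P h
  · rintro f g ⟨M, hM⟩ ⟨M', hM'⟩
    refine ⟨min M M', fun n hn => ?_⟩
    rw [Pi.add_apply, hM n (lt_of_lt_of_le hn (min_le_left _ _)),
      hM' n (lt_of_lt_of_le hn (min_le_right _ _)), add_zero]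
  · rintro c f ⟨M, hM⟩
    exact ⟨M, fun n hn => by rw [Pi.smul_apply, hM n hn, smul_zero]⟩
  · rintro k f ⟨M, hM⟩
    refine ⟨M - 1, fun n hn => hM _ ?_⟩
    have : ∑ i, (Pi.single k 1 : ι → ℤ) i = 1 := by simp [Pi.single_apply]
    simp only [Pi.add_apply, Finset.sum_add_distrib]
    omega

/-- Upper bounds on all indices and a lower bound on their sum confine the support to a finite box.
-/
lemma finite_support_of_bdd {f : (ι → ℤ) → X} (h : ∀ i, BddAt i f) (h' : BddTotal f) :
    (Function.support f).Finite := by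
  choose M hM using h
  obtain ⟨K, hK⟩ := h'
  refine (Set.finite_Icc (fun i => K - ∑ j ∈ Finset.univ.erase i, M j) M).subset fun n hn => ?_
  have h1 : ∀ i, n i ≤ M i := fun i => by
    by_contra hi
    exact hn (hM i n (by omega))
  have h2 : K ≤ ∑ i, n i := by
    by_contra hi
    exact hn (hK n (by omega))
  refine ⟨fun i => ?_, h1⟩
  have h3 : ∑ j ∈ Finset.univ.erase i, n j ≤ ∑ j ∈ Finset.univ.erase i, M j :=
    Finset.sum_le_sum fun j _ => h1 j
  rw [← Finset.add_sum_erase _ _ (Finset.mem_univ i)] at h2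
  simp only
  omega

/-- The monomial `∏ z_i ^ (-n_i-1)`. -/
def mon (z : ι → ℂ) (n : ι → ℤ) : ℂ := ∏ i, z i ^ (-n i - 1)

lemma mon_add_single {z : ι → ℂ} (hz : ∀ i, z i ≠ 0) (n : ι → ℤ) (i : ι) (r : ℤ) :
    mon z (n + Pi.single i r) = mon z n * z i ^ (-r) := by
  unfold mon
  rw [← Finset.mul_prod_erase _ _ (Finset.mem_univ i), ← Finset.mul_prod_erase _ _ (Finset.mem_univ i)]
  have : ∏ j ∈ Finset.univ.erase i, z j ^ (-(n + Pi.single i r : ι → ℤ) j - 1) =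
      ∏ j ∈ Finset.univ.erase i, z j ^ (-n j - 1) := by
    refine Finset.prod_congr rfl fun j hj => ?_
    have : j ≠ i := (Finset.mem_erase.1 hj).1
    simp [this]
  rw [this, Pi.add_apply, Pi.single_eq_same, show -(n i + r) - 1 = (-n i - 1) + (-r) by ring,
    zpow_add₀ (hz i)]
  ring

lemma hasSum_geometric_sub {a b : ℂ} (ha : a ≠ 0) (h : ‖b‖ < ‖a‖) :
    HasSum (fun r : ℕ => a ^ (-(r : ℤ) - 1) * b ^ (r : ℤ)) (1 / (a - b)) := by
  have hq : ‖b / a‖ < 1 := by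
    rw [norm_div, div_lt_one (norm_pos_iff.2 ha)]; exact h
  have h1 := (hasSum_geometric_of_norm_lt_one hq).mul_left a⁻¹
  rw [show 1 / (a - b) = a⁻¹ * (1 - b / a)⁻¹ by
    rw [← mul_inv, mul_sub, mul_one, mul_div_cancel₀ _ ha, one_div]]
  refine h1.of_eq fun r => ?_
  rw [div_pow, zpow_sub_one₀ ha, zpow_neg, zpow_natCast, zpow_natCast]
  field_simp

lemma hasSum_mul_prod {α β : Type*} {f : α → ℂ} {g : β → ℂ} {a b : ℂ} (hf : HasSum f a)
    (hg : HasSum g b) : HasSum (fun x : α × β => f x.1 * g x.2) (a * b) :=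
  hf.mul hg (summable_mul_of_summable_norm hf.summable.norm hg.summable.norm)

/-- The shift `(r, n) ↦ (n + (r+1) e_i - r e_j, r)`. -/
def geomShift (i j : ι) : ℕ × (ι → ℤ) ≃ (ι → ℤ) × ℕ where
  toFun x := (x.2 + Pi.single i ((x.1 : ℤ) + 1) - Pi.single j (x.1 : ℤ), x.1)
  invFun x := (x.2, x.1 - Pi.single i ((x.2 : ℤ) + 1) + Pi.single j (x.2 : ℤ))
  left_inv x := by
    refine Prod.ext rfl ?_
    simp only
    abel
  right_inv x := by
    refine Prod.ext ?_ rfl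
    simp only
    abel

lemma mon_geomShift {z : ι → ℂ} (hz : ∀ i, z i ≠ 0) (i j : ι) (n : ι → ℤ) (r : ℕ) :
    mon z (n + Pi.single i ((r : ℤ) + 1) - Pi.single j (r : ℤ)) =
      z i ^ (-(r : ℤ) - 1) * z j ^ (r : ℤ) * mon z n := by
  rw [sub_eq_add_neg, ← Pi.single_neg, mon_add_single hz, mon_add_single hz, neg_neg, neg_add']
  ring

/-- Multiplying `(z_i - z_j) f` by the geometric expansion of `1 / (z_i - z_j)` telescopes, and the
vanishing of `f` in the direction `e_j - e_i` removes the end term. -/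
lemma hasSum_telescope {f : (ι → ℤ) → ℂ} {i j : ι} (hv : Vanishes i j f) (n : ι → ℤ) (c : ℂ) :
    HasSum (fun r : ℕ => act (MvPolynomial.X i - MvPolynomial.X j) f
      (n - Pi.single i ((r : ℤ) + 1) + Pi.single j (r : ℤ)) * c) (f n * c) := by
  obtain ⟨r₀, hr₀⟩ := hv n
  set t : ℕ → ℂ := fun r => f (n - Pi.single i (r : ℤ) + Pi.single j (r : ℤ)) with ht
  have hFt : ∀ r : ℕ, act (MvPolynomial.X i - MvPolynomial.X j) f
      (n - Pi.single i ((r : ℤ) + 1) + Pi.single j (r : ℤ)) = t r - t (r + 1) := by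
    intro r
    rw [act_sub]
    simp only [ht]
    push_cast
    rw [Pi.single_add, Pi.single_add]
    congr 2 <;> abel
  have h3 : HasSum (fun r => (t r - t (r + 1)) * c)
      (∑ r ∈ Finset.range r₀, (t r - t (r + 1)) * c) := by
    refine hasSum_sum_of_ne_finset_zero fun r hr => ?_
    have hr : r₀ ≤ r := by simpa using hr
    have h1 : t r = 0 := hr₀ r hr
    have h2 : t (r + 1) = 0 := hr₀ (r + 1) (by omega)
    rw [h1, h2, sub_zero, zero_mul]
  rw [← Finset.sum_mul, Finset.sum_range_sub'] at h3
  have h4 : t r₀ = 0 := hr₀ r₀ le_rfl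
  have h5 : t 0 = f n := by simp [ht]
  rw [h4, h5, sub_zero] at h3
  exact h3.of_eq fun r => by rw [hFt]

/-- Division of an absolutely convergent series by `z_i - z_j`, expanded in `|z_i| > |z_j|`. -/
lemma hasSum_div_sub {f : (ι → ℤ) → ℂ} {i j : ι} (hv : Vanishes i j f) {z : ι → ℂ}
    (hz : ∀ i, z i ≠ 0) (hlt : ‖z j‖ < ‖z i‖) {Φ : ℂ}
    (h : HasSum (fun n => act (MvPolynomial.X i - MvPolynomial.X j) f n * mon z n) Φ) :
    HasSum (fun n => f n * mon z n) (Φ / (z i - z j)) := by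
  generalize hF : act (MvPolynomial.X i - MvPolynomial.X j) f = F at h
  have hg := hasSum_geometric_sub (hz i) hlt
  have hprod : HasSum (fun x : ℕ × (ι → ℤ) =>
      z i ^ (-(x.1 : ℤ) - 1) * z j ^ (x.1 : ℤ) * (F x.2 * mon z x.2))
      (1 / (z i - z j) * Φ) := by
    have := hasSum_mul_prod hg h
    exact this
  rw [show 1 / (z i - z j) * Φ = Φ / (z i - z j) by ring] at hprod
  -- The double series converges absolutely, so it may be regrouped by the total monomial; each
  -- group is then a telescoping sum.
  have h2 : HasSum (fun x : (ι → ℤ) × ℕ =>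
      F (x.1 - Pi.single i ((x.2 : ℤ) + 1) + Pi.single j (x.2 : ℤ)) * mon z x.1)
      (Φ / (z i - z j)) := by
    refine (Equiv.hasSum_iff (geomShift i j)).1 (hprod.of_eq fun x => ?_)
    obtain ⟨r, n⟩ := x
    change F (n + Pi.single i ((r : ℤ) + 1) - Pi.single j (r : ℤ) - Pi.single i ((r : ℤ) + 1) +
        Pi.single j (r : ℤ)) * mon z (n + Pi.single i ((r : ℤ) + 1) - Pi.single j (r : ℤ)) =
      z i ^ (-(r : ℤ) - 1) * z j ^ (r : ℤ) * (F n * mon z n)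
    rw [mon_geomShift hz]
    have : n + Pi.single i ((r : ℤ) + 1) - Pi.single j (r : ℤ) - Pi.single i ((r : ℤ) + 1) +
        Pi.single j (r : ℤ) = n := by abel
    rw [this]
    ring
  refine h2.prod_fiberwise fun n => ?_
  rw [← hF]
  exact hasSum_telescope hv n (mon z n)

lemma hasSum_div_sub_pow {f : (ι → ℤ) → ℂ} {i j : ι} (hv : Vanishes i j f)
    {z : ι → ℂ} (hz : ∀ i, z i ≠ 0) (hlt : ‖z j‖ < ‖z i‖) {Φ : ℂ} (N : ℕ)
    (h : HasSum (fun n => act ((MvPolynomial.X i - MvPolynomial.X j) ^ N) f n * mon z n) Φ) :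
    HasSum (fun n => f n * mon z n) (Φ / (z i - z j) ^ N) := by
  induction N generalizing f Φ with
  | zero => simpa [act_one] using h
  | succ N ih =>
    rw [pow_succ, act_mul] at h
    have := hasSum_div_sub hv hz hlt (ih (hv.act _) h)
    rwa [div_div, ← pow_succ] at this

/-- Division of a series by a product of powers of differences. -/
lemma hasSum_div_prod {f : (ι → ℤ) → ℂ} (S : Finset (ι × ι))
    (hv : ∀ p ∈ S, Vanishes p.1 p.2 f) {z : ι → ℂ} (hz : ∀ i, z i ≠ 0)
    (hlt : ∀ p ∈ S, ‖z p.2‖ < ‖z p.1‖) {Φ : ℂ} (N : ℕ)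
    (h : HasSum (fun n =>
      act (∏ p ∈ S, (MvPolynomial.X p.1 - MvPolynomial.X p.2) ^ N) f n * mon z n) Φ) :
    HasSum (fun n => f n * mon z n) (Φ / ∏ p ∈ S, (z p.1 - z p.2) ^ N) := by
  induction S using Finset.induction_on generalizing f with
  | empty => simpa [act_one] using h
  | insert p S hp ih =>
    rw [Finset.prod_insert hp, mul_comm, act_mul] at h
    have h1 := ih (f := act ((MvPolynomial.X p.1 - MvPolynomial.X p.2) ^ N) f)
      (fun q hq => (hv q (Finset.mem_insert_of_mem hq)).act _)
      (fun q hq => hlt q (Finset.mem_insert_of_mem hq)) h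
    have h2 := hasSum_div_sub_pow
      (hv p (Finset.mem_insert_self _ _)) hz (hlt p (Finset.mem_insert_self _ _)) N h1
    rwa [div_div, mul_comm, ← Finset.prod_insert (f := fun p => (z p.1 - z p.2) ^ N) hp] at h2

/-- A finite Laurent sum is a polynomial divided by a power of the product of the variables. -/
lemma exists_poly_of_finite {g : (ι → ℤ) → ℂ} (hg : (Function.support g).Finite) :
    ∃ (P : MvPolynomial ι ℂ) (N : ℕ), ∀ z : ι → ℂ, (∀ i, z i ≠ 0) →
      HasSum (fun n => g n * mon z n) (MvPolynomial.eval z P / (∏ i, z i) ^ N) := by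
  classical
  -- This makes every exponent `N - n i - 1` nonnegative, so the truncation in `toNat` is harmless.
  obtain ⟨N, hN⟩ : ∃ N : ℕ, ∀ n ∈ hg.toFinset, ∀ i, n i + 1 ≤ N := by
    refine ⟨∑ n ∈ hg.toFinset, ∑ i, (n i + 1).toNat, fun n hn i => ?_⟩
    have h1 : (n i + 1).toNat ≤ ∑ i, (n i + 1).toNat :=
      Finset.single_le_sum (f := fun i => (n i + 1).toNat) (fun _ _ => Nat.zero_le _)
        (Finset.mem_univ i)
    have h2 : ∑ i, (n i + 1).toNat ≤ ∑ n ∈ hg.toFinset, ∑ i, (n i + 1).toNat :=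
      Finset.single_le_sum (f := fun n : ι → ℤ => ∑ i, (n i + 1).toNat) (fun _ _ => Nat.zero_le _) hn
    have h3 := h1.trans h2
    have h4 := Int.self_le_toNat (n i + 1)
    have h5 : ((n i + 1).toNat : ℤ) ≤ (∑ n ∈ hg.toFinset, ∑ i, (n i + 1).toNat : ℕ) := by
      exact_mod_cast h3
    exact h4.trans h5
  refine ⟨∑ n ∈ hg.toFinset, MvPolynomial.C (g n) *
    ∏ i, MvPolynomial.X i ^ ((N : ℤ) - n i - 1).toNat, N, fun z hz => ?_⟩
  have h1 : HasSum (fun n => g n * mon z n) (∑ n ∈ hg.toFinset, g n * mon z n) := by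
    refine hasSum_sum_of_ne_finset_zero fun n hn => ?_
    have : g n = 0 := by simpa using hn
    rw [this, zero_mul]
  convert h1 using 1
  rw [map_sum, Finset.sum_div]
  refine Finset.sum_congr rfl fun n hn => ?_
  rw [map_mul, MvPolynomial.eval_C, map_prod, mul_div_assoc, ← Finset.prod_pow, ← Finset.prod_div_distrib]
  congr 1
  refine Finset.prod_congr rfl fun i _ => ?_
  rw [map_pow, MvPolynomial.eval_X, div_eq_iff (pow_ne_zero _ (hz i)), ← zpow_natCast, ← zpow_natCast,
    ← zpow_add₀ (hz i)]
  congr 1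
  have := hN n hn i
  omega

end Action

/-! ### Series that represent rational functions -/

section RationalSeries

variable {ι : Type*} [Fintype ι] [DecidableEq ι]

/-- The value of a finite Laurent sum. -/
def laurentEval (g : (ι → ℤ) → ℂ) (z : ι → ℂ) : ℂ := ∑ᶠ n, g n * mon z n

lemma finite_mul_mon {g : (ι → ℤ) → ℂ} (hg : (Function.support g).Finite) (z : ι → ℂ) :
    (Function.support fun n => g n * mon z n).Finite :=
  hg.subset fun n hn => left_ne_zero_of_mul hn

lemma laurentEval_add {f g : (ι → ℤ) → ℂ} (hf : (Function.support f).Finite)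
    (hg : (Function.support g).Finite) (z : ι → ℂ) :
    laurentEval (f + g) z = laurentEval f z + laurentEval g z := by
  unfold laurentEval
  rw [← finsum_add_distrib (finite_mul_mon hf z) (finite_mul_mon hg z)]
  simp only [Pi.add_apply, add_mul]

lemma laurentEval_smul (c : ℂ) (g : (ι → ℤ) → ℂ) (z : ι → ℂ) :
    laurentEval (c • g) z = c * laurentEval g z := by
  unfold laurentEval
  rw [← smul_eq_mul, smul_finsum]
  simp only [Pi.smul_apply, smul_eq_mul, mul_assoc]

lemma laurentEval_zero (z : ι → ℂ) : laurentEval (0 : (ι → ℤ) → ℂ) z = 0 := by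
  simp [laurentEval]

lemma laurentEval_single (m : ι → ℤ) (c : ℂ) (z : ι → ℂ) :
    laurentEval (Pi.single m c) z = c * mon z m := by
  unfold laurentEval
  rw [finsum_eq_single _ m fun n hn => by rw [Pi.single_eq_of_ne hn, zero_mul], Pi.single_eq_same]

lemma hasSum_laurentEval {g : (ι → ℤ) → ℂ} (hg : (Function.support g).Finite) (z : ι → ℂ) :
    HasSum (fun n => g n * mon z n) (laurentEval g z) := by
  unfold laurentEval
  rw [finsum_eq_sum_of_support_subset (s := hg.toFinset) _ (fun n hn => by
    simpa using left_ne_zero_of_mul hn)]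
  exact hasSum_sum_of_ne_finset_zero fun n hn => by
    have : g n = 0 := by simpa using hn
    rw [this, zero_mul]

lemma finite_support_shift {g : (ι → ℤ) → ℂ} (hg : (Function.support g).Finite) (i : ι) :
    (Function.support fun n : ι → ℤ => g (n + Pi.single i 1)).Finite :=
  hg.preimage ((add_left_injective (Pi.single i 1 : ι → ℤ)).injOn)

lemma finite_support_add {f g : (ι → ℤ) → ℂ} (hf : (Function.support f).Finite)
    (hg : (Function.support g).Finite) : (Function.support (f + g)).Finite :=
  (hf.union hg).subset (Function.support_add f g)

lemma finite_support_smul {g : (ι → ℤ) → ℂ} (hg : (Function.support g).Finite) (c : ℂ) :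
    (Function.support (c • g)).Finite := by
  refine hg.subset fun n hn h => hn ?_
  rw [Pi.smul_apply, h, smul_zero]

lemma finite_support_act {g : (ι → ℤ) → ℂ} (hg : (Function.support g).Finite)
    (P : MvPolynomial ι ℂ) : (Function.support (act P g)).Finite :=
  act_mem (S := fun g => (Function.support g).Finite) (fun _ _ => finite_support_add)
    (fun c _ h => finite_support_smul h c) (fun i _ h => finite_support_shift h i) P hg

lemma act_C (c : ℂ) (f : (ι → ℤ) → ℂ) : act (MvPolynomial.C c) f = c • f := by
  rw [← mul_one (MvPolynomial.C c), ← MvPolynomial.smul_eq_C_mul, map_smul, act_one]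
  rfl

lemma laurentEval_act {g : (ι → ℤ) → ℂ} (hg : (Function.support g).Finite)
    (P : MvPolynomial ι ℂ) {z : ι → ℂ} (hz : ∀ i, z i ≠ 0) :
    laurentEval (act P g) z = MvPolynomial.eval z P * laurentEval g z := by
  induction P using MvPolynomial.induction_on generalizing g with
  | C c => rw [act_C, laurentEval_smul, MvPolynomial.eval_C]
  | add p q hp hq =>
    rw [map_add, LinearMap.add_apply, laurentEval_add (finite_support_act hg _)
      (finite_support_act hg _), hp hg, hq hg, map_add, add_mul]
  | mul_X p i hp =>
    rw [act_mul, Module.End.mul_apply, hp (finite_support_act hg _), map_mul, mul_assoc,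
      MvPolynomial.eval_X]
    congr 1
    rw [show act (MvPolynomial.X i) g = fun n => g (n + Pi.single i 1) from funext (act_X i g)]
    unfold laurentEval
    rw [← smul_eq_mul (z i), smul_finsum]
    refine finsum_eq_of_bijective (fun n => n + Pi.single i 1)
      (Equiv.addRight (Pi.single i 1)).bijective fun n => ?_
    rw [mon_add_single hz, zpow_neg_one, smul_eq_mul]
    field_simp [hz i]

/-- The series becomes a finite Laurent sum after multiplication by a power of `Δ`. -/
def IsRational (Δ : MvPolynomial ι ℂ) (f : (ι → ℤ) → ℂ) : Prop :=
  ∃ N : ℕ, (Function.support (act (Δ ^ N) f)).Finite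

open Classical in
/-- The value of the rational function represented by a series. -/
def ratEval (Δ : MvPolynomial ι ℂ) (f : (ι → ℤ) → ℂ) (z : ι → ℂ) : ℂ :=
  if h : IsRational Δ f then
    laurentEval (act (Δ ^ h.choose) f) z / MvPolynomial.eval z Δ ^ h.choose else 0

variable {Δ : MvPolynomial ι ℂ}

lemma IsRational.of_finite {f : (ι → ℤ) → ℂ} (hf : (Function.support f).Finite) :
    IsRational Δ f := ⟨0, by simpa [act_one] using hf⟩

/-- The value does not depend on the chosen denominator: if both `Q f` and `Δ^N f` are finite sums,
then `Q Δ^N f` can be evaluated through either of them. -/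
lemma ratEval_eq_div {f : (ι → ℤ) → ℂ} (h : IsRational Δ f) {z : ι → ℂ} (hz : ∀ i, z i ≠ 0)
    (hΔ : MvPolynomial.eval z Δ ≠ 0) {Q : MvPolynomial ι ℂ}
    (hQ : (Function.support (act Q f)).Finite) (hQz : MvPolynomial.eval z Q ≠ 0) :
    ratEval Δ f z = laurentEval (act Q f) z / MvPolynomial.eval z Q := by
  rw [ratEval, dif_pos h, div_eq_div_iff (pow_ne_zero _ hΔ) hQz]
  have h1 := laurentEval_act h.choose_spec Q hz
  have h2 := laurentEval_act hQ (Δ ^ h.choose) hz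
  rw [← Module.End.mul_apply, ← act_mul] at h1 h2
  rw [mul_comm Q, h2, map_pow] at h1
  rw [mul_comm, ← h1, mul_comm]

lemma ratEval_of_finite {f : (ι → ℤ) → ℂ} (hf : (Function.support f).Finite) {z : ι → ℂ}
    (hz : ∀ i, z i ≠ 0) (hΔ : MvPolynomial.eval z Δ ≠ 0) : ratEval Δ f z = laurentEval f z := by
  have := ratEval_eq_div (IsRational.of_finite hf) hz hΔ (Q := 1) (by simpa [act_one] using hf)
    (by simp)
  simpa [act_one] using this

lemma IsRational.exists_common {f g : (ι → ℤ) → ℂ} (hf : IsRational Δ f) (hg : IsRational Δ g) :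
    ∃ N : ℕ, (Function.support (act (Δ ^ N) f)).Finite ∧
      (Function.support (act (Δ ^ N) g)).Finite := by
  obtain ⟨N, hN⟩ := hf
  obtain ⟨N', hN'⟩ := hg
  refine ⟨N + N', ?_, ?_⟩
  · rw [pow_add, mul_comm, act_mul]; exact finite_support_act hN _
  · rw [pow_add, act_mul]; exact finite_support_act hN' _

lemma IsRational.add {f g : (ι → ℤ) → ℂ} (hf : IsRational Δ f) (hg : IsRational Δ g) :
    IsRational Δ (f + g) := by
  obtain ⟨N, h1, h2⟩ := hf.exists_common hg
  exact ⟨N, by rw [map_add]; exact finite_support_add h1 h2⟩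

lemma ratEval_add {f g : (ι → ℤ) → ℂ} (hf : IsRational Δ f) (hg : IsRational Δ g) {z : ι → ℂ}
    (hz : ∀ i, z i ≠ 0) (hΔ : MvPolynomial.eval z Δ ≠ 0) :
    ratEval Δ (f + g) z = ratEval Δ f z + ratEval Δ g z := by
  obtain ⟨N, h1, h2⟩ := hf.exists_common hg
  have h3 : MvPolynomial.eval z (Δ ^ N) ≠ 0 := by rw [map_pow]; exact pow_ne_zero _ hΔ
  rw [ratEval_eq_div hf hz hΔ h1 h3, ratEval_eq_div hg hz hΔ h2 h3,
    ratEval_eq_div (hf.add hg) hz hΔ (Q := Δ ^ N) (by rw [map_add]; exact finite_support_add h1 h2) h3,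
    map_add, laurentEval_add h1 h2, add_div]

lemma IsRational.act {f : (ι → ℤ) → ℂ} (hf : IsRational Δ f) (Q : MvPolynomial ι ℂ) :
    IsRational Δ (act Q f) := by
  obtain ⟨N, hN⟩ := hf
  refine ⟨N, ?_⟩
  rw [← Module.End.mul_apply, ← act_mul, mul_comm, act_mul]
  exact finite_support_act hN _

lemma ratEval_act {f : (ι → ℤ) → ℂ} (hf : IsRational Δ f) (Q : MvPolynomial ι ℂ) {z : ι → ℂ}
    (hz : ∀ i, z i ≠ 0) (hΔ : MvPolynomial.eval z Δ ≠ 0) :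
    ratEval Δ (HalfGraded.act Q f) z = MvPolynomial.eval z Q * ratEval Δ f z := by
  obtain ⟨N, hN⟩ := id hf
  have h3 : MvPolynomial.eval z (Δ ^ N) ≠ 0 := by rw [map_pow]; exact pow_ne_zero _ hΔ
  have e : HalfGraded.act (Δ ^ N) (HalfGraded.act Q f) = HalfGraded.act Q (HalfGraded.act (Δ ^ N) f) := by
    rw [← Module.End.mul_apply, ← act_mul, mul_comm, act_mul]; rfl
  rw [ratEval_eq_div hf hz hΔ hN h3, ratEval_eq_div (hf.act Q) hz hΔ (Q := Δ ^ N)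
    (by rw [e]; exact finite_support_act hN _) h3, e, laurentEval_act hN _ hz, mul_div_assoc]

lemma IsRational.smul {f : (ι → ℤ) → ℂ} (hf : IsRational Δ f) (c : ℂ) : IsRational Δ (c • f) := by
  rw [← act_C]; exact hf.act _

lemma ratEval_smul {f : (ι → ℤ) → ℂ} (hf : IsRational Δ f) (c : ℂ) {z : ι → ℂ}
    (hz : ∀ i, z i ≠ 0) (hΔ : MvPolynomial.eval z Δ ≠ 0) :
    ratEval Δ (c • f) z = c * ratEval Δ f z := by
  rw [← act_C, ratEval_act hf _ hz hΔ, MvPolynomial.eval_C]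

lemma ratEval_zero (z : ι → ℂ) : ratEval Δ (0 : (ι → ℤ) → ℂ) z = 0 := by
  unfold ratEval
  split_ifs
  · rw [map_zero, laurentEval_zero, zero_div]
  · rfl

end RationalSeries

/-! ### Poles along the diagonals -/

section Vandermonde

/-- The product of the differences of the variables. -/
def vdm (k : ℕ) : MvPolynomial (Fin k) ℂ :=
  ∏ i, ∏ j ∈ Finset.Ioi i, (MvPolynomial.X i - MvPolynomial.X j)

lemma eval_vdm {k : ℕ} (z : Fin k → ℂ) :
    MvPolynomial.eval z (vdm k) = ∏ i, ∏ j ∈ Finset.Ioi i, (z i - z j) := by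
  simp [vdm, map_prod]

/-- The points with non-zero and distinct coordinates. -/
def Good {k : ℕ} (z : Fin k → ℂ) : Prop := (∀ i, z i ≠ 0) ∧ Function.Injective z

lemma Good.eval_vdm_ne {k : ℕ} {z : Fin k → ℂ} (hz : Good z) : MvPolynomial.eval z (vdm k) ≠ 0 := by
  rw [eval_vdm]
  refine Finset.prod_ne_zero_iff.2 fun i _ => Finset.prod_ne_zero_iff.2 fun j hj => ?_
  exact sub_ne_zero.2 fun h => (Finset.mem_Ioi.1 hj).ne (hz.2 h)

lemma exists_ratFun {k : ℕ} {f : (Fin k → ℤ) → ℂ} (hf : IsRational (vdm k) f) :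
    ∃ (P : MvPolynomial (Fin k) ℂ) (N : ℕ), ∀ z, Good z → ratFun P N z = ratEval (vdm k) f z := by
  obtain ⟨N, hN⟩ := id hf
  obtain ⟨P, N', hP⟩ := exists_poly_of_finite hN
  -- The coordinate factors carry the exponent `N'` and the Vandermonde factor carries `N`; the
  -- padding brings both to `N + N'`, since `ratFun` has a single exponent.
  refine ⟨P * (∏ i, MvPolynomial.X i) ^ N * vdm k ^ N', N + N', fun z hz => ?_⟩
  have h0 : ∏ i, z i ≠ 0 := Finset.prod_ne_zero_iff.2 fun i _ => hz.1 i
  have h1 := hz.eval_vdm_ne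
  rw [ratEval_eq_div hf hz.1 h1 hN (by rw [map_pow]; exact pow_ne_zero _ h1),
    ← (hP z hz.1).unique (hasSum_laurentEval hN z), ratFun, ← eval_vdm]
  simp only [map_mul, map_pow, map_prod, MvPolynomial.eval_X]
  field_simp
  ring

lemma vdm_pow_eq (k N : ℕ) : vdm k ^ N = ∏ p ∈ (Finset.univ : Finset (Fin k × Fin k)).filter
    (fun p => p.1 < p.2), (MvPolynomial.X p.1 - MvPolynomial.X p.2) ^ N := by
  rw [Finset.prod_pow]
  congr 1
  rw [Finset.prod_filter, ← Finset.univ_product_univ, Finset.prod_product, vdm]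
  refine Finset.prod_congr rfl fun i _ => ?_
  rw [← Finset.prod_filter]
  congr 1
  ext j
  simp

/-- The finite Laurent sum is divided by the differences one after another, each expanded in the
domain `|z_i| > |z_j|`; by `Vanishes` the resulting expansion is `f` and not another series with the
same product. -/
lemma hasSum_ratEval {k : ℕ} {f : (Fin k → ℤ) → ℂ} (hf : IsRational (vdm k) f)
    (hv : ∀ i j, i < j → Vanishes i j f) {z : Fin k → ℂ} (hz : ∀ i, z i ≠ 0)
    (ha : StrictAnti fun i => ‖z i‖) : HasSum (fun n => f n * mon z n) (ratEval (vdm k) f z) := by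
  have hg : Good z := ⟨hz, fun i j h => ha.injective (congrArg norm h)⟩
  obtain ⟨N, hN⟩ := id hf
  have h1 := hg.eval_vdm_ne
  rw [ratEval_eq_div hf hz h1 hN (by rw [map_pow]; exact pow_ne_zero _ h1)]
  have h2 := hasSum_laurentEval hN z
  rw [vdm_pow_eq] at h2 ⊢
  have := hasSum_div_prod (Finset.univ.filter fun p : Fin k × Fin k => p.1 < p.2)
    (fun p hp => hv _ _ (Finset.mem_filter.1 hp).2) hz
    (fun p hp => ha (Finset.mem_filter.1 hp).2) N h2
  simpa [map_prod] using this

end Vandermonde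

/-! ### Products of local fields -/

section Products

variable {V : ℤ → Type u} [∀ k, AddCommGroup (V k)] [∀ k, Module ℂ (V k)]
variable {ι : Type*} [Fintype ι] [DecidableEq ι]

/-- The product of the operators `c i (n i)` along a list of indices. -/
def prodL (c : ι → Modes V) (l : List ι) (n : ι → ℤ) : Module.End ℂ (Total V) :=
  (l.map fun i => c i (n i)).prod

lemma prodL_cons (c : ι → Modes V) (i : ι) (l : List ι) (n : ι → ℤ) :
    prodL c (i :: l) n = c i (n i) * prodL c l n := by simp [prodL]

lemma prodL_append (c : ι → Modes V) (l l' : List ι) (n : ι → ℤ) :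
    prodL c (l ++ l') n = prodL c l n * prodL c l' n := by simp [prodL]

lemma prodL_congr (c : ι → Modes V) {l : List ι} {n n' : ι → ℤ} (h : ∀ i ∈ l, n i = n' i) :
    prodL c l n = prodL c l n' := by
  unfold prodL
  congr 1
  exact List.map_congr_left fun i hi => by rw [h i hi]

/-- Exchanging two neighbouring factors. -/
lemma act_prodL_swap {c : ι → Modes V} {i j : ι} {l₁ l₂ : List ι} (hij : i ≠ j)
    (hi₁ : i ∉ l₁) (hj₁ : j ∉ l₁) (hi₂ : i ∉ l₂) (hj₂ : j ∉ l₂) {s : ℂ} {N : ℕ}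
    (hN : ∀ v, mulDiff^[N] (fun m n => c i m (c j n v)) =
      mulDiff^[N] (fun m n => s • c j n (c i m v))) (v : Total V) :
    act ((MvPolynomial.X i - MvPolynomial.X j) ^ N) (fun n => prodL c (l₁ ++ i :: j :: l₂) n v) =
      s • act ((MvPolynomial.X i - MvPolynomial.X j) ^ N)
        (fun n => prodL c (l₁ ++ j :: i :: l₂) n v) := by
  rw [← map_smul]
  funext n
  rw [act_sub_pow hij, act_sub_pow hij]
  have h1 : ∀ (p q : ℤ) (l : List ι), i ∉ l → j ∉ l →
      prodL c l (Function.update (Function.update n i p) j q) = prodL c l n := by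
    intro p q l hi hj
    refine prodL_congr c fun k hk => ?_
    have h1 : k ≠ i := fun h => hi (h ▸ hk)
    have h2 : k ≠ j := fun h => hj (h ▸ hk)
    simp [h1, h2]
  have e1 : (fun p q => prodL c (l₁ ++ i :: j :: l₂)
      (Function.update (Function.update n i p) j q) v) =
      fun p q => (prodL c l₁ n).toAddMonoidHom (c i p (c j q (prodL c l₂ n v))) := by
    funext p q
    rw [prodL_append, prodL_cons, prodL_cons, h1 p q l₁ hi₁ hj₁, h1 p q l₂ hi₂ hj₂]
    simp [hij]
  have e2 : (fun p q => (s • fun n => prodL c (l₁ ++ j :: i :: l₂) n v)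
      (Function.update (Function.update n i p) j q)) =
      fun p q => (prodL c l₁ n).toAddMonoidHom (s • c j q (c i p (prodL c l₂ n v))) := by
    funext p q
    rw [Pi.smul_apply, prodL_append, prodL_cons, prodL_cons, h1 p q l₁ hi₁ hj₁, h1 p q l₂ hi₂ hj₂]
    simp [hij]
  rw [e1, e2, mulDiff_iterate_map, mulDiff_iterate_map, hN]

/-- Moving a factor to the right end. -/
lemma act_prodL_move {c : ι → Modes V} {N : ℕ} {s : ι → ι → ℂ} (hN : ∀ i j v,
    mulDiff^[N] (fun m n => c i m (c j n v)) = mulDiff^[N] (fun m n => s i j • c j n (c i m v)))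
    {i : ι} (v : Total V) (l₂ : List ι) : ∀ l₁ : List ι, (l₁ ++ i :: l₂).Nodup →
    ∃ t : ℂ, act ((l₂.map fun j => MvPolynomial.X i - MvPolynomial.X j).prod ^ N)
      (fun n => prodL c (l₁ ++ i :: l₂) n v) =
      t • act ((l₂.map fun j => MvPolynomial.X i - MvPolynomial.X j).prod ^ N)
      (fun n => prodL c (l₁ ++ l₂ ++ [i]) n v) := by
  induction l₂ with
  | nil => exact fun l₁ _ => ⟨1, by simp⟩
  | cons j l₂ ih =>
    intro l₁ hl
    have hl' : (l₁ ++ [j] ++ i :: l₂).Nodup := by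
      refine (List.Perm.nodup_iff ?_).1 hl
      simp only [List.append_assoc, List.singleton_append]
      exact List.Perm.append_left _ (List.Perm.swap _ _ _)
    obtain ⟨t, ht⟩ := ih (l₁ ++ [j]) hl'
    simp only [List.nodup_append, List.nodup_cons, List.mem_cons, not_or] at hl
    obtain ⟨hl₁, ⟨⟨hij, hi₂⟩, hj₂, hl₂⟩, hd⟩ := hl
    have hi₁ : i ∉ l₁ := fun h => hd i h i (Or.inl rfl) rfl
    have hj₁ : j ∉ l₁ := fun h => hd j h j (Or.inr (Or.inl rfl)) rfl
    have hs := act_prodL_swap hij hi₁ hj₁ hi₂ hj₂ (hN i j) v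
    refine ⟨s i j * t, ?_⟩
    rw [List.map_cons, List.prod_cons, mul_pow, mul_comm, act_mul, Module.End.mul_apply, hs,
      map_smul, ← Module.End.mul_apply, ← act_mul, mul_comm, act_mul, Module.End.mul_apply,
      show l₁ ++ j :: i :: l₂ = l₁ ++ [j] ++ i :: l₂ by simp, ht, map_smul, smul_smul,
      ← Module.End.mul_apply, ← act_mul]
    simp

/-- Locality moves the factor `i` to the right end, where it acts directly on `v` and truncation
bounds its index. -/
lemma prodL_bddAt {c : ι → Modes V} (hc : ∀ i, IsTrunc (c i)) {N : ℕ} {s : ι → ι → ℂ}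
    (hN : ∀ i j v, mulDiff^[N] (fun m n => c i m (c j n v)) =
      mulDiff^[N] (fun m n => s i j • c j n (c i m v)))
    {i : ι} (v : Total V) {l₁ l₂ : List ι} (hl : (l₁ ++ i :: l₂).Nodup) {Δ : MvPolynomial ι ℂ}
    (hΔ : (l₂.map fun j => MvPolynomial.X i - MvPolynomial.X j).prod ∣ Δ) :
    BddAt i (act (Δ ^ N) fun n => prodL c (l₁ ++ i :: l₂) n v) := by
  obtain ⟨Q, rfl⟩ := hΔ
  obtain ⟨t, ht⟩ := act_prodL_move hN v l₂ l₁ hl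
  rw [mul_pow, mul_comm, act_mul, Module.End.mul_apply, ht, ← map_smul]
  refine BddAt.act (BddAt.act ?_ _) _
  obtain ⟨M, hM⟩ := hc i v
  refine ⟨M, fun n hn => ?_⟩
  rw [Pi.smul_apply, prodL_append, prodL_cons]
  simp [prodL, hM _ hn]

/-- Raising `n_j` leaves the operators to the right of `j` unchanged, so the mode of `c j`
eventually kills the fixed vector they produce from `v`. -/
lemma prodL_vanishes {c : ι → Modes V} (hc : ∀ i, IsTrunc (c i)) {i j : ι} (hij : i ≠ j)
    (v : Total V) {l₁ l₂ : List ι} (hi : i ∉ l₂) (hj : j ∉ l₂) :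
    Vanishes i j fun n => prodL c (l₁ ++ j :: l₂) n v := by
  intro n
  obtain ⟨M, hM⟩ := hc j (prodL c l₂ n v)
  refine ⟨(M - n j).toNat, fun r hr => ?_⟩
  beta_reduce
  rw [prodL_append, prodL_cons]
  have h1 : prodL c l₂ (n - Pi.single i (r : ℤ) + Pi.single j (r : ℤ) : ι → ℤ) = prodL c l₂ n := by
    refine prodL_congr c fun k hk => ?_
    have h1 : k ≠ i := fun h => hi (h ▸ hk)
    have h2 : k ≠ j := fun h => hj (h ▸ hk)
    simp [h1, h2]
  rw [h1, Module.End.mul_apply, Module.End.mul_apply, hM, map_zero]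
  simp [hij.symm]
  omega

lemma isHomogOp_prodL {c : ι → Modes V} {d : ι → ℤ} (hc : ∀ i, IsHomog (d i) (c i)) (l : List ι)
    (n : ι → ℤ) : IsHomogOp (l.map fun i => d i - 2 * n i - 2).sum (prodL c l n) := by
  induction l with
  | nil =>
    intro k x j hj
    exact ofDeg_ne _ (by simpa using hj)
  | cons i l ih =>
    rw [prodL_cons, List.map_cons, List.sum_cons]
    exact (hc i (n i)).comp ih

/-- For homogeneous `v` and `v'` the weights fix the sum of the indices; in general finitely many
sums occur. -/
lemma prodL_bddTotal {c : ι → Modes V} {d : ι → ℤ} (hc : ∀ i, IsHomog (d i) (c i)) {l : List ι}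
    (hl : l.Nodup) (hl' : ∀ i, i ∈ l) (v : Total V) (v' : GradedDual V) :
    BddTotal fun n => pair v' (incl (prodL c l n v)) := by
  have hsum : ∀ n : ι → ℤ, (l.map fun i => d i - 2 * n i - 2).sum = ∑ i, (d i - 2) - 2 * ∑ i, n i := by
    intro n
    have : (l.map fun i => d i - 2 * n i - 2).sum = ∑ i ∈ l.toFinset, (d i - 2 * n i - 2) :=
      (List.sum_toFinset _ hl).symm
    rw [this, show l.toFinset = Finset.univ from Finset.eq_univ_iff_forall.2 fun i => by simp [hl'],
      Finset.mul_sum, ← Finset.sum_sub_distrib]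
    exact Finset.sum_congr rfl fun i _ => by ring
  induction v' using gradedDual_induction with
  | h0 => exact ⟨0, fun n _ => by simp⟩
  | h2 x y hx hy =>
    obtain ⟨K, hK⟩ := hx
    obtain ⟨K', hK'⟩ := hy
    exact ⟨min K K', fun n hn => by
      simp only [map_add, LinearMap.add_apply]
      exact (congrArg₂ (· + ·) (hK n (lt_of_lt_of_le hn (min_le_left _ _)))
        (hK' n (lt_of_lt_of_le hn (min_le_right _ _)))).trans (add_zero _)⟩
  | h1 k f =>
    induction v using total_induction with
    | h0 => exact ⟨0, fun n _ => by simp⟩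
    | h2 x y hx hy =>
      obtain ⟨K, hK⟩ := hx
      obtain ⟨K', hK'⟩ := hy
      exact ⟨min K K', fun n hn => by
        simp only [map_add, incl_add]
        exact (congrArg₂ (· + ·) (hK n (lt_of_lt_of_le hn (min_le_left _ _)))
          (hK' n (lt_of_lt_of_le hn (min_le_right _ _)))).trans (add_zero _)⟩
    | h1 j x =>
      refine ⟨-(|j + ∑ i, (d i - 2) - k|), fun n hn => ?_⟩
      simp only
      rw [pair_dualOf, show incl (prodL c l n (ofDeg j x)) k = 0 from
        isHomogOp_prodL hc l n j x k (by
          rw [hsum]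
          have := neg_abs_le (j + ∑ i, (d i - 2) - k)
          rcases abs_cases (j + ∑ i, (d i - 2) - k) with _ | _ <;> omega), map_zero]

end Products

/-! ### Rationality of matrix coefficients -/

section FinProducts

variable {V : ℤ → Type u} [∀ k, AddCommGroup (V k)] [∀ k, Module ℂ (V k)]
variable {k : ℕ}

/-- The matrix coefficients of a product of fields. -/
def coeffs (v' : GradedDual V) (v : Total V) (c : Fin k → Modes V) (n : Fin k → ℤ) : ℂ :=
  pair v' (incl (prodL c (List.finRange k) n v))

lemma finRange_split (i : Fin k) : ∃ l₁ l₂ : List (Fin k), List.finRange k = l₁ ++ i :: l₂ ∧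
    (∀ j ∈ l₁, j < i) ∧ (∀ j ∈ l₂, i < j) := by
  obtain ⟨l₁, l₂, h⟩ := List.append_of_mem (List.mem_finRange i)
  have hs : (List.finRange k).Pairwise (· < ·) := List.pairwise_lt_finRange k
  rw [h, List.pairwise_append, List.pairwise_cons] at hs
  exact ⟨l₁, l₂, h, fun j hj => hs.2.2 j hj i (by simp), fun j hj => hs.2.1.1 j hj⟩

lemma coeffs_vanishes {c : Fin k → Modes V} (hc : ∀ i, IsTrunc (c i)) (v' : GradedDual V)
    (v : Total V) {i j : Fin k} (hij : i < j) : Vanishes i j (coeffs v' v c) := by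
  obtain ⟨l₁, l₂, h, h1, h2⟩ := finRange_split j
  intro n
  obtain ⟨r, hr⟩ := prodL_vanishes hc hij.ne v (l₁ := l₁) (l₂ := l₂)
    (fun hi => (h2 i hi).not_gt hij) (fun hj => (h2 j hj).false) n
  refine ⟨r, fun t ht => ?_⟩
  have := hr t ht
  beta_reduce at this
  rw [coeffs, h, this, incl_zero, map_zero]

/-- The Vandermonde product contains all differences between `i` and the later variables, so a
common power of it moves each factor in turn to the right. All indices become bounded above, while
the grading bounds their sum below. -/
lemma coeffs_isRational {c : Fin k → Modes V} (hc : ∀ i, IsTrunc (c i)) {d : Fin k → ℤ}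
    (hd : ∀ i, IsHomog (d i) (c i)) {s : Fin k → Fin k → ℂ}
    (hs : ∀ i j, IsLocal (s i j) (c i) (c j)) (v' : GradedDual V) (v : Total V) :
    IsRational (vdm k) (coeffs v' v c) := by
  choose N hN using hs
  set N₀ := ∑ i, ∑ j, N i j with hN₀
  have hN' : ∀ i j v, mulDiff^[N₀] (fun m n => c i m (c j n v)) =
      mulDiff^[N₀] (fun m n => s i j • c j n (c i m v)) := by
    intro i j v
    refine mulDiff_iterate_le ?_ (hN i j v)
    exact (Finset.single_le_sum (f := fun j => N i j) (fun _ _ => Nat.zero_le _)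
      (Finset.mem_univ j)).trans (Finset.single_le_sum (f := fun i => ∑ j, N i j)
        (fun _ _ => Nat.zero_le _) (Finset.mem_univ i))
  refine ⟨N₀, finite_support_of_bdd (fun i => ?_) ?_⟩
  · obtain ⟨l₁, l₂, h, h1, h2⟩ := finRange_split i
    have hl : (l₁ ++ i :: l₂).Nodup := h ▸ List.nodup_finRange k
    have hdvd : (l₂.map fun j => MvPolynomial.X i - MvPolynomial.X j).prod ∣ vdm k := by
      have h3 : l₂.Nodup := (List.nodup_cons.1 (List.nodup_append.1 hl).2.1).2
      rw [← List.prod_toFinset _ h3, vdm]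
      refine (Finset.prod_dvd_prod_of_subset _ (Finset.Ioi i) _ fun j hj => ?_).trans
        (Finset.dvd_prod_of_mem (fun i => ∏ j ∈ Finset.Ioi i,
          (MvPolynomial.X i - MvPolynomial.X j : MvPolynomial (Fin k) ℂ)) (Finset.mem_univ i))
      exact Finset.mem_Ioi.2 (h2 j (List.mem_toFinset.1 hj))
    obtain ⟨M, hM⟩ := prodL_bddAt hc hN' v hl hdvd
    refine ⟨M, fun n hn => ?_⟩
    have h4 := map_act (pair v' ∘ₗ inclL) (vdm k ^ N₀)
      (fun n => prodL c (List.finRange k) n v) n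
    have h5 := hM n hn
    rw [← h] at h5
    rw [h5, map_zero] at h4
    exact h4.symm
  · exact BddTotal.act (prodL_bddTotal hd (List.nodup_finRange k) (List.mem_finRange) v v') _

end FinProducts

/-! ### Binomial series and convergent power series -/

section PowerSeriesExpansion

lemma hasSum_one_add_zpow (m : ℤ) {x : ℂ} (hx : ‖x‖ < 1) :
    HasSum (fun k : ℕ => Ring.choose (m : ℂ) k * x ^ k) ((1 + x) ^ m) := by
  have h := (Complex.one_add_cpow_hasFPowerSeriesOnBall_zero (a := (m : ℂ))).hasSum (y := x)
    (by
      rw [Metric.mem_eball, edist_zero_right, ← ofReal_norm]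
      exact ENNReal.ofReal_lt_one.2 hx)
  rw [zero_add, Complex.cpow_intCast] at h
  refine h.of_eq fun k => ?_
  rw [binomialSeries, FormalMultilinearSeries.ofScalars_apply_eq]
  simp

lemma hasSum_add_zpow (m : ℤ) {z ξ : ℂ} (h : ‖ξ‖ < ‖z‖) :
    HasSum (fun k : ℕ => Ring.choose (m : ℂ) k * z ^ (m - k) * ξ ^ k) ((z + ξ) ^ m) := by
  have hz : z ≠ 0 := by
    rintro rfl
    simp at h
    exact absurd h (norm_nonneg ξ).not_gt
  have h1 := (hasSum_one_add_zpow m (x := ξ / z)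
    (by rwa [norm_div, div_lt_one (norm_pos_iff.2 hz)])).mul_left (z ^ m)
  rw [← mul_zpow, mul_add, mul_one, mul_div_cancel₀ _ hz] at h1
  refine h1.of_eq fun k => ?_
  rw [zpow_sub₀ hz, zpow_natCast, div_pow]
  field_simp

/-- The power series converges to the function near `0`. -/
def ConvergesTo (φ : PowerSeries ℂ) (f : ℂ → ℂ) : Prop :=
  ∀ᶠ ξ in 𝓝 (0 : ℂ), HasSum (fun k => PowerSeries.coeff k φ * ξ ^ k) (f ξ)

lemma ConvergesTo.hasFPowerSeriesAt {φ : PowerSeries ℂ} {f : ℂ → ℂ} (h : ConvergesTo φ f) :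
    HasFPowerSeriesAt f (FormalMultilinearSeries.ofScalars ℂ fun k => PowerSeries.coeff k φ) 0 := by
  rw [hasFPowerSeriesAt_iff]
  filter_upwards [h] with ξ hξ
  rw [zero_add]
  exact hξ.of_eq fun k => by rw [FormalMultilinearSeries.coeff_ofScalars, smul_eq_mul, mul_comm]

lemma ConvergesTo.unique {φ ψ : PowerSeries ℂ} {f : ℂ → ℂ} (h : ConvergesTo φ f)
    (h' : ConvergesTo ψ f) : φ = ψ := by
  have := h.hasFPowerSeriesAt.eq_formalMultilinearSeries h'.hasFPowerSeriesAt
  ext k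
  have := congrArg (fun p => FormalMultilinearSeries.coeff p k) this
  simpa using this

lemma ConvergesTo.mul {φ ψ : PowerSeries ℂ} {f g : ℂ → ℂ} (h : ConvergesTo φ f)
    (h' : ConvergesTo ψ g) : ConvergesTo (φ * ψ) fun ξ => f ξ * g ξ := by
  filter_upwards [h, h'] with ξ hf hg
  have h1 := hasSum_sum_range_mul_of_summable_norm hf.summable.norm hg.summable.norm
  rw [hf.tsum_eq, hg.tsum_eq] at h1
  refine h1.of_eq fun k => ?_
  rw [PowerSeries.coeff_mul, Finset.Nat.sum_antidiagonal_eq_sum_range_succ_mk, Finset.sum_mul]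
  refine Finset.sum_congr rfl fun j hj => ?_
  have : j + (k - j) = k := by have := Finset.mem_range.1 hj; omega
  conv_lhs => rw [← this, pow_add]
  simp only [add_tsub_cancel_left]
  ring

lemma exists_convergesTo {f : ℂ → ℂ} (hf : AnalyticAt ℂ f 0) : ∃ φ, ConvergesTo φ f := by
  obtain ⟨p, hp⟩ := hf
  refine ⟨PowerSeries.mk p.coeff, ?_⟩
  rw [hasFPowerSeriesAt_iff] at hp
  filter_upwards [hp] with ξ hξ
  rw [zero_add] at hξ
  exact hξ.of_eq fun k => by rw [PowerSeries.coeff_mk, smul_eq_mul, mul_comm]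

lemma convergesTo_polynomial (p : Polynomial ℂ) :
    ConvergesTo (p : PowerSeries ℂ) fun ξ => p.eval ξ := by
  refine Eventually.of_forall fun ξ => ?_
  beta_reduce
  rw [Polynomial.eval_eq_sum_range]
  simp only [Polynomial.coeff_coe]
  refine hasSum_sum_of_ne_finset_zero fun k hk => ?_
  rw [Polynomial.coeff_eq_zero_of_natDegree_lt (by simpa using hk), zero_mul]

/-- Solving a linear equation whose coefficient does not vanish at `0`. -/
lemma ConvergesTo.of_mul {p : Polynomial ℂ} (hp : p.eval 0 ≠ 0) {φ : PowerSeries ℂ} {f : ℂ → ℂ}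
    (h : ConvergesTo ((p : PowerSeries ℂ) * φ) f) : ConvergesTo φ fun ξ => f ξ / p.eval ξ := by
  obtain ⟨ψ, hψ⟩ := exists_convergesTo (f := fun ξ => (p.eval ξ)⁻¹)
    ((p.differentiable.analyticAt 0).fun_inv hp)
  have h1 : ψ * (p : PowerSeries ℂ) = 1 := by
    refine (hψ.mul (convergesTo_polynomial p)).unique (f := fun ξ => (p.eval ξ)⁻¹ * p.eval ξ) ?_
    have h2 := convergesTo_polynomial 1
    have h3 : ∀ᶠ ξ in 𝓝 (0 : ℂ), p.eval ξ ≠ 0 := p.continuous.continuousAt.eventually_ne hp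
    filter_upwards [h2, h3] with ξ hξ hne
    rw [inv_mul_cancel₀ hne]
    simpa using hξ
  have h4 := hψ.mul h
  rw [← mul_assoc, h1, one_mul] at h4
  filter_upwards [h4] with ξ hξ
  rwa [div_eq_mul_inv, mul_comm]

end PowerSeriesExpansion

lemma resCoeff_shift_right {X : Type*} [AddCommGroup X] [Module ℂ X] (A B : ℤ → ℤ → X) (m n : ℤ) :
    resCoeff m n (fun p q => A p (q + 1)) (fun p q => B p (q + 1)) = resCoeff m (n + 1) A B := by
  unfold resCoeff resTerm
  refine finsum_congr fun j => ?_
  beta_reduce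
  rw [show n + (j : ℤ) + 1 = n + 1 + j by ring, show m + n - (j : ℤ) + 1 = m + (n + 1) - j by ring]

lemma resCoeff_smul_left {X : Type*} [AddCommGroup X] [Module ℂ X] {A B : ℤ → ℤ → X}
    (h : Truncated A B) (c : ℂ) (m n : ℤ) :
    resCoeff m n (fun p q => c • A p q) (fun p q => c • B p q) = c • resCoeff m n A B :=
  (map_resCoeff (LinearMap.lsmul ℂ X c) h m n).symm

/-! ### Taylor expansion when the last two variables collide -/

section Merge

variable {r : ℕ}

/-- Appending two coordinates `p`, `q` in place of the last one. -/
def split {α : Type*} (n : Fin (r + 1) → α) (p q : α) : Fin (r + 2) → α :=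
  Fin.snoc (α := fun _ => α) (Fin.snoc (α := fun _ => α) (Fin.init n) p) q

section

variable {α : Type*} (n : Fin (r + 1) → α) (p q : α)

@[simp] lemma split_last : split n p q (Fin.last (r + 1)) = q := by simp [split]

@[simp] lemma split_penult : split n p q (Fin.last r).castSucc = p := by simp [split]

@[simp] lemma split_castSucc (i : Fin r) : split n p q i.castSucc.castSucc = n i.castSucc := by
  simp [split, Fin.init]

lemma fin_cases_two {P : Fin (r + 2) → Prop} (h1 : ∀ i : Fin r, P i.castSucc.castSucc)
    (h2 : P (Fin.last r).castSucc) (h3 : P (Fin.last (r + 1))) (i : Fin (r + 2)) : P i := by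
  induction i using Fin.lastCases with
  | last => exact h3
  | cast i =>
    induction i using Fin.lastCases with
    | last => exact h2
    | cast i => exact h1 i

lemma split_ext {f g : Fin (r + 2) → α} (h1 : ∀ i : Fin r, f i.castSucc.castSucc = g i.castSucc.castSucc)
    (h2 : f (Fin.last r).castSucc = g (Fin.last r).castSucc)
    (h3 : f (Fin.last (r + 1)) = g (Fin.last (r + 1))) : f = g :=
  funext fun i => fin_cases_two (P := fun i => f i = g i) h1 h2 h3 i

end

lemma castSucc_castSucc_ne_penult (i : Fin r) : i.castSucc.castSucc ≠ (Fin.last r).castSucc :=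
  fun h => (Fin.castSucc_lt_last i).ne (Fin.castSucc_injective _ h)

lemma split_add_castSucc (n : Fin (r + 1) → ℤ) (p q : ℤ) (i : Fin r) :
    split n p q + Pi.single i.castSucc.castSucc 1 =
      split (n + Pi.single i.castSucc 1 : Fin (r + 1) → ℤ) p q := by
  refine split_ext (fun j => ?_) ?_ ?_
  · simp [Pi.single_apply]
  · simp [Pi.single_apply, (castSucc_castSucc_ne_penult i).symm]
  · simp [Pi.single_apply, (Fin.castSucc_lt_last i.castSucc).ne']

lemma split_add_penult (n : Fin (r + 1) → ℤ) (p q : ℤ) :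
    split n p q + Pi.single (Fin.last r).castSucc 1 = split n (p + 1) q := by
  refine split_ext (fun j => ?_) ?_ ?_
  · simp [Pi.single_apply, castSucc_castSucc_ne_penult]
  · simp
  · simp [Pi.single_apply, (Fin.castSucc_lt_last (Fin.last r)).ne']

lemma split_add_last (n : Fin (r + 1) → ℤ) (p q : ℤ) :
    split n p q + Pi.single (Fin.last (r + 1)) 1 = split n p (q + 1) := by
  refine split_ext (fun j => ?_) ?_ ?_
  · simp [Pi.single_apply, (Fin.castSucc_lt_last j.castSucc).ne]
  · simp [Pi.single_apply, (Fin.castSucc_lt_last (Fin.last r)).ne]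
  · simp

lemma split_congr {α : Type*} {n n' : Fin (r + 1) → α} (h : ∀ i : Fin r, n i.castSucc = n' i.castSucc)
    (p q : α) : split n p q = split n' p q :=
  split_ext (fun i => by simp [h]) (by simp) (by simp)

lemma mon_split {y : Fin (r + 1) → ℂ} {a b : ℂ} (n : Fin (r + 1) → ℤ) (p q : ℤ) :
    mon (split y a b) (split n p q) =
      (∏ i : Fin r, y i.castSucc ^ (-n i.castSucc - 1)) * a ^ (-p - 1) * b ^ (-q - 1) := by
  unfold mon
  rw [Fin.prod_univ_castSucc, Fin.prod_univ_castSucc]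
  simp

/-- The `k`-th Taylor coefficient in `ξ` of the series `h(x, z + ξ, z)`. -/
def taylor (k : ℕ) (h : (Fin (r + 2) → ℤ) → ℂ) (n : Fin (r + 1) → ℤ) : ℂ :=
  -- The two expansions of `(x - z)^(-k-1)` differ by the `k`-th divided derivative of the delta
  -- function, so this residue is the `k`-th divided derivative of `h` in `x` at `x = z`.
  resCoeff (-k - 1) (n (Fin.last r)) (fun p q => h (split n p q)) (fun p q => h (split n p q))

/-- The series is truncated in the last two variables. -/
def TruncatedLast (h : (Fin (r + 2) → ℤ) → ℂ) : Prop :=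
  ∀ n : Fin (r + 1) → ℤ, Truncated (fun p q => h (split n p q)) (fun p q => h (split n p q))

variable {f h : (Fin (r + 2) → ℤ) → ℂ}

lemma TruncatedLast.add (hf : TruncatedLast f) (hh : TruncatedLast h) : TruncatedLast (f + h) := by
  intro n s
  obtain ⟨J, hJ⟩ := hf n s
  obtain ⟨J', hJ'⟩ := hh n s
  refine ⟨max J J', fun j hj => ?_⟩
  have h1 := hJ j (le_trans (le_max_left _ _) hj)
  have h2 := hJ' j (le_trans (le_max_right _ _) hj)
  simp [h1, h2]

lemma TruncatedLast.smul (hh : TruncatedLast h) (c : ℂ) : TruncatedLast (c • h) :=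
  fun n => (hh n).map (LinearMap.lsmul ℂ ℂ c) (LinearMap.lsmul ℂ ℂ c)

lemma TruncatedLast.shift (hh : TruncatedLast h) (i : Fin (r + 2)) :
    TruncatedLast fun n => h (n + Pi.single i 1) := by
  induction i using fin_cases_two with
  | h1 i => intro n; simp only [split_add_castSucc]; exact hh _
  | h2 =>
    intro n s
    obtain ⟨J, hJ⟩ := hh n (s + 1)
    refine ⟨J, fun j hj => ?_⟩
    have h1 := (hJ j hj).1
    have h2 := (hJ (j + 1) (by omega)).2
    simp only [split_add_penult]
    rw [show s + 1 - (j + 1) = s - j by ring] at h2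
    rw [show s + 1 - j = s - j + 1 by ring] at h1
    exact ⟨h1, h2⟩
  | h3 =>
    intro n s
    obtain ⟨J, hJ⟩ := hh n (s + 1)
    refine ⟨J, fun j hj => ?_⟩
    have h1 := (hJ (j + 1) (by omega)).1
    have h2 := (hJ j hj).2
    simp only [split_add_last]
    rw [show s + 1 - (j + 1) = s - j by ring] at h1
    rw [show s + 1 - j = s - j + 1 by ring] at h2
    exact ⟨h1, h2⟩

lemma taylor_add (hf : TruncatedLast f) (hh : TruncatedLast h) (k : ℕ) :
    taylor k (f + h) = taylor k f + taylor k h := by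
  funext n
  exact resCoeff_add (hf n) (hh n) _ _

lemma taylor_smul (hh : TruncatedLast h) (c : ℂ) (k : ℕ) : taylor k (c • h) = c • taylor k h := by
  funext n
  exact resCoeff_smul_left (hh n) c _ _

lemma taylor_shift_castSucc (k : ℕ) (i : Fin r) :
    taylor k (fun n => h (n + Pi.single i.castSucc.castSucc 1)) =
      fun n => taylor k h (n + Pi.single i.castSucc 1) := by
  funext n
  unfold taylor
  simp only [split_add_castSucc]
  simp [Pi.single_apply, (Fin.castSucc_lt_last i).ne']

lemma taylor_shift_last (k : ℕ) :
    taylor k (fun n => h (n + Pi.single (Fin.last (r + 1)) 1)) =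
      fun n => taylor k h (n + Pi.single (Fin.last r) 1) := by
  funext n
  unfold taylor
  simp only [split_add_last]
  rw [resCoeff_shift_right (fun p q => h (split n p q)) (fun p q => h (split n p q))]
  have : ∀ p q, split (n + Pi.single (Fin.last r) 1 : Fin (r + 1) → ℤ) p q = split n p q :=
    fun p q => split_congr (fun i => by simp [Pi.single_apply, (Fin.castSucc_lt_last i).ne]) p q
  simp only [this]
  simp

/-- The constant term of `(z + ξ) h` is that of `z h`: the product `(x - z) h` vanishes on the
diagonal. -/
lemma taylor_zero_shift_penult (hh : TruncatedLast h) :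
    taylor 0 (fun n => h (n + Pi.single (Fin.last r).castSucc 1)) =
      taylor 0 (fun n => h (n + Pi.single (Fin.last (r + 1)) 1)) := by
  funext n
  have h1 := resCoeff_mulDiff (hh n) (-(0 : ℕ) - 1) (n (Fin.last r))
  have h2 := resCoeff_self_nat 0 (n (Fin.last r)) fun p q => h (split n p q)
  rw [show (-((0 : ℕ) : ℤ) - 1 + 1) = ((0 : ℕ) : ℤ) by simp, h2] at h1
  have h3 := resCoeff_sub ((hh.shift (Fin.last r).castSucc) n) ((hh.shift (Fin.last (r + 1))) n)
    (-(0 : ℕ) - 1) (n (Fin.last r))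
  refine sub_eq_zero.1 (h3.symm.trans (Eq.trans ?_ h1))
  congr 1 <;> funext p q <;> simp [mulDiff, split_add_penult, split_add_last]

/-- Multiplying by `x = z + ξ` adds the previous coefficient, because `x - z` turns the exponent
`-(k+1) - 1` into `-k - 1`. -/
lemma taylor_succ_shift_penult (hh : TruncatedLast h) (k : ℕ) :
    taylor (k + 1) (fun n => h (n + Pi.single (Fin.last r).castSucc 1)) =
      taylor (k + 1) (fun n => h (n + Pi.single (Fin.last (r + 1)) 1)) + taylor k h := by
  funext n
  have h1 := resCoeff_mulDiff (hh n) (-(k + 1 : ℕ) - 1) (n (Fin.last r))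
  rw [show (-((k + 1 : ℕ) : ℤ) - 1 + 1) = -(k : ℤ) - 1 by push_cast; ring] at h1
  have h3 := resCoeff_sub ((hh.shift (Fin.last r).castSucc) n) ((hh.shift (Fin.last (r + 1))) n)
    (-(k + 1 : ℕ) - 1) (n (Fin.last r))
  refine sub_eq_iff_eq_add'.1 (h3.symm.trans (Eq.trans ?_ h1))
  congr 1 <;> funext p q <;> simp [mulDiff, split_add_penult, split_add_last]

/-- The substitution of `(x, z + ξ, z)` for the variables, as a polynomial in `ξ`. -/
def substPoly (y : Fin (r + 1) → ℂ) : MvPolynomial (Fin (r + 2)) ℂ →ₐ[ℂ] Polynomial ℂ :=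
  MvPolynomial.aeval (split (fun i => Polynomial.C (y i))
    (Polynomial.C (y (Fin.last r)) + Polynomial.X) (Polynomial.C (y (Fin.last r))))

lemma eval_substPoly (y : Fin (r + 1) → ℂ) (ξ : ℂ) (Q : MvPolynomial (Fin (r + 2)) ℂ) :
    (substPoly y Q).eval ξ =
      MvPolynomial.eval (split y (y (Fin.last r) + ξ) (y (Fin.last r))) Q := by
  induction Q using MvPolynomial.induction_on with
  | C c => simp [substPoly]
  | add p q hp hq => rw [map_add, Polynomial.eval_add, hp, hq, map_add]
  | mul_X p i hp =>
    rw [map_mul, Polynomial.eval_mul, hp, map_mul, MvPolynomial.eval_X]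
    congr 1
    rw [substPoly, MvPolynomial.aeval_X]
    induction i using fin_cases_two with
    | h1 i => simp
    | h2 => simp
    | h3 => simp

/-- The series that have rational Taylor coefficients. -/
def TaylorRational (h : (Fin (r + 2) → ℤ) → ℂ) : Prop :=
  TruncatedLast h ∧ ∀ k, IsRational (vdm (r + 1)) (taylor k h)

/-- The Taylor expansion at a point. -/
def taylorSeries (y : Fin (r + 1) → ℂ) (h : (Fin (r + 2) → ℤ) → ℂ) : PowerSeries ℂ :=
  PowerSeries.mk fun k => ratEval (vdm (r + 1)) (taylor k h) y

/-- Multiplication by a variable corresponds, on Taylor series, to multiplication by its value under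
`(x, z + ξ, z)`. -/
lemma taylorRational_shift (hh : TaylorRational h) {y : Fin (r + 1) → ℂ} (hy : Good y)
    (i : Fin (r + 2)) : TaylorRational (fun n => h (n + Pi.single i 1)) ∧
      taylorSeries y (fun n => h (n + Pi.single i 1)) =
        (substPoly y (MvPolynomial.X i) : PowerSeries ℂ) * taylorSeries y h := by
  have hlast : ∀ k, taylor k (fun n => h (n + Pi.single (Fin.last (r + 1)) 1)) =
      act (MvPolynomial.X (Fin.last r)) (taylor k h) := by
    intro k
    rw [taylor_shift_last]
    exact (funext (act_X _ _)).symm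
  have e1 := hy.eval_vdm_ne
  induction i using fin_cases_two with
  | h1 i =>
    have h1 : ∀ k, taylor k (fun n => h (n + Pi.single i.castSucc.castSucc 1)) =
        act (MvPolynomial.X i.castSucc) (taylor k h) := by
      intro k
      rw [taylor_shift_castSucc]
      exact (funext (act_X _ _)).symm
    refine ⟨⟨hh.1.shift _, fun k => by rw [h1]; exact (hh.2 k).act _⟩, ?_⟩
    ext k
    rw [substPoly, MvPolynomial.aeval_X, split_castSucc, Polynomial.coe_C, PowerSeries.coeff_C_mul,
      taylorSeries, taylorSeries, PowerSeries.coeff_mk, PowerSeries.coeff_mk, h1,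
      ratEval_act (hh.2 k) _ hy.1 e1, MvPolynomial.eval_X]
  | h3 =>
    refine ⟨⟨hh.1.shift _, fun k => by rw [hlast]; exact (hh.2 k).act _⟩, ?_⟩
    ext k
    rw [substPoly, MvPolynomial.aeval_X, split_last, Polynomial.coe_C, PowerSeries.coeff_C_mul,
      taylorSeries, taylorSeries, PowerSeries.coeff_mk, PowerSeries.coeff_mk, hlast,
      ratEval_act (hh.2 k) _ hy.1 e1, MvPolynomial.eval_X]
  | h2 =>
    refine ⟨⟨hh.1.shift _, fun k => ?_⟩, ?_⟩
    · cases k with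
      | zero => rw [taylor_zero_shift_penult hh.1, hlast]; exact (hh.2 0).act _
      | succ k => rw [taylor_succ_shift_penult hh.1, hlast]; exact ((hh.2 _).act _).add (hh.2 k)
    · ext k
      rw [substPoly, MvPolynomial.aeval_X, split_penult, Polynomial.coe_add, Polynomial.coe_C,
        Polynomial.coe_X, add_mul, map_add, PowerSeries.coeff_C_mul,
        taylorSeries, taylorSeries, PowerSeries.coeff_mk, PowerSeries.coeff_mk]
      cases k with
      | zero =>
        rw [taylor_zero_shift_penult hh.1, hlast, ratEval_act (hh.2 _) _ hy.1 e1,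
          MvPolynomial.eval_X]
        simp
      | succ k =>
        rw [taylor_succ_shift_penult hh.1, hlast, ratEval_add ((hh.2 _).act _) (hh.2 k) hy.1 e1,
          ratEval_act (hh.2 _) _ hy.1 e1, MvPolynomial.eval_X, PowerSeries.coeff_succ_X_mul,
          PowerSeries.coeff_mk]

/-- Taylor expansion is linear over polynomials through `substPoly`. Thus the expansion of a series
can be recovered from that of a polynomial multiple which is a finite Laurent sum. -/
lemma taylorRational_act (hh : TaylorRational h) {y : Fin (r + 1) → ℂ} (hy : Good y)
    (Q : MvPolynomial (Fin (r + 2)) ℂ) : TaylorRational (act Q h) ∧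
      taylorSeries y (act Q h) = (substPoly y Q : PowerSeries ℂ) * taylorSeries y h := by
  have e1 := hy.eval_vdm_ne
  induction Q using MvPolynomial.induction_on generalizing h with
  | C c =>
    rw [act_C]
    refine ⟨⟨hh.1.smul c, fun k => by rw [taylor_smul hh.1]; exact (hh.2 k).smul c⟩, ?_⟩
    ext k
    rw [← MvPolynomial.algebraMap_eq, AlgHom.commutes, Polynomial.algebraMap_eq, Polynomial.coe_C,
      PowerSeries.coeff_C_mul, taylorSeries, taylorSeries, PowerSeries.coeff_mk,
      PowerSeries.coeff_mk, taylor_smul hh.1, ratEval_smul (hh.2 k) _ hy.1 e1]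
  | add p q hp hq =>
    obtain ⟨h1, h2⟩ := hp hh
    obtain ⟨h3, h4⟩ := hq hh
    rw [map_add, map_add, LinearMap.add_apply, Polynomial.coe_add, add_mul, ← h2, ← h4]
    refine ⟨⟨h1.1.add h3.1, fun k => by rw [taylor_add h1.1 h3.1]; exact (h1.2 k).add (h3.2 k)⟩, ?_⟩
    ext k
    rw [map_add, taylorSeries, taylorSeries, taylorSeries, PowerSeries.coeff_mk,
      PowerSeries.coeff_mk, PowerSeries.coeff_mk, taylor_add h1.1 h3.1,
      ratEval_add (h1.2 k) (h3.2 k) hy.1 e1]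
  | mul_X p i hp =>
    obtain ⟨h1, h2⟩ := taylorRational_shift hh hy i
    obtain ⟨h3, h4⟩ := hp h1
    rw [act_mul, Module.End.mul_apply,
      show act (MvPolynomial.X i) h = fun n => h (n + Pi.single i 1) from funext (act_X i h)]
    refine ⟨h3, ?_⟩
    rw [h4, h2, map_mul, Polynomial.coe_mul, mul_assoc]

end Merge

/-! ### Taylor expansion of finite Laurent sums -/

section FiniteTaylor

lemma finite_support_induction {α : Type*} [DecidableEq α] {P : (α → ℂ) → Prop} (h0 : P 0)
    (hadd : ∀ f g, (Function.support f).Finite → (Function.support g).Finite → P f → P g → P (f + g))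
    (hs : ∀ (m : α) (c : ℂ), P (Pi.single m c)) {g : α → ℂ}
    (hg : (Function.support g).Finite) : P g := by
  have key : ∀ g : α →₀ ℂ, P g := by
    intro g
    induction g using Finsupp.induction_linear with
    | zero => exact h0
    | add f g hf hg =>
      rw [Finsupp.coe_add]
      exact hadd _ _ f.hasFiniteSupport g.hasFiniteSupport hf hg
    | single m c => rw [Finsupp.single_eq_pi_single]; exact hs m c
  exact key (Finsupp.ofSupportFinite g hg)

variable {r : ℕ}

/-- Replacing the last two coordinates by the exponent of their `k`-th Taylor coefficient. -/
def mergeLast (k : ℕ) (m : Fin (r + 2) → ℤ) : Fin (r + 1) → ℤ :=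
  Fin.snoc (α := fun _ => ℤ) (fun i => m i.castSucc.castSucc)
    (m (Fin.last r).castSucc + m (Fin.last (r + 1)) + k + 1)

lemma split_eq_iff (n : Fin (r + 1) → ℤ) (p q : ℤ) (m : Fin (r + 2) → ℤ) :
    split n p q = m ↔ (∀ i : Fin r, n i.castSucc = m i.castSucc.castSucc) ∧
      p = m (Fin.last r).castSucc ∧ q = m (Fin.last (r + 1)) := by
  constructor
  · rintro rfl
    simp
  · rintro ⟨h1, h2, h3⟩
    exact split_ext (by simpa using h1) (by simpa using h2) (by simpa using h3)

lemma truncatedLast_single (m : Fin (r + 2) → ℤ) (c : ℂ) : TruncatedLast (Pi.single m c) := by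
  intro n s
  refine ⟨max (m (Fin.last r).castSucc) (m (Fin.last (r + 1))) + 1, fun j hj => ⟨?_, ?_⟩⟩ <;>
  · refine Pi.single_eq_of_ne (fun h => ?_) _
    have := (split_eq_iff _ _ _ _).1 h
    omega

/-- On a monomial only one `p` contributes, and its binomial is the coefficient of `ξ ^ k` in `(z +
ξ) ^ (-p-1)`. -/
lemma taylor_single (k : ℕ) (m : Fin (r + 2) → ℤ) (c : ℂ) :
    taylor k (Pi.single m c) = Pi.single (mergeLast k m)
      (Ring.choose (-(m (Fin.last r).castSucc : ℂ) - 1) k * c) := by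
  funext n
  refine (hasSum_resCoeff_neg (truncatedLast_single m c n) k (n (Fin.last r))).unique ?_
  by_cases hn : n = mergeLast k m
  · subst hn
    rw [Pi.single_eq_same]
    have h1 := hasSum_single (f := fun p : ℤ => Ring.choose (-p - 1 : ℂ) k *
      (Pi.single m c : (Fin (r + 2) → ℤ) → ℂ) (split (mergeLast k m) p
        (mergeLast k m (Fin.last r) - k - 1 - p))) (m (Fin.last r).castSucc) (fun p hp => by
      rw [Pi.single_eq_of_ne, mul_zero]
      exact fun h => hp ((split_eq_iff _ _ _ _).1 h).2.1)
    have h2 : split (mergeLast k m) (m (Fin.last r).castSucc)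
        (mergeLast k m (Fin.last r) - k - 1 - m (Fin.last r).castSucc) = m := by
      rw [split_eq_iff]
      refine ⟨fun i => by simp [mergeLast], rfl, ?_⟩
      simp only [mergeLast, Fin.snoc_last]
      ring
    rw [h2, Pi.single_eq_same] at h1
    exact h1
  · rw [Pi.single_eq_of_ne hn]
    refine hasSum_zero.of_eq fun p => ?_
    rw [Pi.single_eq_of_ne, mul_zero]
    intro h
    obtain ⟨h1, h2, h3⟩ := (split_eq_iff _ _ _ _).1 h
    refine hn (funext fun i => ?_)
    induction i using Fin.lastCases with
    | last => simp only [mergeLast, Fin.snoc_last]; omega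
    | cast i => simp only [mergeLast, Fin.snoc_castSucc]; exact h1 i

lemma taylor_zero (k : ℕ) : taylor k (0 : (Fin (r + 2) → ℤ) → ℂ) = 0 := by
  have := taylor_single k (0 : Fin (r + 2) → ℤ) 0
  simpa using this

/-- Taylor expansion of a finite Laurent sum. -/
lemma taylor_finite {g : (Fin (r + 2) → ℤ) → ℂ} (hg : (Function.support g).Finite) :
    TruncatedLast g ∧ (∀ k, (Function.support (taylor k g)).Finite) ∧
    ∀ y : Fin (r + 1) → ℂ, (∀ i, y i ≠ 0) → ∀ ξ : ℂ, ‖ξ‖ < ‖y (Fin.last r)‖ →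
      HasSum (fun k => laurentEval (taylor k g) y * ξ ^ k)
        (laurentEval g (split y (y (Fin.last r) + ξ) (y (Fin.last r)))) := by
  refine finite_support_induction (P := fun g => TruncatedLast g ∧
    (∀ k, (Function.support (taylor k g)).Finite) ∧
    ∀ y : Fin (r + 1) → ℂ, (∀ i, y i ≠ 0) → ∀ ξ : ℂ, ‖ξ‖ < ‖y (Fin.last r)‖ →
      HasSum (fun k => laurentEval (taylor k g) y * ξ ^ k)
        (laurentEval g (split y (y (Fin.last r) + ξ) (y (Fin.last r))))) ?_ ?_ ?_ hg
  · refine ⟨fun n s => ⟨0, fun j _ => ⟨rfl, rfl⟩⟩, fun k => by simp [taylor_zero],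
      fun y _ ξ _ => ?_⟩
    simp [taylor_zero, laurentEval_zero, hasSum_zero]
  · rintro f g hf hg ⟨f1, f2, f3⟩ ⟨g1, g2, g3⟩
    refine ⟨f1.add g1, fun k => by rw [taylor_add f1 g1]; exact finite_support_add (f2 k) (g2 k),
      fun y hy ξ hξ => ?_⟩
    rw [laurentEval_add hf hg]
    refine ((f3 y hy ξ hξ).add (g3 y hy ξ hξ)).of_eq fun k => ?_
    rw [taylor_add f1 g1, laurentEval_add (f2 k) (g2 k), add_mul]
  · intro m c
    refine ⟨truncatedLast_single m c, fun k => ?_, fun y hy ξ hξ => ?_⟩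
    · rw [taylor_single]
      exact (Set.finite_singleton (mergeLast k m)).subset Pi.support_single_subset
    · have h1 := (hasSum_add_zpow (-m (Fin.last r).castSucc - 1) hξ).mul_left
        (c * (∏ i : Fin r, y i.castSucc ^ (-m i.castSucc.castSucc - 1)) *
          y (Fin.last r) ^ (-m (Fin.last (r + 1)) - 1))
      have h2 : split (mergeLast 0 m) (m (Fin.last r).castSucc) (m (Fin.last (r + 1))) = m := by
        rw [split_eq_iff]
        exact ⟨fun i => by simp [mergeLast], rfl, rfl⟩
      have h3 : laurentEval (Pi.single m c) (split y (y (Fin.last r) + ξ) (y (Fin.last r))) =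
          c * (∏ i : Fin r, y i.castSucc ^ (-m i.castSucc.castSucc - 1)) *
          y (Fin.last r) ^ (-m (Fin.last (r + 1)) - 1) *
          (y (Fin.last r) + ξ) ^ (-m (Fin.last r).castSucc - 1) := by
        rw [laurentEval_single]
        conv_lhs => rw [← h2, mon_split]
        simp only [mergeLast, Fin.snoc_castSucc]
        ring
      rw [← h3] at h1
      refine h1.of_eq fun k => ?_
      rw [taylor_single, laurentEval_single]
      unfold mon
      rw [Fin.prod_univ_castSucc]
      simp only [mergeLast, Fin.snoc_castSucc, Fin.snoc_last]
      rw [show -(m (Fin.last r).castSucc + m (Fin.last (r + 1)) + k + 1) - 1 =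
        (-m (Fin.last (r + 1)) - 1) + (-m (Fin.last r).castSucc - 1 - k) by ring,
        zpow_add₀ (hy _)]
      push_cast
      ring

end FiniteTaylor

/-! ### Operator product expansion: formal part -/

section OPE

variable {V : ℤ → Type u} [∀ k, AddCommGroup (V k)] [∀ k, Module ℂ (V k)]

/-- Appending a field to a family. -/
abbrev snocM {r : ℕ} (c : Fin r → Modes V) (a : Modes V) : Fin (r + 1) → Modes V :=
  Fin.snoc (α := fun _ => Modes V) c a

lemma coeffs_snoc {r : ℕ} (v' : GradedDual V) (v : Total V) (c : Fin r → Modes V) (a : Modes V)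
    (n : Fin (r + 1) → ℤ) : coeffs v' v (snocM c a) n = pair v' (incl
      (prodL c (List.finRange r) (fun i => n i.castSucc) (a (n (Fin.last r)) v))) := by
  rw [coeffs, List.finRange_succ_last, prodL_append]
  simp [prodL, Function.comp_def]

lemma coeffs_snoc_split {r : ℕ} (v' : GradedDual V) (v : Total V) (c : Fin r → Modes V)
    (a b : Modes V) (n : Fin (r + 1) → ℤ) (p q : ℤ) :
    coeffs v' v (snocM (snocM c a) b) (split n p q) = pair v' (incl
      (prodL c (List.finRange r) (fun i => n i.castSucc) (a p (b q v)))) := by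
  rw [coeffs_snoc, split_last]
  rw [List.finRange_succ_last, prodL_append]
  simp [prodL, Function.comp_def]

/-- Splits off the one difference that vanishes at the collision; the cofactor stays nonzero there
because the remaining points are distinct. -/
lemma vdm_factor (r : ℕ) : ∃ Q : MvPolynomial (Fin (r + 2)) ℂ,
    vdm (r + 2) = Q * (MvPolynomial.X (Fin.last r).castSucc - MvPolynomial.X (Fin.last (r + 1))) ∧
    ∀ y : Fin (r + 1) → ℂ, Function.Injective y →
      MvPolynomial.eval (split y (y (Fin.last r)) (y (Fin.last r))) Q ≠ 0 := by
  have h1 := vdm_pow_eq (r + 2) 1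
  simp only [pow_one] at h1
  set S := (Finset.univ : Finset (Fin (r + 2) × Fin (r + 2))).filter fun p => p.1 < p.2 with hS
  have hmem : ((Fin.last r).castSucc, Fin.last (r + 1)) ∈ S := by
    rw [hS, Finset.mem_filter]
    exact ⟨Finset.mem_univ _, Fin.castSucc_lt_last _⟩
  refine ⟨∏ p ∈ S.erase ((Fin.last r).castSucc, Fin.last (r + 1)),
    (MvPolynomial.X p.1 - MvPolynomial.X p.2), ?_, fun y hy => ?_⟩
  · rw [h1, ← Finset.prod_erase_mul _ _ hmem]
  · rw [map_prod]
    refine Finset.prod_ne_zero_iff.2 fun p hp => ?_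
    obtain ⟨hne, hp⟩ := Finset.mem_erase.1 hp
    have hlt := (Finset.mem_filter.1 hp).2
    obtain ⟨i, j⟩ := p
    simp only at hlt hne
    rw [map_sub, MvPolynomial.eval_X, MvPolynomial.eval_X, sub_ne_zero]
    have hpl : (Fin.last r).castSucc < Fin.last (r + 1) := Fin.castSucc_lt_last _
    induction j using fin_cases_two with
    | h1 j =>
      induction i using fin_cases_two with
      | h1 i =>
        rw [split_castSucc, split_castSucc]
        intro h
        have := hy h
        rw [Fin.castSucc_inj] at this
        exact hlt.ne (by rw [this])
      | h2 => exact absurd hlt (Fin.castSucc_lt_castSucc_iff.2 (Fin.castSucc_lt_last j)).not_gt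
      | h3 => exact absurd hlt (Fin.castSucc_lt_last j.castSucc).not_gt
    | h2 =>
      induction i using fin_cases_two with
      | h1 i =>
        rw [split_castSucc, split_penult]
        exact fun h => (Fin.castSucc_lt_last i).ne (hy h)
      | h2 => exact absurd hlt (lt_irrefl _)
      | h3 => exact absurd hlt hpl.not_gt
    | h3 =>
      induction i using fin_cases_two with
      | h1 i =>
        rw [split_castSucc, split_last]
        exact fun h => (Fin.castSucc_lt_last i).ne (hy h)
      | h2 => exact absurd rfl hne
      | h3 => exact absurd hlt (lt_irrefl _)

lemma vdm_two : vdm 2 = MvPolynomial.X (0 : Fin 2) - MvPolynomial.X 1 := by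
  have h := vdm_pow_eq 2 1
  simp only [pow_one] at h
  rw [h, show (Finset.univ : Finset (Fin 2 × Fin 2)).filter (fun p => p.1 < p.2) = {(0, 1)} by decide,
    Finset.prod_singleton]

variable {r : ℕ} {a b : Modes V} (ha : IsTrunc a) (hb : IsTrunc b) {s : ℂ}
  (v' : GradedDual V) (v : Total V) (c : Fin r → Modes V)

lemma coeffs_nprod (m : ℤ) (n : Fin (r + 1) → ℤ) :
    coeffs v' v (snocM c (nprod s ha hb m)) n = resCoeff m (n (Fin.last r))
      (fun p q => pair v' (incl (prodL c (List.finRange r) (fun i => n i.castSucc) (a p (b q v)))))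
      (fun p q => pair v' (incl (prodL c (List.finRange r) (fun i => n i.castSucc)
        (s • b q (a p v))))) := by
  rw [coeffs_snoc, nprod_apply]
  exact map_resCoeff (pair v' ∘ₗ inclL ∘ₗ prodL c (List.finRange r) (fun i => n i.castSucc))
    (truncated_products ha hb s v) m _

section

variable {N : ℕ} (hN : ∀ v, mulDiff^[N] (fun m n => a m (b n v)) =
  mulDiff^[N] (fun m n => s • b n (a m v)))
include hN

/-- Bounds the order of the pole of the operator product expansion by the order of locality. -/
lemma nprod_eq_zero {m : ℤ} (hm : N ≤ m) : nprod s ha hb m = 0 := by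
  funext n
  refine LinearMap.ext fun v => ?_
  exact resCoeff_eq_zero_of_iterate_eq (truncated_products ha hb s v) (hN v) hm n

lemma act_coeffs_split (n : Fin (r + 1) → ℤ) :
    (fun p q => act ((MvPolynomial.X (Fin.last r).castSucc - MvPolynomial.X (Fin.last (r + 1))) ^ N)
      (coeffs v' v (snocM (snocM c a) b)) (split n p q)) =
    mulDiff^[N] fun p q => pair v' (incl (prodL c (List.finRange r) (fun i => n i.castSucc)
      (a p (b q v)))) := by
  funext p q
  rw [act_sub_pow (Fin.castSucc_lt_last _).ne, split_last, split_penult]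
  refine congrFun (congrFun (congrArg _ ?_) _) _
  funext p' q'
  rw [← coeffs_snoc_split]
  congr 1
  refine split_ext (fun i => ?_) ?_ ?_
  · simp [Function.update_of_ne, (Fin.castSucc_lt_last i.castSucc).ne,
      castSucc_castSucc_ne_penult]
  · simp [Function.update_of_ne, (Fin.castSucc_lt_last (Fin.last r)).ne]
  · simp

lemma mulDiff_coeffs (n : Fin (r + 1) → ℤ) :
    mulDiff^[N] (fun p q => pair v' (incl (prodL c (List.finRange r) (fun i => n i.castSucc)
      (a p (b q v))))) =
    mulDiff^[N] (fun p q => pair v' (incl (prodL c (List.finRange r) (fun i => n i.castSucc)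
        (s • b q (a p v))))) := by
  let Φ := pair v' ∘ₗ inclL ∘ₗ prodL c (List.finRange r) (fun i => n i.castSucc)
  have h1 := mulDiff_iterate_map Φ.toAddMonoidHom N fun p q => a p (b q v)
  have h2 := mulDiff_iterate_map Φ.toAddMonoidHom N fun p q => s • b q (a p v)
  rw [hN v] at h1
  exact h1.trans h2.symm

include ha hb in
-- After multiplication by `(x - z)^N` the two orders of `a` and `b` give the same series; one order
-- truncates it in one direction, the other order in the opposite direction.
lemma truncatedLast_act_coeffs : TruncatedLast
    (act ((MvPolynomial.X (Fin.last r).castSucc - MvPolynomial.X (Fin.last (r + 1))) ^ N)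
      (coeffs v' v (snocM (snocM c a) b))) := by
  intro n
  rw [act_coeffs_split v' v c hN]
  have h := ((truncated_products ha hb s v).map
    (pair v' ∘ₗ inclL ∘ₗ prodL c (List.finRange r) (fun i => n i.castSucc))
    (pair v' ∘ₗ inclL ∘ₗ prodL c (List.finRange r) (fun i => n i.castSucc))).mulDiff_iterate N
  have h2 := mulDiff_coeffs v' v c hN n
  refine Eq.mp (congrArg (Truncated _) ?_) h
  exact h2.symm

/-- The power `(x - z)^N` from locality and the power `(x - z)^(-k-1)` from the Taylor coefficient
combine to the exponent of the product `N - k - 1`. -/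
lemma taylor_act_coeffs (k : ℕ) : taylor k
    (act ((MvPolynomial.X (Fin.last r).castSucc - MvPolynomial.X (Fin.last (r + 1))) ^ N)
      (coeffs v' v (snocM (snocM c a) b))) =
    coeffs v' v (snocM c (nprod s ha hb (N - k - 1))) := by
  funext n
  rw [taylor, act_coeffs_split v' v c hN, coeffs_nprod]
  conv_lhs => arg 4; rw [mulDiff_coeffs v' v c hN n]
  have h := (truncated_products ha hb s v).map
    (pair v' ∘ₗ inclL ∘ₗ prodL c (List.finRange r) (fun i => n i.castSucc))
    (pair v' ∘ₗ inclL ∘ₗ prodL c (List.finRange r) (fun i => n i.castSucc))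
  have h1 := resCoeff_mulDiff_iterate h N (-k - 1) (n (Fin.last r))
  rw [show -(k : ℤ) - 1 + N = N - k - 1 by ring] at h1
  exact h1

/-- Reindexing of the expansion in powers of `ξ`. -/
lemma hasSum_ope_aux {y : Fin (r + 1) → ℂ} {ξ : ℂ} (hξ : ξ ≠ 0) {G : ℂ}
    (h : HasSum (fun k : ℕ => ratEval (vdm (r + 1))
      (coeffs v' v (snocM c (nprod s ha hb (N - k - 1)))) y * ξ ^ k) G) :
    HasSum (fun m : ℤ => ratEval (vdm (r + 1)) (coeffs v' v (snocM c (nprod s ha hb m))) y *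
      ξ ^ (-m - 1)) (G / ξ ^ N) := by
  have hinj : Function.Injective fun k : ℕ => (N : ℤ) - k - 1 := fun i j h => by
    simp only at h; omega
  refine (hinj.hasSum_iff fun m hm => ?_).1 ((h.div_const (ξ ^ N)).of_eq fun k => ?_)
  · have hm' : (N : ℤ) ≤ m := by
      by_contra hlt
      exact hm ⟨((N : ℤ) - m - 1).toNat, by simp only; omega⟩
    have : coeffs v' v (snocM c (nprod s ha hb m)) = 0 := by
      funext n
      rw [nprod_eq_zero ha hb hN hm', coeffs_snoc]
      simp
    rw [this, ratEval_zero, zero_mul]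
  · simp only [Function.comp_apply]
    rw [show -((N : ℤ) - k - 1) - 1 = k - N by ring, zpow_sub₀ hξ, zpow_natCast, zpow_natCast,
      mul_div_assoc]

end

end OPE

/-! ### Operator product expansion: convergence -/

section OPE

variable {V : ℤ → Type u} [∀ k, AddCommGroup (V k)] [∀ k, Module ℂ (V k)]

variable {r : ℕ} {a b : Modes V} (ha : IsTrunc a) (hb : IsTrunc b) {s : ℂ}
  (v' : GradedDual V) (v : Total V) (c : Fin r → Modes V)

lemma IsLocal.exists_le (h : IsLocal s a b) (M : ℕ) : ∃ N, M ≤ N ∧ ∀ v,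
    mulDiff^[N] (fun m n => a m (b n v)) = mulDiff^[N] (fun m n => s • b n (a m v)) := by
  obtain ⟨N, hN⟩ := h
  exact ⟨max M N, le_max_left _ _, fun v => mulDiff_iterate_le (le_max_right _ _) (hN v)⟩

/-- Associativity: the expansion of a correlation function when two points approach each other. -/
lemma hasSum_ope (hab : IsLocal s a b)
    (hf : IsRational (vdm (r + 2)) (coeffs v' v (snocM (snocM c a) b)))
    (hp : ∀ m, IsRational (vdm (r + 1)) (coeffs v' v (snocM c (nprod s ha hb m))))
    {y : Fin (r + 1) → ℂ} (hy : Good y) : ∀ᶠ ξ in 𝓝 (0 : ℂ), ξ ≠ 0 →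
    HasSum (fun m : ℤ => ratEval (vdm (r + 1)) (coeffs v' v (snocM c (nprod s ha hb m))) y *
      ξ ^ (-m - 1)) (ratEval (vdm (r + 2)) (coeffs v' v (snocM (snocM c a) b))
        (split y (y (Fin.last r) + ξ) (y (Fin.last r)))) := by
  obtain ⟨M, hM⟩ := id hf
  -- One exponent must serve both purposes: clear all poles of the correlation function and exceed
  -- the order of locality.
  obtain ⟨N, hMN, hN⟩ := hab.exists_le M
  have hfin : (Function.support (act (vdm (r + 2) ^ N)
      (coeffs v' v (snocM (snocM c a) b)))).Finite := by
    obtain ⟨k, rfl⟩ := Nat.exists_eq_add_of_le' hMN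
    rw [pow_add, act_mul]; exact finite_support_act hM _
  obtain ⟨Q, hQ, hQy⟩ := vdm_factor r
  set d : MvPolynomial (Fin (r + 2)) ℂ :=
    MvPolynomial.X (Fin.last r).castSucc - MvPolynomial.X (Fin.last (r + 1)) with hd
  set f := coeffs v' v (snocM (snocM c a) b) with hfdef
  set h := act (d ^ N) f with hh
  have hg : act (Q ^ N) h = act (vdm (r + 2) ^ N) f := by
    rw [hh, ← Module.End.mul_apply, ← act_mul, ← mul_pow, ← hQ]
  have hT : TaylorRational h := ⟨truncatedLast_act_coeffs ha hb v' v c hN, fun k => by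
    rw [hh, taylor_act_coeffs ha hb v' v c hN]; exact hp _⟩
  obtain ⟨_, h2⟩ := taylorRational_act hT hy (Q ^ N)
  obtain ⟨_, h3, h4⟩ := taylor_finite hfin
  have hconv : ConvergesTo (taylorSeries y (act (vdm (r + 2) ^ N) f)) fun ξ =>
      laurentEval (act (vdm (r + 2) ^ N) f) (split y (y (Fin.last r) + ξ) (y (Fin.last r))) := by
    have : ∀ᶠ ξ in 𝓝 (0 : ℂ), ‖ξ‖ < ‖y (Fin.last r)‖ :=
      continuous_norm.continuousAt.eventually_lt continuousAt_const (by
        simpa using hy.1 (Fin.last r))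
    filter_upwards [this] with ξ hξ
    refine (h4 y hy.1 ξ hξ).of_eq fun k => ?_
    rw [taylorSeries, PowerSeries.coeff_mk, ratEval_of_finite (h3 k) hy.1 hy.eval_vdm_ne]
  rw [← hg, h2, hg] at hconv
  have hQ0 : ∀ ξ, (substPoly y (Q ^ N)).eval ξ = (substPoly y Q).eval ξ ^ N := by
    intro ξ; rw [map_pow, Polynomial.eval_pow]
  have hQ1 : (substPoly y Q).eval 0 ≠ 0 := by
    rw [eval_substPoly, add_zero]; exact hQy y hy.2
  -- Convergence is known for the finite sum `Q^N h`. The polynomial `Q^N` does not vanish at `ξ =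
  -- 0`, so dividing by it gives convergence of the Taylor series of `h` near `0`.
  have h5 := ConvergesTo.of_mul (by rw [hQ0]; exact pow_ne_zero _ hQ1) hconv
  have h6 : ∀ᶠ ξ in 𝓝 (0 : ℂ), (substPoly y Q).eval ξ ≠ 0 :=
    (substPoly y Q).continuous.continuousAt.eventually_ne hQ1
  have h7 : ∀ᶠ ξ in 𝓝 (0 : ℂ), y (Fin.last r) + ξ ≠ 0 :=
    (continuous_const.add continuous_id).continuousAt.eventually_ne (by simpa using hy.1 _)
  filter_upwards [h5, h6, h7] with ξ h5 h6 h7 hξ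
  set z := split y (y (Fin.last r) + ξ) (y (Fin.last r)) with hz
  have hz0 : ∀ i, z i ≠ 0 := fun i => by
    induction i using fin_cases_two with
    | h1 i => rw [hz, split_castSucc]; exact hy.1 _
    | h2 => rw [hz, split_penult]; exact h7
    | h3 => rw [hz, split_last]; exact hy.1 _
  have hev : MvPolynomial.eval z (vdm (r + 2)) = (substPoly y Q).eval ξ * ξ := by
    rw [hQ, map_mul, eval_substPoly, map_sub, MvPolynomial.eval_X, MvPolynomial.eval_X, hz,
      split_penult, split_last, add_sub_cancel_left]
  have hne : MvPolynomial.eval z (vdm (r + 2)) ≠ 0 := by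
    rw [hev]; exact mul_ne_zero h6 hξ
  have h8 := hasSum_ope_aux ha hb v' v c hN hξ (y := y) (h5.of_eq fun k => by
    rw [taylorSeries, PowerSeries.coeff_mk, hh, taylor_act_coeffs ha hb v' v c hN])
  rw [ratEval_eq_div hf hz0 hne hfin (by rw [map_pow]; exact pow_ne_zero _ hne), map_pow (MvPolynomial.eval _), hev,
    mul_pow, ← div_div, ← hQ0]
  exact h8

/-- For two fields the expansion converges in a full punctured disc. -/
lemma hasSum_ope_two (hab : IsLocal s a b) {c : Fin 0 → Modes V}
    (hf : IsRational (vdm 2) (coeffs v' v (snocM (snocM c a) b)))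
    {z ξ : ℂ} (hξ : ξ ≠ 0) (hlt : ‖ξ‖ < ‖z‖) :
    HasSum (fun m : ℤ => ratEval (vdm 1) (coeffs v' v (snocM c (nprod s ha hb m))) (fun _ => z) *
      ξ ^ (-m - 1)) (ratEval (vdm 2) (coeffs v' v (snocM (snocM c a) b)) ![z + ξ, z]) := by
  have hz : z ≠ 0 := by
    rintro rfl
    simp at hlt
    exact absurd hlt (norm_nonneg ξ).not_gt
  have hzξ : z + ξ ≠ 0 := fun h => by
    rw [eq_neg_of_add_eq_zero_left h, norm_neg] at hlt
    exact lt_irrefl _ hlt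
  obtain ⟨M, hM⟩ := id hf
  obtain ⟨N, hMN, hN⟩ := hab.exists_le M
  have hfin : (Function.support (act (vdm 2 ^ N)
      (coeffs v' v (snocM (snocM c a) b)))).Finite := by
    obtain ⟨k, rfl⟩ := Nat.exists_eq_add_of_le' hMN
    rw [pow_add, act_mul]; exact finite_support_act hM _
  have hy : Good (fun _ : Fin 1 => z) := ⟨fun _ => hz, fun i j _ => Subsingleton.elim i j⟩
  -- With two variables the Vandermonde product is the single colliding difference. There is no
  -- cofactor to divide by, so the full radius `|z|` survives.
  obtain ⟨_, h3, h4⟩ := taylor_finite (r := 0) hfin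
  have h5 := h4 (fun _ => z) (fun _ => hz) ξ hlt
  have hpt : split (r := 0) (fun _ => z) (z + ξ) z = ![z + ξ, z] := by
    funext i
    fin_cases i
    · exact split_penult (r := 0) (fun _ => z) (z + ξ) z
    · exact split_last (r := 0) (fun _ => z) (z + ξ) z
  rw [hpt] at h5
  have hz0 : ∀ i, (![z + ξ, z] : Fin 2 → ℂ) i ≠ 0 := fun i => by
    fin_cases i
    · exact hzξ
    · exact hz
  have hev : MvPolynomial.eval ![z + ξ, z] (vdm 2) = ξ := by
    rw [vdm_two]; simp
  have hne : MvPolynomial.eval ![z + ξ, z] (vdm 2) ≠ 0 := by rwa [hev]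
  rw [ratEval_eq_div hf hz0 hne hfin (by rw [map_pow]; exact pow_ne_zero _ hne), map_pow (MvPolynomial.eval _), hev]
  refine hasSum_ope_aux ha hb v' v c hN hξ (h5.of_eq fun k => ?_)
  have e := taylor_act_coeffs ha hb v' v c hN k
  rw [show (MvPolynomial.X (Fin.last 0).castSucc - MvPolynomial.X (Fin.last 1) :
    MvPolynomial (Fin 2) ℂ) = vdm 2 from vdm_two.symm] at e
  rw [← e, ratEval_of_finite (h3 k) hy.1 hy.eval_vdm_ne]

end OPE

/-! ### Iterated residues -/

section IteratedResidue

lemma iterRes_congr (k : ℕ) {ε : ℝ} (hε : 0 < ε) (m : Fin k → ℤ) {F G : (Fin k → ℂ) → ℂ}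
    (h : ∀ ξ : Fin k → ℂ, (∀ j, ξ j ≠ 0) → (∀ j, ‖ξ j‖ < ε) → StrictAnti (fun j => ‖ξ j‖) →
      F ξ = G ξ) : iterRes k m F = iterRes k m G := by
  induction k generalizing ε with
  | zero => exact h _ (fun j => j.elim0) (fun j => j.elim0) (fun j => j.elim0)
  | succ k ih =>
    refine residueAtZero_congr hε fun ξ hξ hlt => ?_
    congr 1
    -- The inner residues are taken with `ξ` fixed, so their variables may be assumed smaller than
    -- `ξ`; only points with decreasing absolute values matter.
    refine ih (norm_pos_iff.2 hξ) _ fun ξs h1 h2 h3 => h _ ?_ ?_ ?_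
    · exact Fin.cases hξ h1
    · exact Fin.cases hlt fun j => (h2 j).trans hlt
    · refine Fin.strictAnti_iff_succ_lt.2 fun j => ?_
      cases k with
      | zero => exact j.elim0
      | succ k =>
        induction j using Fin.cases with
        | zero => exact h2 0
        | succ j =>
          rw [Fin.cons_succ, ← Fin.succ_castSucc, Fin.cons_succ]
          exact h3 (Fin.castSucc_lt_succ)

end IteratedResidue

/-! ### Inserting the identity field -/

section Identity

variable {r : ℕ}

/-- A series in one more variable `z`, not depending on it. -/
def constLast (f : (Fin r → ℤ) → ℂ) (n : Fin (r + 1) → ℤ) : ℂ :=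
  -- The index `-1` is the exponent `0` of the new variable.
  if n (Fin.last r) = -1 then f fun i => n i.castSucc else 0

lemma act_constLast (Q : MvPolynomial (Fin r) ℂ) (f : (Fin r → ℤ) → ℂ) :
    act (MvPolynomial.rename Fin.castSucc Q) (constLast f) = constLast (act Q f) := by
  induction Q using MvPolynomial.induction_on generalizing f with
  | C c =>
    rw [MvPolynomial.rename_C, act_C, act_C]
    funext n
    simp [constLast]
  | add p q hp hq =>
    rw [map_add, map_add, map_add, LinearMap.add_apply, LinearMap.add_apply, hp, hq]
    funext n
    simp only [constLast, Pi.add_apply]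
    split_ifs <;> simp
  | mul_X p i hp =>
    rw [map_mul, MvPolynomial.rename_X, act_mul, act_mul, Module.End.mul_apply, Module.End.mul_apply,
      ← hp]
    congr 1
    funext n
    rw [act_X]
    simp only [constLast]
    rw [act_X]
    have h1 : (n + Pi.single i.castSucc 1 : Fin (r + 1) → ℤ) (Fin.last r) = n (Fin.last r) := by
      simp [Pi.single_apply, (Fin.castSucc_lt_last i).ne']
    rw [h1]
    have h2 : (fun j : Fin r => (n + Pi.single i.castSucc 1 : Fin (r + 1) → ℤ) j.castSucc) =
        (fun j : Fin r => n j.castSucc) + Pi.single i 1 := by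
      funext j
      simp [Pi.single_apply]
    rw [h2]

lemma snoc_injective_last {α : Type*} (a : α) :
    Function.Injective fun n : Fin r → α => (Fin.snoc (α := fun _ => α) n a : Fin (r + 1) → α) :=
  fun n n' h => by
    have := congrArg Fin.init h
    simpa using this

lemma hasSum_constLast {g : (Fin r → ℤ) → ℂ} {x : Fin r → ℂ} (z : ℂ) {S : ℂ}
    (h : HasSum (fun n => g n * mon x n) S) :
    HasSum (fun n => constLast g n * mon (Fin.snoc (α := fun _ => ℂ) x z) n) S := by
  refine ((snoc_injective_last (-1 : ℤ)).hasSum_iff fun n hn => ?_).1 (h.of_eq fun n => ?_)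
  · rw [constLast, if_neg, zero_mul]
    intro h
    refine hn ⟨fun i => n i.castSucc, ?_⟩
    beta_reduce
    rw [← h]
    exact Fin.snoc_init_self n
  · simp only [Function.comp_apply, constLast, Fin.snoc_last, if_true, Fin.snoc_castSucc]
    congr 1
    unfold mon
    rw [Fin.prod_univ_castSucc]
    simp

lemma finite_constLast {g : (Fin r → ℤ) → ℂ} (hg : (Function.support g).Finite) :
    (Function.support (constLast g)).Finite := by
  refine (hg.image fun n => (Fin.snoc (α := fun _ => ℤ) n (-1) : Fin (r + 1) → ℤ)).subset
    fun n hn => ?_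
  have h : n (Fin.last r) = -1 := by
    by_contra h
    exact hn (if_neg h)
  refine ⟨fun i => n i.castSucc, ?_, ?_⟩
  · rw [Function.mem_support, constLast, if_pos h] at hn
    exact hn
  · beta_reduce
    rw [← h]
    exact Fin.snoc_init_self n

/-- The denominator in the old variables already clears all poles, and it can replace the full
Vandermonde product in evaluating the function; nothing then depends on `z`. -/
lemma isRational_constLast {f : (Fin r → ℤ) → ℂ} (hf : IsRational (vdm r) f)
    (hf' : IsRational (vdm (r + 1)) (constLast f)) {x : Fin r → ℂ} {z : ℂ} (hx : Good x)
    (hxz : Good (Fin.snoc (α := fun _ => ℂ) x z)) :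
    ratEval (vdm (r + 1)) (constLast f) (Fin.snoc (α := fun _ => ℂ) x z) = ratEval (vdm r) f x := by
  obtain ⟨N, hN⟩ := id hf
  have h1 := act_constLast (vdm r ^ N) f
  have h2 : MvPolynomial.eval (Fin.snoc (α := fun _ => ℂ) x z)
      (MvPolynomial.rename Fin.castSucc (vdm r ^ N)) = MvPolynomial.eval x (vdm r ^ N) := by
    rw [MvPolynomial.eval_rename]
    congr 2
    funext i
    simp
  have h3 : MvPolynomial.eval x (vdm r ^ N) ≠ 0 := by
    rw [map_pow]; exact pow_ne_zero _ hx.eval_vdm_ne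
  rw [ratEval_eq_div hf' hxz.1 hxz.eval_vdm_ne (by rw [h1]; exact finite_constLast hN)
    (by rw [h2]; exact h3), ratEval_eq_div hf hx.1 hx.eval_vdm_ne hN h3, h2, h1]
  congr 1
  exact (hasSum_laurentEval (finite_constLast hN) _).unique
    (hasSum_constLast z (hasSum_laurentEval hN x))

end Identity

/-! ### Correlation functions and their residues -/

section Correlation

variable {V : ℤ → Type u} [∀ k, AddCommGroup (V k)] [∀ k, Module ℂ (V k)]
variable {I : Type v}

/-- The correlation function of a list of fields at the given points. -/
def corr (v' : GradedDual V) (v : Total V) (L : List (Modes V × ℂ)) : ℂ :=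
  ratEval (vdm L.length) (coeffs v' v fun i => (L.get i).1) fun i => (L.get i).2

lemma corr_ofFn (v' : GradedDual V) (v : Total V) {k : ℕ} (c : Fin k → Modes V) (y : Fin k → ℂ) :
    corr v' v (List.ofFn fun i => (c i, y i)) = ratEval (vdm k) (coeffs v' v c) y := by
  generalize hL : (List.ofFn fun i => (c i, y i)) = L
  have hk : L.length = k := by rw [← hL, List.length_ofFn]
  subst hk
  have h : (fun i => (c i, y i)) = L.get := by
    apply List.ofFn_injective
    rw [hL, List.ofFn_get]
  unfold corr
  rw [← h]

lemma append_eq_ofFn (L : List (Modes V × ℂ)) (a : Modes V) (z : ℂ) :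
    L ++ [(a, z)] = List.ofFn fun i : Fin (L.length + 1) =>
      (snocM (fun i => (L.get i).1) a i, Fin.snoc (α := fun _ => ℂ) (fun i => (L.get i).2) z i) := by
  rw [List.ofFn_succ_last]
  simp

lemma corr_append (v' : GradedDual V) (v : Total V) (L : List (Modes V × ℂ)) (a : Modes V) (z : ℂ) :
    corr v' v (L ++ [(a, z)]) = ratEval (vdm (L.length + 1))
      (coeffs v' v (snocM (fun i => (L.get i).1) a))
      (Fin.snoc (α := fun _ => ℂ) (fun i => (L.get i).2) z) := by
  rw [append_eq_ofFn, corr_ofFn]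

lemma corr_append_two (v' : GradedDual V) (v : Total V) (L : List (Modes V × ℂ)) (a b : Modes V)
    (w z : ℂ) :
    corr v' v (L ++ [(a, w)] ++ [(b, z)]) = ratEval (vdm (L.length + 2))
      (coeffs v' v (snocM (snocM (fun i => (L.get i).1) a) b))
      (split (Fin.snoc (α := fun _ => ℂ) (fun i => (L.get i).2) z) w z) := by
  rw [← corr_ofFn]
  congr 1
  rw [List.ofFn_succ_last, List.ofFn_succ_last]
  simp [split]

/-- The points are distinct and non-zero. -/
def GoodList (l : List ℂ) : Prop := l.Nodup ∧ (0 : ℂ) ∉ l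

lemma good_iff_ofFn {k : ℕ} (y : Fin k → ℂ) : Good y ↔ GoodList (List.ofFn y) := by
  rw [Good, GoodList, List.nodup_ofFn, and_comm]
  refine and_congr_right fun _ => ?_
  simp [List.mem_ofFn]

lemma good_snoc (L : List (Modes V × ℂ)) (z : ℂ) (h : GoodList (L.map Prod.snd ++ [z])) :
    Good (Fin.snoc (α := fun _ => ℂ) (fun i => (L.get i).2) z) := by
  rw [good_iff_ofFn, List.ofFn_succ_last]
  simpa [← List.map_ofFn, Function.comp_def, List.ofFn_getElem] using h

lemma corr_idModes (v' : GradedDual V) (v : Total V) (L : List (Modes V × ℂ)) {z : ℂ}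
    (hz : GoodList (L.map Prod.snd ++ [z]))
    (h1 : IsRational (vdm L.length) (coeffs v' v fun i => (L.get i).1))
    (h2 : IsRational (vdm (L.length + 1)) (coeffs v' v (snocM (fun i => (L.get i).1) idModes))) :
    corr v' v (L ++ [(idModes, z)]) = corr v' v L := by
  have e : coeffs v' v (snocM (fun i => (L.get i).1) idModes) =
      constLast (coeffs v' v fun i => (L.get i).1) := by
    funext n
    rw [coeffs_snoc, constLast, idModes]
    split_ifs
    · rfl
    · simp
  have hg := good_snoc L z hz
  rw [corr_append, e, corr]
  rw [e] at h2
  refine isRational_constLast h1 h2 ⟨fun i => ?_, fun i j hij => ?_⟩ hg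
  · have := hg.1 i.castSucc
    rwa [Fin.snoc_castSucc] at this
  · have := @hg.2 i.castSucc j.castSucc
    rw [Fin.snoc_castSucc, Fin.snoc_castSucc, Fin.castSucc_inj] at this
    exact this hij

variable {vac : V 0} {M : I → Modes V} {wt : I → ℤ} {L : Module.End ℂ (Total V)}

/-- A field of some weight. -/
def IsSomeField (M : I → Modes V) (wt : I → ℤ) (L : Module.End ℂ (Total V)) (a : Modes V) : Prop :=
  ∃ d, IsField M wt L d a

namespace IsFormalData

variable (D : IsFormalData vac M wt L)
include D

lemma isRational_coeffs {k : ℕ} {c : Fin k → Modes V} (hc : ∀ i, IsSomeField M wt L (c i))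
    (v' : GradedDual V) (v : Total V) : IsRational (vdm k) (coeffs v' v c) := by
  choose d hd using hc
  exact coeffs_isRational (fun i => D.isTrunc (hd i)) (fun i => (hd i).homog)
    (fun i j => D.isLocal_fields (hd i) (hd j)) v' v

lemma hasSum_coeffs {k : ℕ} {c : Fin k → Modes V} (hc : ∀ i, IsSomeField M wt L (c i))
    (v' : GradedDual V) (v : Total V) {z : Fin k → ℂ} (hz : ∀ i, z i ≠ 0)
    (ha : StrictAnti fun i => ‖z i‖) :
    HasSum (fun n => coeffs v' v c n * mon z n) (ratEval (vdm k) (coeffs v' v c) z) :=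
  hasSum_ratEval (D.isRational_coeffs hc v' v) (fun i j hij => by
    choose d hd using hc
    exact coeffs_vanishes (fun i => D.isTrunc (hd i)) v' v hij) hz ha

lemma isSomeField_snoc {k : ℕ} {c : Fin k → Modes V} (hc : ∀ i, IsSomeField M wt L (c i))
    {a : Modes V} (ha : IsSomeField M wt L a) (i : Fin (k + 1)) :
    IsSomeField M wt L (snocM c a i) := by
  induction i using Fin.lastCases with
  | last => simpa [snocM] using ha
  | cast i => simpa [snocM] using hc i

/-- The residue of a correlation function at a collision of two points. -/
lemma residue_corr {Λ : List (Modes V × ℂ)} (hΛ : ∀ p ∈ Λ, IsSomeField M wt L p.1) {d e : ℤ}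
    {a b : Modes V} (ha : IsField M wt L d a) (hb : IsField M wt L e b) (v' : GradedDual V)
    (v : Total V) {z : ℂ} (hz : GoodList (Λ.map Prod.snd ++ [z])) (m : ℤ) :
    residueAtZero (fun ξ => ξ ^ m * corr v' v (Λ ++ [(a, ξ + z)] ++ [(b, z)])) =
      corr v' v (Λ ++ [(nprod (sg d e) (D.isTrunc ha) (D.isTrunc hb) m, z)]) := by
  have hc : ∀ i, IsSomeField M wt L (Λ.get i).1 := fun i => hΛ _ (List.get_mem _ _)
  have hab := D.isLocal_fields ha hb
  have h := hasSum_ope (D.isTrunc ha) (D.isTrunc hb) v' v (fun i => (Λ.get i).1) hab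
    (D.isRational_coeffs (D.isSomeField_snoc (D.isSomeField_snoc hc ⟨d, ha⟩) ⟨e, hb⟩) v' v)
    (fun m => D.isRational_coeffs (D.isSomeField_snoc hc ⟨_, D.isField_nprod ha hb hab m⟩) v' v)
    (good_snoc Λ z hz)
  obtain ⟨ε, hε, h⟩ := Metric.eventually_nhds_iff.1 h
  rw [corr_append]
  refine residueAtZero_of_hasSum (c := fun m => ratEval (vdm (Λ.length + 1))
      (coeffs v' v (snocM (fun i => (Λ.get i).1) (nprod (sg d e) (D.isTrunc ha) (D.isTrunc hb) m)))
      (Fin.snoc (α := fun _ => ℂ) (fun i => (Λ.get i).2) z)) hε (fun ξ hξ hlt => ?_) m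
  have := h (by simpa using hlt) hξ
  rw [Fin.snoc_last] at this
  rw [corr_append_two, add_comm ξ z]
  exact this

/-- Iterated residues of correlation functions. -/
lemma exists_iterRes {k : ℕ} {c : Fin k → Modes V} (hc : ∀ i, IsSomeField M wt L (c i))
    {b : Modes V} (hb : IsSomeField M wt L b) (m : Fin k → ℤ) : ∃ w, IsSomeField M wt L w ∧
    w (-1) (vacuum vac) = prodL c (List.finRange k) m (b (-1) (vacuum vac)) ∧
    ∀ (Λ : List (Modes V × ℂ)) (v' : GradedDual V) (v : Total V) (z : ℂ),
      (∀ p ∈ Λ, IsSomeField M wt L p.1) → GoodList (Λ.map Prod.snd ++ [z]) →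
      iterRes k m (fun ξ => corr v' v (Λ ++ List.ofFn (fun j => (c j, ξ j + z)) ++ [(b, z)])) =
        corr v' v (Λ ++ [(w, z)]) := by
  induction k with
  | zero => exact ⟨b, hb, by simp [prodL], fun Λ v' v z _ _ => by simp [iterRes]⟩
  | succ k ih =>
    -- The later fields collapse onto `b` first and produce `w`; then `c 0` collapses onto `w`.
    -- During the inner step `c 0` is one more spectator, which is why `Λ` is arbitrary.
    obtain ⟨w, ⟨e, hw⟩, hw1, hw2⟩ := ih (fun i => hc i.succ) (Fin.tail m)
    obtain ⟨d, ha⟩ := hc 0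
    refine ⟨nprod (sg d e) (D.isTrunc ha) (D.isTrunc hw) (m 0),
      ⟨_, D.isField_nprod ha hw (D.isLocal_fields ha hw) _⟩, ?_, fun Λ v' v z hΛ hz => ?_⟩
    · rw [D.nprod_vacuum ha hw, hw1, List.finRange_succ, prodL_cons]
      simp [prodL, Function.comp_def, Fin.tail]
    · rw [← D.residue_corr hΛ ha hw v' v hz]
      obtain ⟨ε, hε, h⟩ : ∃ ε > 0, ∀ ξ : ℂ, ξ ≠ 0 → ‖ξ‖ < ε →
          GoodList (Λ.map Prod.snd ++ [ξ + z] ++ [z]) := by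
        -- For small nonzero `ξ` the moving point avoids the origin and all spectators, so the inner
        -- induction hypothesis applies.
        have h1 : ∀ᶠ ξ in 𝓝 (0 : ℂ), ∀ w ∈ insert 0 (Λ.map Prod.snd).toFinset, ξ + z ≠ w := by
          rw [Filter.eventually_all_finset]
          intro w hw
          refine (continuous_id.add continuous_const).continuousAt.eventually_ne ?_
          simp only [Pi.add_apply, id_eq, zero_add]
          rintro rfl
          rw [GoodList, List.nodup_append] at hz
          rcases Finset.mem_insert.1 hw with rfl | hw
          · exact hz.2 (by simp)
          · exact hz.1.2.2 z (List.mem_toFinset.1 hw) z (by simp) rfl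
        obtain ⟨ε, hε, h1⟩ := Metric.eventually_nhds_iff.1 h1
        refine ⟨ε, hε, fun ξ hξ hlt => ?_⟩
        have h2 := h1 (y := ξ) (by simpa using hlt)
        have h3 : ξ + z ∉ Λ.map Prod.snd := fun h =>
          h2 _ (Finset.mem_insert_of_mem (List.mem_toFinset.2 h)) rfl
        have h4 := h2 0 (Finset.mem_insert_self _ _)
        obtain ⟨hz1, hz2⟩ := hz
        refine ⟨?_, ?_⟩
        · rw [List.append_assoc, List.singleton_append, List.nodup_append]
          rw [List.nodup_append] at hz1
          refine ⟨hz1.1, by simpa using hξ, fun x hx y hy => ?_⟩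
          rcases List.mem_cons.1 hy with rfl | hy
          · rintro rfl; exact h3 hx
          · exact hz1.2.2 x hx y hy
        · simp only [List.mem_append, List.mem_singleton, not_or] at hz2 ⊢
          exact ⟨⟨hz2.1, fun h => h4 h.symm⟩, hz2.2⟩
      refine residueAtZero_congr hε fun ξ hξ hlt => ?_
      congr 1
      have h5 := hw2 (Λ ++ [(c 0, ξ + z)]) v' v z (fun p hp => by
        rcases List.mem_append.1 hp with hp | hp
        · exact hΛ p hp
        · rw [List.mem_singleton.1 hp]; exact hc 0) (by simpa using h ξ hξ hlt)
      rw [← h5]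
      congr 1
      funext ξs
      beta_reduce
      rw [List.ofFn_succ]
      simp

end IsFormalData

end Correlation

/-! ### Translating the hypotheses on the generating fields -/

section Data

variable {V : ℤ → Type u} [∀ k, AddCommGroup (V k)] [∀ k, Module ℂ (V k)] {I : Type v}

lemma evalAt_add (d : ℤ) (a b : Modes V) (z : ℂ) : evalAt d (a + b) z = evalAt d a z + evalAt d b z := by
  refine DirectSum.linearMap_ext ℂ fun l => LinearMap.ext fun x => funext fun j => ?_
  change evalAt d (a + b) z (ofDeg l x) j = evalAt d a z (ofDeg l x) j + evalAt d b z (ofDeg l x) j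
  rw [evalAt_ofDeg, evalAt_ofDeg, evalAt_ofDeg]
  split_ifs
  · simp
  · simp

lemma evalAt_smul (d : ℤ) (c : ℂ) (a : Modes V) (z : ℂ) : evalAt d (c • a) z = c • evalAt d a z := by
  refine DirectSum.linearMap_ext ℂ fun l => LinearMap.ext fun x => funext fun j => ?_
  change evalAt d (c • a) z (ofDeg l x) j = c • evalAt d a z (ofDeg l x) j
  rw [evalAt_ofDeg, evalAt_ofDeg]
  split_ifs
  · simp only [Pi.smul_apply, LinearMap.smul_apply, DirectSum.smul_apply]
    rw [smul_comm]
  · simp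

lemma dcoeff_congr {f g : ℂ → Completion V} (h : ∀ z, z ≠ 0 → f z = g z) (v' : GradedDual V) {z : ℂ}
    (hz : z ≠ 0) : dcoeff f v' z = dcoeff g v' z := by
  refine Filter.EventuallyEq.deriv_eq ?_
  filter_upwards [isOpen_ne.mem_nhds hz] with x hx
  rw [h x hx]

namespace IsGeneratingData

variable {vac : V 0} {φ : I → ℂ → Total V →ₗ[ℂ] Completion V} {wt : I → ℤ}
  {L : Module.End ℂ (Total V)} (h : IsGeneratingData vac φ wt L)
include h

lemma eq_evalAt (i : I) {z : ℂ} (hz : z ≠ 0) : φ i z = evalAt (wt i) (modesOf (wt i) (φ i)) z :=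
  eq_evalAt_modesOf (h.analytic i) (h.weight_bracket i) hz

lemma mode_eq (i : I) (n : ℤ) (v : Total V) : mode (φ i) n v = modesOf (wt i) (φ i) n v :=
  mode_eq_of_evalAt (isHomog_modesOf _ _) (fun _ hz => h.eq_evalAt i hz) n v

lemma word_eq (l : List (I × ℤ)) (v : Total V) :
    word φ l v = wordM (fun i => modesOf (wt i) (φ i)) l v := by
  unfold word wordM
  simp only [h.mode_eq]

lemma isCovariant (i : I) : IsCovariant L (modesOf (wt i) (φ i)) :=
  isCovariant_of_hasSum (isHomog_modesOf _ _) fun v v' z hz => by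
    have h1 := h.L_bracket i v v' z hz
    rw [dcoeff_congr (fun z hz => by rw [h.eq_evalAt i hz]) v' hz] at h1
    rwa [h.eq_evalAt i hz] at h1

lemma spanning_modesOf : Submodule.span ℂ (Set.range fun l : List (I × ℤ) =>
    wordM (fun i => modesOf (wt i) (φ i)) l (vacuum vac)) = ⊤ := by
  have := h.spanning
  simpa only [h.word_eq] using this

lemma isTrunc_modesOf (i : I) : IsTrunc (modesOf (wt i) (φ i)) := by
  obtain ⟨k₀, hk⟩ := h.lower_bounded
  exact fun v => (isHomog_modesOf _ _).trunc hk v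

lemma isLocal_fieldParity (i j : I) : IsLocal
    (sign (fieldParity vac (φ i)) (fieldParity vac (φ j)))
    (modesOf (wt i) (φ i)) (modesOf (wt j) (φ j)) := by
  obtain ⟨N, _, hN⟩ := h.weak_comm i j
  refine ⟨N, fun v => ?_⟩
  have := hN v
  simpa only [h.mode_eq] using this

/-- Goddard's theorem compares the field with zero. A vanishing vector `φ_{-1} 1`, whose parity is
`0` by convention, thus belongs to the zero field only. -/
lemma modesOf_eq_zero {i : I} (hi : modesOf (wt i) (φ i) (-1) (vacuum vac) = 0) :
    modesOf (wt i) (φ i) = 0 :=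
  goddard (b := 0) h.isTrunc_modesOf h.L_vacuum h.spanning_modesOf (h.isTrunc_modesOf i)
    (fun v => ⟨0, fun _ _ => rfl⟩) (h.isCovariant i) (fun n v => by simp)
    (fun j => (h.isLocal_fieldParity i j).isWeakLocal) (fun j => (isLocal_zero _ _).isWeakLocal) hi

/-- The vector `φ_{-1} 1` is homogeneous of index `wt i`, and it is nonzero because the field is;
its parity is therefore that of `wt i`. -/
lemma fieldParity_eq {i : I} (hi : modesOf (wt i) (φ i) ≠ 0) :
    fieldParity vac (φ i) = (wt i : ZMod 2) := by
  have h1 : modesOf (wt i) (φ i) (-1) (vacuum vac) ≠ 0 := fun h0 => hi (h.modesOf_eq_zero h0)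
  have h2 : ∀ j, j ≠ wt i → modesOf (wt i) (φ i) (-1) (vacuum vac) j = 0 := fun j hj =>
    isHomog_modesOf (wt i) (φ i) (-1) 0 vac j (by omega)
  have h3 := eq_ofDeg_of_forall h2
  rw [fieldParity, h.mode_eq]
  split_ifs with hp
  · by_contra hne
    refine h1 ?_
    rw [h3, hp (wt i) fun h => hne h.symm, map_zero]
  · have h4 : (wt i : ZMod 2) ≠ 0 := fun h0 => hp (by
      rw [h3, ← h0]; exact ofDeg_mem_parityPart _ _)
    generalize (wt i : ZMod 2) = x at h4
    revert x
    decide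

lemma isFormalData : IsFormalData vac (fun i => modesOf (wt i) (φ i)) wt L where
  lower_bounded := h.lower_bounded
  homog i := isHomog_modesOf _ _
  L_vacuum := h.L_vacuum
  covariant := h.isCovariant
  spanning := h.spanning_modesOf
  isLocal i j := by
    -- The conventional parity of a zero field may disagree with its weight, but the zero field is
    -- local with any sign.
    by_cases hi : modesOf (wt i) (φ i) = 0
    · rw [hi]; exact isLocal_zero _ _
    by_cases hj : modesOf (wt j) (φ j) = 0
    · rw [hj]; exact ⟨0, fun v => by simp⟩
    have := h.isLocal_fieldParity i j
    rwa [h.fieldParity_eq hi, h.fieldParity_eq hj, sg_parity] at this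

end IsGeneratingData

end Data

/-! ### The vertex operator map and its one-field axioms -/

section VertexOperators

variable {V : ℤ → Type u} [∀ k, AddCommGroup (V k)] [∀ k, Module ℂ (V k)] {I : Type v}
variable {vac : V 0} {M : I → Modes V} {wt : I → ℤ} {L : Module.End ℂ (Total V)}

namespace IsFormalData

variable (D : IsFormalData vac M wt L)

/-- The field attached to a homogeneous vector. -/
def stateField (k : ℤ) : V k →ₗ[ℂ] Modes V where
  toFun x := (D.exists_field x).choose
  map_add' x y := by
    have hx := (D.exists_field x).choose_spec
    have hy := (D.exists_field y).choose_spec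
    have hxy := (D.exists_field (x + y)).choose_spec
    -- The fields are obtained by choice; linearity is a consequence of uniqueness.
    refine D.field_unique hxy.1 (hx.1.add hy.1) ?_
    rw [hxy.2, Pi.add_apply, LinearMap.add_apply, hx.2, hy.2, map_add]
  map_smul' c x := by
    have hx := (D.exists_field x).choose_spec
    have hcx := (D.exists_field (c • x)).choose_spec
    refine D.field_unique hcx.1 (hx.1.smul c) ?_
    rw [hcx.2, Pi.smul_apply, LinearMap.smul_apply, hx.2, map_smul]
    rfl

lemma isField_stateField (k : ℤ) (x : V k) : IsField M wt L k (D.stateField k x) :=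
  (D.exists_field x).choose_spec.1

lemma stateField_vacuum (k : ℤ) (x : V k) : D.stateField k x (-1) (vacuum vac) = ofDeg k x :=
  (D.exists_field x).choose_spec.2

/-- The vertex operator map. -/
def vertexOp (z : ℂ) : Total V →ₗ[ℂ] Total V →ₗ[ℂ] Completion V :=
  DirectSum.toModule ℂ ℤ _ fun k =>
    { toFun := fun x => evalAt k (D.stateField k x) z
      map_add' := fun x y => by rw [map_add, evalAt_add]
      map_smul' := fun c x => by rw [map_smul, evalAt_smul]; rfl }

lemma vertexOp_ofDeg (z : ℂ) (k : ℤ) (x : V k) :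
    D.vertexOp z (ofDeg k x) = evalAt k (D.stateField k x) z := by
  simp only [vertexOp, ofDeg, DirectSum.toModule_lof]
  rfl

include D

/-- Every field is the vertex operator of the vector it creates. Applied to products, derivatives,
the identity and the generators, this gives most of the properties of the map. -/
lemma vertexOp_apply {d : ℤ} {a : Modes V} (ha : IsField M wt L d a) (z : ℂ) :
    D.vertexOp z (a (-1) (vacuum vac)) = evalAt d a z := by
  have h := eq_ofDeg_of_forall (D.field_vacuum ha)
  rw [h, vertexOp_ofDeg, D.field_unique (D.isField_stateField d _) ha]
  rw [stateField_vacuum, ← h]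

/-- Reduction to vectors of the form `a_{-1} 1`. -/
lemma field_induction {p : Total V → Prop} (u : Total V) (h0 : p 0)
    (h1 : ∀ d a, IsField M wt L d a → p (a (-1) (vacuum vac)))
    (h2 : ∀ x y, p x → p y → p (x + y)) : p u := by
  refine total_induction u h0 (fun k x => ?_) h2
  obtain ⟨a, ha, hx⟩ := D.exists_field x
  rw [← hx]
  exact h1 k a ha

lemma analytic (u v : Total V) : IsAnalytic fun z => D.vertexOp z u v := by
  induction u using D.field_induction with
  | h0 =>
    intro v'
    simp only [map_zero, LinearMap.zero_apply]
    exact differentiableOn_const _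
  | h1 d a ha =>
    simp only [D.vertexOp_apply ha]
    exact isAnalytic_evalAt ha.homog v
  | h2 x y hx hy =>
    intro v'
    simp only [map_add, LinearMap.add_apply]
    exact (hx v').add (hy v')

lemma dcoeff_add (x y v : Total V) (v' : GradedDual V) {z : ℂ} (hz : z ≠ 0) :
    dcoeff (fun z => D.vertexOp z (x + y) v) v' z =
      dcoeff (fun z => D.vertexOp z x v) v' z + dcoeff (fun z => D.vertexOp z y v) v' z := by
  have h := fun u => (D.analytic u v v').differentiableAt (isOpen_compl_singleton.mem_nhds hz)
  unfold dcoeff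
  simp only [map_add, LinearMap.add_apply]
  exact deriv_fun_add (h x) (h y)

lemma dcoeff_zero (v : Total V) (v' : GradedDual V) (z : ℂ) :
    dcoeff (fun z => D.vertexOp z 0 v) v' z = 0 := by
  simp [dcoeff]

lemma L_field {d : ℤ} {a : Modes V} (ha : IsField M wt L d a) :
    L (a (-1) (vacuum vac)) = derivModes a (-1) (vacuum vac) := by
  have := ha.covariant (-1) (vacuum vac)
  rw [D.L_vacuum, map_zero, sub_zero] at this
  rw [this]
  simp [derivModes]

/-- Not assumed: `L` sends `a_{-1} 1` to `(∂a)_{-1} 1`, and the weight of `∂a` is one higher, which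
is `2` in the doubled index. -/
lemma isHomogOp_L : IsHomogOp 2 L := by
  intro k x j hj
  obtain ⟨a, ha, hx⟩ := D.exists_field x
  rw [← hx, D.L_field ha]
  exact D.field_vacuum (D.isField_deriv ha) j hj

lemma weight_field {d : ℤ} {a : Modes V} (ha : IsField M wt L d a) :
    weight (a (-1) (vacuum vac)) = ((d : ℂ) / 2) • a (-1) (vacuum vac) := by
  have h := eq_ofDeg_of_forall (D.field_vacuum ha)
  rw [h, weight_ofDeg]

lemma weight_bracket (u v : Total V) (v' : GradedDual V) {z : ℂ} (hz : z ≠ 0) :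
    pair v' (weightCompl (D.vertexOp z u v)) - pair v' (D.vertexOp z u (weight v))
      = z * dcoeff (fun x => D.vertexOp x u v) v' z + pair v' (D.vertexOp z (weight u) v) := by
  induction u using D.field_induction with
  | h0 =>
    rw [dcoeff_zero]
    have : weightCompl (0 : Completion V) = 0 := by funext k; simp [weightCompl]
    simp [this]
  | h1 d a ha =>
    rw [D.weight_field ha]
    simp only [map_smul, LinearMap.smul_apply, D.vertexOp_apply ha, smul_eq_mul]
    exact weight_bracket_evalAt ha.homog v v' hz
  | h2 x y hx hy =>
    rw [D.dcoeff_add x y v v' hz]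
    have : ∀ w w' : Completion V, weightCompl (w + w') = weightCompl w + weightCompl w' := by
      intro w w'; funext k; simp [weightCompl]
    simp only [map_add, LinearMap.add_apply, this]
    linear_combination hx + hy

lemma evalAt_idModes {z : ℂ} (v : Total V) : evalAt 0 idModes z v = incl v := by
  refine completion_ext fun v' => (hasSum_evalAt isHomog_idModes z v v').unique ?_
  have := hasSum_single (f := fun n : ℤ => pair v' (incl ((idModes : Modes V) n v)) * z ^ (-n - 1))
    (-1) fun n hn => by simp [idModes, hn]
  simpa [idModes] using this

lemma identity (v : Total V) (z : ℂ) : D.vertexOp z (vacuum vac) v = incl v := by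
  have := D.vertexOp_apply (isField_idModes (M := M) (wt := wt) (L := L)) z
  simp only [idModes, if_true, Module.End.one_apply] at this
  rw [this]
  exact D.evalAt_idModes v

lemma creation_field {d : ℤ} {a : Modes V} (ha : IsField M wt L d a) :
    TendstoAtZero (fun z => evalAt d a z (vacuum vac)) (incl (a (-1) (vacuum vac))) := by
  intro v'
  induction v' using gradedDual_induction with
  | h0 => simp
  | h2 x y hx hy => simpa only [map_add, LinearMap.add_apply] using hx.add hy
  | h1 j f =>
    have hvac := covariant_vacuum D.L_vacuum ha.covariant (D.isTrunc ha)
    simp only [pair_dualOf, vacuum, evalAt_ofDeg]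
    split_ifs with he
    · obtain ⟨m, hm⟩ := he
      rw [show (d + 0 - j) / 2 = m by omega]
      simp only [map_smul, smul_eq_mul]
      -- The component is a multiple of `z ^ (-m)`: a positive power tends to zero, `m = 0` is the
      -- component of `a_{-1} 1`, and a negative power has coefficient zero because nonnegative
      -- modes kill the vacuum.
      rcases lt_trichotomy m 0 with hlt | rfl | hgt
      · have h1 : incl (a (-1) (ofDeg 0 vac)) j = 0 := D.field_vacuum ha j (by omega)
        rw [h1, map_zero]
        obtain ⟨k, rfl⟩ : ∃ k : ℕ, m = -(k + 1 : ℤ) := ⟨(-m - 1).toNat, by omega⟩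
        have h2 : Tendsto (fun z : ℂ => z ^ (k + 1)) (𝓝 0) (𝓝 0) := by
          have := (continuous_pow (M := ℂ) (k + 1)).tendsto 0
          simpa using this
        have h3 : Tendsto (fun z : ℂ => z ^ (k + 1)) (𝓝[≠] 0) (𝓝 0) :=
          h2.mono_left nhdsWithin_le_nhds
        replace h3 := h3.mul_const (f (a (-(k + 1 : ℤ) - 1) (ofDeg 0 vac) j))
        rw [zero_mul] at h3
        refine h3.congr fun z => ?_
        rw [neg_neg]
        norm_cast
      · simp only [neg_zero, zpow_zero, one_mul, zero_sub]
        exact tendsto_const_nhds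
      · have h1 : a (m - 1) (ofDeg 0 vac) = 0 := by
          have := hvac (m - 1).toNat
          rwa [Int.toNat_of_nonneg (by omega)] at this
        have h2 : incl (a (-1) (ofDeg 0 vac)) j = 0 := D.field_vacuum ha j (by omega)
        rw [h1, h2]
        simp
    · have h2 : incl (a (-1) (ofDeg 0 vac)) j = 0 := D.field_vacuum ha j (by
        rintro rfl; exact he ⟨0, by ring⟩)
      rw [h2, map_zero]
      exact tendsto_const_nhds

lemma creation (u : Total V) : TendstoAtZero (fun z => D.vertexOp z u (vacuum vac)) (incl u) := by
  induction u using D.field_induction with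
  | h0 => intro v'; simp
  | h1 d a ha =>
    simp only [D.vertexOp_apply ha]
    exact D.creation_field ha
  | h2 x y hx hy =>
    intro v'
    simpa only [map_add, LinearMap.add_apply, incl_add] using (hx v').add (hy v')

lemma dcoeff_vertexOp (u v : Total V) (v' : GradedDual V) {z : ℂ} (hz : z ≠ 0) :
    dcoeff (fun x => D.vertexOp x u v) v' z = pair v' (D.vertexOp z (L u) v) := by
  induction u using D.field_induction with
  | h0 => rw [dcoeff_zero]; simp
  | h1 d a ha =>
    rw [D.L_field ha, D.vertexOp_apply (D.isField_deriv ha)]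
    simp only [D.vertexOp_apply ha]
    exact (dcoeff_evalAt ha.homog v v' hz).deriv
  | h2 x y hx hy =>
    rw [D.dcoeff_add x y v v' hz, hx, hy]
    simp

lemma L_bracket (u v : Total V) (v' : GradedDual V) {z : ℂ} (hz : z ≠ 0) :
    HasSum (fun k : ℤ => pair v' (incl (L (comp k (D.vertexOp z u v)))))
      (dcoeff (fun x => D.vertexOp x u v) v' z + pair v' (D.vertexOp z u (L v))) := by
  have h := hasSum_extend D.isHomogOp_L (D.vertexOp z u v) v'
  have e : pair v' (extend 2 L (D.vertexOp z u v)) =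
      dcoeff (fun x => D.vertexOp x u v) v' z + pair v' (D.vertexOp z u (L v)) := by
    rw [D.dcoeff_vertexOp u v v' hz]
    clear h
    induction u using D.field_induction with
    | h0 => simp
    | h1 d a ha =>
      rw [D.L_field ha, D.vertexOp_apply (D.isField_deriv ha), D.vertexOp_apply ha]
      -- Moving `L` to the functional turns the left side into a matrix coefficient of the field,
      -- which is compared mode by mode with covariance.
      obtain ⟨w', hw'⟩ := exists_dual_comp D.isHomogOp_L v'
      rw [← hw']
      refine (hasSum_evalAt ha.homog z v w').unique ?_
      refine ((hasSum_evalAt (isHomog_derivModes ha.homog) z v v').add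
        (hasSum_evalAt ha.homog z (L v) v')).of_eq fun n => ?_
      rw [hw', extend_incl D.isHomogOp_L, sub_eq_iff_eq_add.1 (ha.covariant n v), incl_add, map_add,
        add_mul]
      rfl
    | h2 x y hx hy =>
      simp only [map_add, LinearMap.add_apply]
      rw [hx, hy]
      ring
  rwa [e] at h

lemma translation_creation (u : Total V) (v' : GradedDual V) :
    Tendsto (dcoeff (fun x => D.vertexOp x u (vacuum vac)) v') (𝓝[≠] 0) (𝓝 (pair v' (incl (L u)))) := by
  refine (D.creation (L u) v').congr' ?_
  filter_upwards [self_mem_nhdsWithin] with z hz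
  exact (D.dcoeff_vertexOp u _ v' hz).symm

end IsFormalData

end VertexOperators

/-! ### Duality -/

section Duality

/-- Three families of series that converge to a common rational function. -/
def IsDual (A B C : ℂ → ℂ → ℤ → ℂ) : Prop :=
  ∃ (P : MvPolynomial (Fin 2) ℂ) (N : ℕ),
    (∀ z₁ z₂ : ℂ, ‖z₂‖ < ‖z₁‖ → 0 < ‖z₂‖ → HasSum (A z₁ z₂) (ratFun P N ![z₁, z₂])) ∧
    (∀ z₁ z₂ : ℂ, ‖z₁‖ < ‖z₂‖ → 0 < ‖z₁‖ → HasSum (B z₁ z₂) (ratFun P N ![z₁, z₂])) ∧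
    (∀ z₁ z₂ : ℂ, ‖z₁ - z₂‖ < ‖z₂‖ → 0 < ‖z₁ - z₂‖ → HasSum (C z₁ z₂) (ratFun P N ![z₁, z₂]))

lemma good_pair {z₁ z₂ : ℂ} (h₁ : z₁ ≠ 0) (h₂ : z₂ ≠ 0) (h : z₁ ≠ z₂) :
    Good (![z₁, z₂] : Fin 2 → ℂ) := by
  refine ⟨fun i => by fin_cases i <;> assumption, fun i j hij => ?_⟩
  fin_cases i <;> fin_cases j <;> simp_all

lemma good_pair₁ {z₁ z₂ : ℂ} (h : ‖z₂‖ < ‖z₁‖) (h' : 0 < ‖z₂‖) : Good (![z₁, z₂] : Fin 2 → ℂ) :=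
  good_pair (norm_pos_iff.1 (h'.trans h)) (norm_pos_iff.1 h') (by rintro rfl; exact lt_irrefl _ h)

lemma good_pair₂ {z₁ z₂ : ℂ} (h : ‖z₁‖ < ‖z₂‖) (h' : 0 < ‖z₁‖) : Good (![z₁, z₂] : Fin 2 → ℂ) :=
  good_pair (norm_pos_iff.1 h') (norm_pos_iff.1 (h'.trans h)) (by rintro rfl; exact lt_irrefl _ h)

lemma good_pair₃ {z₁ z₂ : ℂ} (h : ‖z₁ - z₂‖ < ‖z₂‖) (h' : 0 < ‖z₁ - z₂‖) :
    Good (![z₁, z₂] : Fin 2 → ℂ) :=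
  good_pair (by rintro rfl; simp at h) (norm_pos_iff.1 (h'.trans h))
    (sub_ne_zero.1 (norm_pos_iff.1 h'))

lemma exists_ratFun_add {k : ℕ} (P P' : MvPolynomial (Fin k) ℂ) (N N' : ℕ) :
    ∃ P'' N'', ∀ z, Good z → ratFun P'' N'' z = ratFun P N z + ratFun P' N' z := by
  set E : MvPolynomial (Fin k) ℂ := (∏ i, MvPolynomial.X i) * vdm k with hE
  refine ⟨P * E ^ N' + P' * E ^ N, N + N', fun z hz => ?_⟩
  have hev : MvPolynomial.eval z E = (∏ i, z i) * ∏ i, ∏ j ∈ Finset.Ioi i, (z i - z j) := by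
    rw [hE, map_mul, eval_vdm, map_prod]
    simp
  have hne : MvPolynomial.eval z E ≠ 0 := by
    rw [hev, ← eval_vdm]
    exact mul_ne_zero (Finset.prod_ne_zero_iff.2 fun i _ => hz.1 i) hz.eval_vdm_ne
  unfold ratFun
  rw [← hev]
  simp only [map_add, map_mul, map_pow]
  field_simp
  ring

lemma IsDual.add {A B C A' B' C' : ℂ → ℂ → ℤ → ℂ} (h : IsDual A B C) (h' : IsDual A' B' C') :
    IsDual (fun z₁ z₂ k => A z₁ z₂ k + A' z₁ z₂ k) (fun z₁ z₂ k => B z₁ z₂ k + B' z₁ z₂ k)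
      (fun z₁ z₂ k => C z₁ z₂ k + C' z₁ z₂ k) := by
  obtain ⟨P, N, h1, h2, h3⟩ := h
  obtain ⟨P', N', h1', h2', h3'⟩ := h'
  obtain ⟨P'', N'', hP⟩ := exists_ratFun_add P P' N N'
  refine ⟨P'', N'', fun z₁ z₂ a b => ?_, fun z₁ z₂ a b => ?_, fun z₁ z₂ a b => ?_⟩
  · rw [hP _ (good_pair₁ a b)]; exact (h1 _ _ a b).add (h1' _ _ a b)
  · rw [hP _ (good_pair₂ a b)]; exact (h2 _ _ a b).add (h2' _ _ a b)
  · rw [hP _ (good_pair₃ a b)]; exact (h3 _ _ a b).add (h3' _ _ a b)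

lemma isDual_zero : IsDual (fun _ _ _ => 0) (fun _ _ _ => 0) (fun _ _ _ => 0) := by
  have : ∀ z, ratFun (0 : MvPolynomial (Fin 2) ℂ) 0 z = 0 := fun z => by simp [ratFun]
  exact ⟨0, 0, fun _ _ _ _ => by rw [this]; exact hasSum_zero,
    fun _ _ _ _ => by rw [this]; exact hasSum_zero, fun _ _ _ _ => by rw [this]; exact hasSum_zero⟩

variable {V : ℤ → Type u} [∀ k, AddCommGroup (V k)] [∀ k, Module ℂ (V k)] {I : Type v}

/-- Passing from modes to homogeneous components. -/
lemma hasSum_comp_of_modes {e l : ℤ} {b : Modes V} (hb : IsHomog e b) {z : ℂ} {w : Total V}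
    (hw : ∀ j, j ≠ l → w j = 0) (Λ : Total V →ₗ[ℂ] ℂ) {S : ℂ}
    (h : HasSum (fun q : ℤ => Λ (b q w) * z ^ (-q - 1)) S) :
    HasSum (fun k : ℤ => Λ (comp k (evalAt e b z w))) S := by
  have hinj : Function.Injective fun q : ℤ => l + e - 2 * q - 2 := fun q q' h => by
    simp only at h; omega
  rw [eq_ofDeg_of_forall hw] at h ⊢
  generalize w l = x at h ⊢
  refine (hinj.hasSum_iff fun k hk => ?_).1 (h.of_eq fun q => ?_)
  · have : comp k (evalAt e b z (ofDeg l x)) = 0 := by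
      rw [comp, evalAt_ofDeg, if_neg, map_zero]
      rintro ⟨m, hm⟩
      exact hk ⟨m - 1, by simp only; omega⟩
    rw [this, map_zero]
  · have he : Even (e + l - (l + e - 2 * q - 2)) := ⟨q + 1, by ring⟩
    simp only [Function.comp_apply]
    rw [comp, evalAt_ofDeg, if_pos he, show (e + l - (l + e - 2 * q - 2)) / 2 = q + 1 by omega,
      map_smul, map_smul, smul_eq_mul, mul_comm, neg_add', add_sub_cancel_right]
    have h1 : ∀ j, j ≠ l + e - 2 * q - 2 → b q (ofDeg l x) j = 0 := fun j hj =>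
      hb q l x j (by omega)
    rw [← eq_ofDeg_of_forall h1]

lemma ratEval_one {d : ℤ} {a : Modes V} (ha : IsHomog d a) (v' : GradedDual V) (v : Total V)
    {c : Fin 0 → Modes V} (h : IsRational (vdm 1) (coeffs v' v (snocM c a))) {z : ℂ} (hz : z ≠ 0) :
    ratEval (vdm 1) (coeffs v' v (snocM c a)) (fun _ => z) = pair v' (evalAt d a z v) := by
  have h1 := hasSum_ratEval h (fun i j hij => absurd (Subsingleton.elim i j) hij.ne)
    (z := fun _ => z) (fun _ => hz) (fun i j hij => absurd (Subsingleton.elim i j) hij.ne)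
  refine HasSum.unique ((Equiv.hasSum_iff (Equiv.funUnique (Fin 1) ℤ).symm).2 h1)
    ((hasSum_evalAt ha z v v').of_eq fun n => ?_)
  simp only [Function.comp_apply]
  rw [coeffs_snoc]
  simp [prodL, mon]

variable {vac : V 0} {M : I → Modes V} {wt : I → ℤ} {L : Module.End ℂ (Total V)}

lemma coeffs_two (v' : GradedDual V) (v : Total V) (a b : Modes V) (c : Fin 0 → Modes V)
    (n : Fin 2 → ℤ) : coeffs v' v (snocM (snocM c a) b) n = pair v' (incl (a (n 0) (b (n 1) v))) := by
  have h1 : n = split (r := 0) (fun _ => 0) (n 0) (n 1) := by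
    funext i
    fin_cases i
    · exact (split_penult (r := 0) (fun _ => (0 : ℤ)) (n 0) (n 1)).symm
    · exact (split_last (r := 0) (fun _ => (0 : ℤ)) (n 0) (n 1)).symm
  have h2 := coeffs_snoc_split (r := 0) v' v c a b (fun _ => 0) (n 0) (n 1)
  rw [← h1] at h2
  rw [h2]
  simp [prodL]

/-- The series of a product of two fields, summed over the modes of the second factor. -/
lemma hasSum_two {d : ℤ} {a b : Modes V} (ha : IsHomog d a) (v' : GradedDual V)
    (v : Total V) {c : Fin 0 → Modes V} {z₁ z₂ S : ℂ}
    (h : HasSum (fun n => coeffs v' v (snocM (snocM c a) b) n * mon ![z₁, z₂] n) S) :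
    HasSum (fun q : ℤ => pair v' (evalAt d a z₁ (b q v)) * z₂ ^ (-q - 1)) S := by
  have h0 := (Equiv.hasSum_iff (((finTwoArrowEquiv ℤ).trans (Equiv.prodComm ℤ ℤ)).symm)).2 h
  have e : ∀ x : ℤ × ℤ, pair v' (incl (a x.2 (b x.1 v))) * z₁ ^ (-x.2 - 1) * z₂ ^ (-x.1 - 1) =
      ((fun n => coeffs v' v (snocM (snocM c a) b) n * mon ![z₁, z₂] n) ∘
        ((finTwoArrowEquiv ℤ).trans (Equiv.prodComm ℤ ℤ)).symm) x := by
    intro x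
    simp only [Function.comp_apply]
    rw [coeffs_two]
    simp [mon, Fin.prod_univ_two, mul_assoc]
  have h1 := h0.of_eq e
  have h2 : ∀ q : ℤ, HasSum (fun p : ℤ => pair v' (incl (a p (b q v))) * z₁ ^ (-p - 1) *
      z₂ ^ (-q - 1)) (pair v' (evalAt d a z₁ (b q v)) * z₂ ^ (-q - 1)) := by
    intro q
    have h3 := hasSum_evalAt ha z₁ (b q v) v'
    have h4 := h3.mul_right (z₂ ^ (-q - 1))
    exact h4
  have h5 := h1.prod_fiberwise h2
  exact h5

lemma laurentEval_swap (g : (Fin 2 → ℤ) → ℂ) (z₁ z₂ : ℂ) :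
    laurentEval (fun n => g ![n 1, n 0]) ![z₁, z₂] = laurentEval g ![z₂, z₁] := by
  unfold laurentEval
  let σ : (Fin 2 → ℤ) → (Fin 2 → ℤ) := fun n => ![n 1, n 0]
  have hσ : Function.Involutive σ := fun n => by
    funext i
    fin_cases i <;> rfl
  refine finsum_eq_of_bijective σ hσ.bijective fun n => ?_
  simp [mon, σ, Fin.prod_univ_two, mul_comm]

/-- Locality as a symmetry of the correlation function. -/
lemma ratEval_swap {a b : Modes V} {s : ℂ} (hab : IsLocal s a b) (v' : GradedDual V) (v : Total V)
    {c : Fin 0 → Modes V} (h : IsRational (vdm 2) (coeffs v' v (snocM (snocM c a) b)))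
    (h' : IsRational (vdm 2) (coeffs v' v (snocM (snocM c b) a))) {z₁ z₂ : ℂ}
    (hz : Good (![z₁, z₂] : Fin 2 → ℂ)) :
    ratEval (vdm 2) (coeffs v' v (snocM (snocM c a) b)) ![z₁, z₂] =
      s * ratEval (vdm 2) (coeffs v' v (snocM (snocM c b) a)) ![z₂, z₁] := by
  obtain ⟨m, hm, hm'⟩ : ∃ m, (Function.support (act (vdm 2 ^ m)
      (coeffs v' v (snocM (snocM c a) b)))).Finite ∧ (Function.support (act (vdm 2 ^ m)
      (coeffs v' v (snocM (snocM c b) a)))).Finite := h.exists_common h'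
  obtain ⟨N, hmN, hN⟩ := hab.exists_le m
  have hfin : ∀ f : (Fin 2 → ℤ) → ℂ, (Function.support (act (vdm 2 ^ m) f)).Finite →
      (Function.support (act (vdm 2 ^ N) f)).Finite := fun f hf => by
    obtain ⟨k, rfl⟩ := Nat.exists_eq_add_of_le' hmN
    rw [pow_add, act_mul]; exact finite_support_act hf _
  have hz' : Good (![z₂, z₁] : Fin 2 → ℂ) :=
    good_pair (hz.1 1) (hz.1 0) fun h => by
      have := @hz.2 0 1 (by simpa using h.symm)
      exact absurd this (by decide)
  have e : ∀ (a b : Modes V) (n : Fin 2 → ℤ), act (vdm 2 ^ N) (coeffs v' v (snocM (snocM c a) b)) n =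
      mulDiff^[N] (fun p q => pair v' (incl (a p (b q v)))) (n 0) (n 1) := by
    intro a b n
    rw [vdm_two, act_sub_pow (by decide)]
    refine congrFun (congrFun (congrArg _ ?_) _) _
    funext p q
    rw [coeffs_two]
    simp
  -- The sign `(-1)^N` from exchanging the variables in `(z₁ - z₂)^N` cancels later against the same
  -- sign in the denominator.
  have e2 : act (vdm 2 ^ N) (coeffs v' v (snocM (snocM c a) b)) =
      (s * (-1) ^ N) • fun n : Fin 2 → ℤ =>
        act (vdm 2 ^ N) (coeffs v' v (snocM (snocM c b) a)) ![n 1, n 0] := by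
    funext n
    have h1 := mulDiff_iterate_map ((pair v' ∘ₗ inclL).toAddMonoidHom) N fun p q => a p (b q v)
    have h2 := mulDiff_iterate_map ((pair v' ∘ₗ inclL).toAddMonoidHom) N fun p q => s • b q (a p v)
    rw [hN v] at h1
    have h3 := mulDiff_iterate_smul N s fun p q => pair v' (incl (b q (a p v)))
    have h4 := mulDiff_iterate_swap N fun p q => pair v' (incl (b p (a q v)))
    rw [Pi.smul_apply, e, e]
    have h5 : mulDiff^[N] (fun p q => pair v' (incl (a p (b q v)))) =
        mulDiff^[N] (fun p q => s • pair v' (incl (b q (a p v)))) := by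
      refine h1.trans (h2.symm.trans (congrArg _ ?_))
      funext p q
      exact (pair v' ∘ₗ inclL).map_smul s _
    rw [h5, h3, h4]
    simp [mul_assoc]
  rw [ratEval_eq_div h hz.1 hz.eval_vdm_ne (hfin _ hm) (by
      rw [map_pow]; exact pow_ne_zero _ hz.eval_vdm_ne),
    ratEval_eq_div h' hz'.1 hz'.eval_vdm_ne (hfin _ hm') (by
      rw [map_pow]; exact pow_ne_zero _ hz'.eval_vdm_ne), e2, laurentEval_smul, laurentEval_swap]
  have h6 : z₁ - z₂ ≠ 0 := by simpa [vdm_two] using hz.eval_vdm_ne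
  have h7 : z₂ - z₁ ≠ 0 := by simpa [vdm_two] using hz'.eval_vdm_ne
  have h8 : MvPolynomial.eval ![z₁, z₂] (vdm 2 ^ N) = (-1) ^ N * (z₂ - z₁) ^ N := by
    rw [vdm_two, ← mul_pow]; simp
  have h9 : MvPolynomial.eval ![z₂, z₁] (vdm 2 ^ N) = (z₂ - z₁) ^ N := by
    rw [vdm_two]; simp
  rw [h8, h9]
  have h10 : ((-1 : ℂ)) ^ N ≠ 0 := pow_ne_zero _ (by norm_num)
  have h11 : (z₂ - z₁) ^ N ≠ 0 := pow_ne_zero _ h7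
  field_simp

namespace IsFormalData

variable (D : IsFormalData vac M wt L)
include D

/-- All three series expand one correlation function: directly for `|z₁| > |z₂|`, through its
symmetry for `|z₂| > |z₁|`, and through the two-field operator product expansion near `z₁ = z₂`.
There the `m`-th coefficient is the vertex operator of `a_m b_{-1} 1`. -/
lemma isDual_fields {d e l : ℤ} {a b : Modes V} (ha : IsField M wt L d a) (hb : IsField M wt L e b)
    (x : V l) (v' : GradedDual V) : IsDual
      (fun z₁ z₂ k => pair v' (evalAt d a z₁ (comp k (evalAt e b z₂ (ofDeg l x)))))
      (fun z₁ z₂ k => sg d e * pair v' (evalAt e b z₂ (comp k (evalAt d a z₁ (ofDeg l x)))))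
      (fun z₁ z₂ k => pair v' (D.vertexOp z₂
        (comp k (evalAt d a (z₁ - z₂) (b (-1) (vacuum vac)))) (ofDeg l x))) := by
  set v := ofDeg l x with hv
  let c : Fin 0 → Modes V := fun i => i.elim0
  have hc : ∀ i, IsSomeField M wt L (c i) := fun i => i.elim0
  have hab := D.isLocal_fields ha hb
  have hcab := D.isSomeField_snoc (D.isSomeField_snoc hc ⟨d, ha⟩) ⟨e, hb⟩
  have hcba := D.isSomeField_snoc (D.isSomeField_snoc hc ⟨e, hb⟩) ⟨d, ha⟩
  have h1 := D.isRational_coeffs hcab v' v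
  have h2 := D.isRational_coeffs hcba v' v
  have hw : ∀ j, j ≠ l → v j = 0 := fun j hj => ofDeg_ne x hj
  obtain ⟨P, N, hP⟩ := exists_ratFun h1
  have hanti : ∀ z₁ z₂ : ℂ, ‖z₂‖ < ‖z₁‖ → StrictAnti fun i => ‖(![z₁, z₂] : Fin 2 → ℂ) i‖ := by
    intro z₁ z₂ h
    refine Fin.strictAnti_iff_succ_lt.2 fun i => ?_
    fin_cases i
    exact h
  refine ⟨P, N, fun z₁ z₂ hlt hpos => ?_, fun z₁ z₂ hlt hpos => ?_, fun z₁ z₂ hlt hpos => ?_⟩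
  · have hg := good_pair₁ hlt hpos
    rw [hP _ hg]
    exact hasSum_comp_of_modes hb.homog hw (pair v' ∘ₗ evalAt d a z₁)
      (hasSum_two ha.homog v' v (D.hasSum_coeffs hcab v' v hg.1 (hanti _ _ hlt)))
  · have hg := good_pair₂ hlt hpos
    have hg' := good_pair₁ hlt hpos
    rw [hP _ hg, ratEval_swap hab v' v h1 h2 hg]
    exact (hasSum_comp_of_modes ha.homog hw (pair v' ∘ₗ evalAt e b z₂)
      (hasSum_two hb.homog v' v (D.hasSum_coeffs hcba v' v hg'.1 (hanti _ _ hlt)))).mul_left _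
  · have hg := good_pair₃ hlt hpos
    rw [hP _ hg]
    have h3 := hasSum_ope_two (D.isTrunc ha) (D.isTrunc hb) v' v hab h1 (norm_pos_iff.1 hpos) hlt
    rw [add_sub_cancel] at h3
    refine hasSum_comp_of_modes ha.homog (D.field_vacuum hb)
      (pair v' ∘ₗ (LinearMap.flip (D.vertexOp z₂) v)) (h3.of_eq fun m => ?_)
    have hab' := D.isField_nprod ha hb hab m
    rw [ratEval_one hab'.homog v' v (D.isRational_coeffs (D.isSomeField_snoc hc ⟨_, hab'⟩) v' v)
      (norm_pos_iff.1 (hpos.trans hlt)), ← D.vertexOp_apply hab', D.nprod_vacuum ha hb]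
    rfl

lemma duality (p q : ZMod 2) (u₁ : Total V) (h₁ : u₁ ∈ parityPart V p) (u₂ : Total V)
    (h₂ : u₂ ∈ parityPart V q) (v : Total V) (v' : GradedDual V) : IsDual
      (fun z₁ z₂ k => pair v' (D.vertexOp z₁ u₁ (comp k (D.vertexOp z₂ u₂ v))))
      (fun z₁ z₂ k => sign p q * pair v' (D.vertexOp z₂ u₂ (comp k (D.vertexOp z₁ u₁ v))))
      (fun z₁ z₂ k => pair v' (D.vertexOp z₂ (comp k (D.vertexOp (z₁ - z₂) u₁ u₂)) v)) := by
  refine parityPart_induction (p := fun u₁ => IsDual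
      (fun z₁ z₂ k => pair v' (D.vertexOp z₁ u₁ (comp k (D.vertexOp z₂ u₂ v))))
      (fun z₁ z₂ k => sign p q * pair v' (D.vertexOp z₂ u₂ (comp k (D.vertexOp z₁ u₁ v))))
      (fun z₁ z₂ k => pair v' (D.vertexOp z₂ (comp k (D.vertexOp (z₁ - z₂) u₁ u₂)) v))) u₁ h₁ ?_ ?_ ?_
  · simpa [comp_zero] using isDual_zero
  · intro d hd x₁
    refine parityPart_induction (p := fun u₂ => IsDual
      (fun z₁ z₂ k => pair v' (D.vertexOp z₁ (ofDeg d x₁) (comp k (D.vertexOp z₂ u₂ v))))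
      (fun z₁ z₂ k => sign p q *
        pair v' (D.vertexOp z₂ u₂ (comp k (D.vertexOp z₁ (ofDeg d x₁) v))))
      (fun z₁ z₂ k => pair v' (D.vertexOp z₂ (comp k (D.vertexOp (z₁ - z₂) (ofDeg d x₁) u₂)) v)))
      u₂ h₂ ?_ ?_ ?_
    · simpa [comp_zero] using isDual_zero
    · intro e he x₂
      obtain ⟨a, ha, hx₁⟩ := D.exists_field x₁
      obtain ⟨b, hb, hx₂⟩ := D.exists_field x₂
      rw [← hx₁, ← hx₂, ← hd, ← he, sg_parity]
      simp only [D.vertexOp_apply ha, D.vertexOp_apply hb]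
      induction v using total_induction with
      | h0 => simpa [comp_zero] using isDual_zero
      | h1 l x => exact D.isDual_fields ha hb x v'
      | h2 x y hx hy => simpa only [map_add, comp_add, LinearMap.add_apply, mul_add] using hx.add hy
    · intro x y hx hy
      simpa only [map_add, comp_add, LinearMap.add_apply, mul_add] using hx.add hy
  · intro x y hx hy
    simpa only [map_add, comp_add, LinearMap.add_apply, mul_add] using hx.add hy

lemma isVertexSuperalgebra (hfin : ∀ k, Module.Finite ℂ (V k)) :
    IsVertexSuperalgebra vac D.vertexOp where
  analytic := D.analytic
  lower_bounded := D.lower_bounded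
  finite_dim := hfin
  weight_bracket u v v' z hz := D.weight_bracket u v v' hz
  identity v z _ := D.identity v z
  creation := D.creation
  translation := ⟨L, D.translation_creation, fun u v v' z hz =>
    ⟨D.dcoeff_vertexOp u v v' hz, D.L_bracket u v v' hz⟩⟩
  duality := D.duality

end IsFormalData

end Duality

/-! ### The Jacobi-residue description -/

section Jacobi

variable {V : ℤ → Type u} [∀ k, AddCommGroup (V k)] [∀ k, Module ℂ (V k)] {I : Type v}

/-- Very negative modes raise every weight above those seen by `v'`; the bound is uniform in `w`
since the grading is bounded below. -/
lemma IsHomog.exists_coeff_eq_zero {d : ℤ} {a : Modes V} (h : IsHomog d a) {k₀ : ℤ}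
    (hk : ∀ k < k₀, Subsingleton (V k)) (v' : GradedDual V) :
    ∃ K : ℤ, ∀ m ≤ K, ∀ w, pair v' (incl (a m w)) = 0 := by
  induction v' using gradedDual_induction with
  | h0 => exact ⟨0, by simp⟩
  | h2 x y hx hy =>
    obtain ⟨K, hK⟩ := hx
    obtain ⟨K', hK'⟩ := hy
    refine ⟨min K K', fun m hm w => ?_⟩
    rw [map_add, LinearMap.add_apply, hK m (by omega) w, hK' m (by omega) w, add_zero]
  | h1 k f =>
    refine ⟨-(|k| + |d| + |k₀| + 2), fun m hm w => ?_⟩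
    induction w using total_induction with
    | h0 => simp
    | h2 x y hx hy => rw [map_add, incl_add, map_add, hx, hy, add_zero]
    | h1 l x =>
      rw [pair_dualOf]
      have h0 : incl (a m (ofDeg l x)) k = 0 := by
        by_cases hl : k = l + (d - 2 * m - 2)
        · have := hk l (by
            have h1 := neg_abs_le k
            have h2 := le_abs_self k
            have h3 := neg_abs_le d
            have h4 := neg_abs_le k₀
            have h5 := abs_nonneg k₀
            have h6 := abs_nonneg k
            have h7 := abs_nonneg d
            omega)
          rw [Subsingleton.elim x 0]
          simp
        · exact h m l x k hl
      rw [h0, map_zero]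

/-- The residue of the Jacobi identity for fields. -/
lemma hasSum_nprod {d e : ℤ} {a b : Modes V} (hda : IsHomog d a) (hdb : IsHomog e b)
    {k₀ : ℤ} (hk : ∀ k < k₀, Subsingleton (V k)) (ha : IsTrunc a) (hb : IsTrunc b) (s : ℂ) (n : ℤ)
    (v : Total V) (v' : GradedDual V) {z : ℂ} (hz : z ≠ 0) :
    HasSum (fun j : ℕ => (Ring.choose n j : ℂ) *
        ((-z) ^ j * pair v' (extend (d - 2 * (n - j) - 2) (a (n - j)) (evalAt e b z v))
          - s * ((-z) ^ (n - j) * pair v' (evalAt e b z (a j v)))))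
      (pair v' (evalAt (d + e - 2 * n - 2) (nprod s ha hb n) z v)) := by
  obtain ⟨K₁, hK₁⟩ := hda.exists_coeff_eq_zero hk v'
  obtain ⟨K₂, hK₂⟩ := ha v
  -- Beyond `K` the first terms vanish by the choice of `v'` and the second ones by truncation on
  -- `v`, so the sum over `j` is finite and may be exchanged with the sum over modes.
  obtain ⟨K, h1, h2⟩ : ∃ K : ℕ, (∀ j : ℕ, K ≤ j → ∀ w, pair v' (incl (a (n - j) w)) = 0) ∧
      ∀ j : ℕ, K ≤ j → a j v = 0 := by
    refine ⟨(|K₁| + |K₂| + |n|).toNat, fun j hj w => hK₁ _ ?_ w, fun j hj => hK₂ _ ?_⟩ <;>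
    · have a1 := neg_abs_le K₁
      have a2 := le_abs_self K₂
      have a3 := le_abs_self n
      have a4 := abs_nonneg K₁
      have a5 := abs_nonneg K₂
      have a6 := abs_nonneg n
      omega
  have hext : ∀ j : ℕ, ∃ w' : GradedDual V, ∀ w,
      pair w' w = pair v' (extend (d - 2 * (n - j) - 2) (a (n - j)) w) := fun j =>
    exists_dual_comp (hda _) v'
  choose w' hw' using hext
  have hw'i : ∀ (j : ℕ) w, pair (w' j) (incl w) = pair v' (incl (a (n - j) w)) := fun j w => by
    rw [hw', extend_incl (hda _)]
  have hzero : ∀ j ∉ Finset.range K, (Ring.choose n j : ℂ) *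
        ((-z) ^ j * pair v' (extend (d - 2 * (n - j) - 2) (a (n - j)) (evalAt e b z v))
          - s * ((-z) ^ (n - (j : ℤ)) * pair v' (evalAt e b z (a j v)))) = 0 := by
    intro j hj
    rw [Finset.mem_range, not_lt] at hj
    have e1 : pair v' (extend (d - 2 * (n - j) - 2) (a (n - j)) (evalAt e b z v)) = 0 := by
      refine (hasSum_extend (hda _) _ v').unique ?_
      exact hasSum_zero.of_eq fun k => h1 j hj _
    rw [e1, h2 j hj]
    simp
  suffices hs : pair v' (evalAt (d + e - 2 * n - 2) (nprod s ha hb n) z v) =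
      ∑ j ∈ Finset.range K, (Ring.choose n j : ℂ) *
        ((-z) ^ j * pair v' (extend (d - 2 * (n - j) - 2) (a (n - j)) (evalAt e b z v))
          - s * ((-z) ^ (n - (j : ℤ)) * pair v' (evalAt e b z (a j v)))) by
    rw [hs]; exact hasSum_sum_of_ne_finset_zero hzero
  -- The mode indices are shifted by `j` and by `n - j`, so that the powers of `-z` are absorbed and
  -- all terms are series in `z ^ (-q-1)`.
  have hterm : ∀ j ∈ Finset.range K, HasSum (fun q : ℤ => (Ring.choose (n : ℂ) j) *
      ((-1) ^ j * pair v' (incl (a (n - j) (b (q + j) v))) -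
        (-1) ^ (n - (j : ℤ)) * (s * pair v' (incl (b (n + q - j) (a j v))))) * z ^ (-q - 1))
      ((Ring.choose n j : ℂ) *
        ((-z) ^ j * pair v' (extend (d - 2 * (n - j) - 2) (a (n - j)) (evalAt e b z v))
          - s * ((-z) ^ (n - (j : ℤ)) * pair v' (evalAt e b z (a j v))))) := by
    intro j _
    have a1 := hasSum_evalAt hdb z v (w' j)
    have a2 := (Equiv.hasSum_iff (Equiv.addRight (j : ℤ))).2 a1
    have a3 := a2.mul_left ((-z) ^ j)
    have b1 := hasSum_evalAt hdb z (a j v) v'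
    have b2 := (Equiv.hasSum_iff (Equiv.addRight (n - (j : ℤ)))).2 b1
    have b3 := (b2.mul_left ((-z) ^ (n - (j : ℤ)))).mul_left s
    have c1 := (a3.sub b3).mul_left (Ring.choose n j : ℂ)
    rw [hw'] at c1
    refine c1.of_eq fun q => ?_
    simp only [Function.comp_apply, Equiv.coe_addRight, hw'i]
    have p1 : (-z) ^ j * z ^ (-(q + j) - 1) = (-1) ^ j * z ^ (-q - 1) := by
      rw [neg_pow, mul_assoc, ← zpow_natCast z j, ← zpow_add₀ hz]
      congr 2; ring
    have p2 : (-z) ^ (n - (j : ℤ)) * z ^ (-(q + (n - j)) - 1) =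
        (-1) ^ (n - (j : ℤ)) * z ^ (-q - 1) := by
      rw [show -z = -1 * z by ring, mul_zpow, mul_assoc, ← zpow_add₀ hz]
      congr 2; ring
    rw [show q + (n - (j : ℤ)) = n + q - j by ring] at p2 ⊢
    have p3 : (Ring.choose (n : ℂ) j) = ((Ring.choose n j : ℤ) : ℂ) :=
      (Ring.map_choose (Int.castRingHom ℂ) n j).symm
    rw [p3]
    linear_combination -((Ring.choose n j : ℤ) : ℂ) * pair v' (incl (a (n - j) (b (q + j) v))) * p1
      + ((Ring.choose n j : ℤ) : ℂ) * s * pair v' (incl (b (n + q - j) (a j v))) * p2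
  have hsum := hasSum_sum hterm
  refine (hasSum_evalAt (isHomog_nprod hda hdb s ha hb n) z v v').unique (hsum.of_eq fun q => ?_)
  have hmap := map_resCoeff (pair v' ∘ₗ inclL) (truncated_products ha hb s v) n q
  have hmap' : pair v' (incl (nprod s ha hb n q v)) = _ := hmap
  rw [hmap', resCoeff_eq_sum (K := K), Finset.sum_mul]
  · refine Finset.sum_congr rfl fun j _ => ?_
    simp only [resTerm, LinearMap.comp_apply, map_smul, smul_eq_mul]
    rfl
  · intro j hj
    have e1 : pair v' (incl (a (n - j) (b (q + j) v))) = 0 := h1 j hj _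
    simp only [resTerm, LinearMap.comp_apply, map_smul, smul_eq_mul, h2 j hj, map_zero, mul_zero,
      sub_zero]
    erw [e1]
    simp

variable {vac : V 0} {φ : I → ℂ → Total V →ₗ[ℂ] Completion V} {wt : I → ℤ}
  {L : Module.End ℂ (Total V)}

lemma IsFormalData.wordM_mem_parityPart {M : I → Modes V} (D : IsFormalData vac M wt L)
    (l : List (I × ℤ)) : wordM M l (vacuum vac) ∈ parityPart V (wordDeg wt l : ZMod 2) := by
  obtain ⟨a, ha, h1, _⟩ := D.exists_field_word l
  rw [← h1, eq_ofDeg_of_forall (D.field_vacuum ha)]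
  exact ofDeg_mem_parityPart _ _

namespace IsGeneratingData

variable (h : IsGeneratingData vac φ wt L)
include h

lemma isJacobiResidueMap : IsJacobiResidueMap vac φ h.isFormalData.vertexOp := by
  set D := h.isFormalData
  obtain ⟨k₀, hk⟩ := h.lower_bounded
  refine ⟨fun v z _ => D.identity v z, fun i n p u hu v v' z hz => ?_⟩
  simp only [h.mode_eq]
  -- For a zero field both sides vanish, so its conventional parity plays no role.
  by_cases hi : modesOf (wt i) (φ i) = 0
  · simp only [hi, Pi.zero_apply, LinearMap.zero_apply, map_zero, incl_zero, tsum_zero, mul_zero,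
      sub_zero]
    exact hasSum_zero
  rw [h.fieldParity_eq hi]
  have hts : ∀ (j : ℕ) (w : Completion V),
      (∑' k : ℤ, pair v' (incl (modesOf (wt i) (φ i) (n - j) (comp k w)))) =
        pair v' (extend (wt i - 2 * (n - j) - 2) (modesOf (wt i) (φ i) (n - j)) w) :=
    fun j w => (hasSum_extend (isHomog_modesOf (wt i) (φ i) _) w v').tsum_eq
  simp only [hts]
  refine parityPart_induction (p := fun u => HasSum (fun j : ℕ => (Ring.choose n j : ℂ) *
        ((-z) ^ j * pair v' (extend (wt i - 2 * (n - j) - 2) (modesOf (wt i) (φ i) (n - j))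
            (D.vertexOp z u v))
          - sign (wt i : ZMod 2) p * ((-z) ^ (n - (j : ℤ)) *
            pair v' (D.vertexOp z u (modesOf (wt i) (φ i) j v)))))
      (pair v' (D.vertexOp z (modesOf (wt i) (φ i) n u) v))) u hu ?_ ?_ ?_
  · simp only [map_zero, LinearMap.zero_apply, mul_zero, sub_zero]
    exact hasSum_zero
  · intro e he x
    obtain ⟨b, hb, hx⟩ := D.exists_field x
    have ha := D.isField_gen i
    rw [← hx, ← he, sg_parity, ← D.nprod_vacuum ha hb (sg (wt i) e) n,
      D.vertexOp_apply (D.isField_nprod ha hb (D.isLocal_fields ha hb) n), D.vertexOp_apply hb]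
    exact hasSum_nprod ha.homog hb.homog hk _ _ _ n v v' hz
  · intro x y hx hy
    simp only [map_add, LinearMap.add_apply]
    exact (hx.add hy).of_eq fun j => by ring

/-- The recursion computes the map on a word from its value on the shorter word, which has a
definite parity; words span. -/
lemma eq_of_isJacobiResidueMap {Y Y' : ℂ → Total V →ₗ[ℂ] Total V →ₗ[ℂ] Completion V}
    (hY : IsJacobiResidueMap vac φ Y) (hY' : IsJacobiResidueMap vac φ Y') {z : ℂ} (hz : z ≠ 0) :
    Y z = Y' z := by
  refine LinearMap.ext_on_range h.isFormalData.spanning fun l => ?_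
  induction l with
  | nil => exact LinearMap.ext fun v => (hY.1 v z hz).trans (hY'.1 v z hz).symm
  | cons p l ih =>
    refine LinearMap.ext fun v => completion_ext fun v' => ?_
    have hmem := h.isFormalData.wordM_mem_parityPart l
    have h1 := hY.2 p.1 p.2 _ _ hmem v v' z hz
    have h2 := hY'.2 p.1 p.2 _ _ hmem v v' z hz
    rw [ih] at h1
    rw [h.mode_eq] at h1 h2
    exact h1.unique h2

end IsGeneratingData

lemma IsJacobiResidueMap.congr {Y Y' : ℂ → Total V →ₗ[ℂ] Total V →ₗ[ℂ] Completion V}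
    (hY : IsJacobiResidueMap vac φ Y) (h : ∀ z, z ≠ 0 → Y' z = Y z) :
    IsJacobiResidueMap vac φ Y' := by
  refine ⟨fun v z hz => by rw [h z hz]; exact hY.1 v z hz, fun i n p a ha v v' z hz => ?_⟩
  rw [h z hz]
  exact hY.2 i n p a ha v v' z hz

end Jacobi

/-! ### The product-residue description -/

section ProductResidues

lemma infinite_annulus {a b : ℝ} (ha : 0 ≤ a) (hab : a < b) : {w : ℂ | a < ‖w‖ ∧ ‖w‖ < b}.Infinite := by
  refine ((Set.Ioo_infinite hab).image (f := fun x : ℝ => (x : ℂ))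
    Complex.ofReal_injective.injOn).mono ?_
  rintro _ ⟨x, hx, rfl⟩
  have : ‖(x : ℂ)‖ = x := by rw [Complex.norm_real, Real.norm_of_nonneg (ha.trans hx.1.le)]
  change a < ‖(x : ℂ)‖ ∧ ‖(x : ℂ)‖ < b
  rw [this]
  exact hx

/-- A rational function is determined by its values for decreasing absolute values. -/
lemma ratFun_unique {k : ℕ} {P P' : MvPolynomial (Fin k) ℂ} {N N' : ℕ}
    (h : ∀ z : Fin k → ℂ, (∀ j, z j ≠ 0) → StrictAnti (fun j => ‖z j‖) →
      ratFun P N z = ratFun P' N' z) {z : Fin k → ℂ} (hz : Good z) :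
    ratFun P N z = ratFun P' N' z := by
  set E : MvPolynomial (Fin k) ℂ := (∏ i, MvPolynomial.X i) * vdm k with hE
  have hev : ∀ z : Fin k → ℂ, MvPolynomial.eval z E =
      (∏ i, z i) * ∏ i, ∏ j ∈ Finset.Ioi i, (z i - z j) := fun z => by
    rw [hE, map_mul, eval_vdm, map_prod]
    simp
  have hne : ∀ {z : Fin k → ℂ}, Good z → MvPolynomial.eval z E ≠ 0 := fun {z} hz => by
    rw [hev, ← eval_vdm]
    exact mul_ne_zero (Finset.prod_ne_zero_iff.2 fun i _ => hz.1 i) hz.eval_vdm_ne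
  have key : P * E ^ N' = P' * E ^ N := by
    -- Polynomials that agree on a product of infinite sets are equal. The disjoint annuli, with
    -- radii decreasing in `i`, give such a product inside the domain of the hypothesis.
    refine MvPolynomial.funext_set
      (fun i : Fin k => {w : ℂ | (k : ℝ) - i < ‖w‖ ∧ ‖w‖ < (k : ℝ) - i + 1}) (fun i => ?_)
      fun x hx => ?_
    · refine infinite_annulus ?_ (by linarith)
      have : ((i : ℕ) : ℝ) ≤ k := by exact_mod_cast i.2.le
      linarith
    · have hx' : ∀ i : Fin k, (k : ℝ) - i < ‖x i‖ ∧ ‖x i‖ < (k : ℝ) - i + 1 := fun i =>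
        hx i (Set.mem_univ i)
      have h0 : ∀ i, x i ≠ 0 := fun i => norm_pos_iff.1 (by
        have : ((i : ℕ) : ℝ) ≤ k := by exact_mod_cast i.2.le
        linarith [(hx' i).1])
      have hanti : StrictAnti fun i => ‖x i‖ := fun i j hij => by
        have h1 : ((i : ℕ) : ℝ) + 1 ≤ (j : ℕ) := by exact_mod_cast hij
        have h2 := (hx' i).1
        have h3 := (hx' j).2
        change ‖x j‖ < ‖x i‖
        linarith
      have hg : Good x := ⟨h0, fun i j hij => hanti.injective (congrArg norm hij)⟩
      have h1 := h x h0 hanti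
      have h2 := hne hg
      unfold ratFun at h1
      rw [← hev, div_eq_div_iff (pow_ne_zero _ h2) (pow_ne_zero _ h2)] at h1
      simpa only [map_mul, map_pow] using h1
  have h2 := hne hz
  unfold ratFun
  rw [← hev, div_eq_div_iff (pow_ne_zero _ h2) (pow_ne_zero _ h2)]
  simpa only [map_mul, map_pow] using congrArg (MvPolynomial.eval z) key

lemma good_add {k : ℕ} {z : ℂ} {ξ : Fin k → ℂ} (h0 : ∀ j, ξ j ≠ 0) (hlt : ∀ j, ‖ξ j‖ < ‖z‖)
    (hanti : StrictAnti fun j => ‖ξ j‖) : Good (fun j => ξ j + z) ∧ ∀ j, ξ j + z ≠ z := by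
  refine ⟨⟨fun j hj => ?_, fun i j hij => ?_⟩, fun j hj => h0 j (by simpa using hj)⟩
  · have h1 : ‖ξ j‖ = ‖z‖ := by rw [eq_neg_of_add_eq_zero_left hj, norm_neg]
    exact (hlt j).ne h1
  · exact hanti.injective (congrArg norm (add_right_cancel hij))

variable {V : ℤ → Type u} [∀ k, AddCommGroup (V k)] [∀ k, Module ℂ (V k)] {I : Type v}
variable {vac : V 0} {φ : I → ℂ → Total V →ₗ[ℂ] Completion V} {wt : I → ℤ}
  {L : Module.End ℂ (Total V)}

lemma wordM_ofFn (M : I → Modes V) {k : ℕ} (i : Fin k → I) (n : Fin k → ℤ) (v : Total V) :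
    wordM M (List.ofFn fun j => (i j, n j)) v =
      prodL (fun j => M (i j)) (List.finRange k) n v := by
  have h : ∀ l : List (Fin k), wordM M (l.map fun j => (i j, n j)) v =
      prodL (fun j => M (i j)) l n v := by
    intro l
    induction l with
    | nil => simp [wordM, prodL]
    | cons j l ih =>
      rw [prodL_cons, Module.End.mul_apply, ← ih]
      rfl
  rw [← h, List.ofFn_eq_map]

/-- The vertex operator of a word as a residue of a correlation function. -/
lemma IsFormalData.vertexOp_prodL {M : I → Modes V} (D : IsFormalData vac M wt L) {k : ℕ}
    {c : Fin k → Modes V} (hc : ∀ i, IsSomeField M wt L (c i)) (v' : GradedDual V) (v : Total V)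
    (m : Fin k → ℤ) {z : ℂ} (hz : z ≠ 0) :
    pair v' (D.vertexOp z (prodL c (List.finRange k) m (vacuum vac)) v) =
      iterRes k m fun ξ => ratEval (vdm k) (coeffs v' v c) fun j => ξ j + z := by
  -- The identity field at `z` is the point onto which the fields of the word collapse; it creates
  -- the vacuum and does not change the correlation function.
  have hid : IsSomeField M wt L idModes := ⟨0, isField_idModes⟩
  obtain ⟨w, ⟨d, hw⟩, hwv, hres⟩ := D.exists_iterRes hc hid m
  have h1 := hres [] v' v z (by simp) (by simp [GoodList, hz.symm])
  have hvac : (idModes : Modes V) (-1) (vacuum vac) = vacuum vac := by simp [idModes]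
  rw [hvac] at hwv
  have h2 : corr v' v ([] ++ [(w, z)]) = pair v' (D.vertexOp z (w (-1) (vacuum vac)) v) := by
    rw [corr_append, D.vertexOp_apply hw]
    have h3 : (Fin.snoc (α := fun _ => ℂ) (fun i : Fin 0 => (List.get ([] : List (Modes V × ℂ)) i).2) z)
        = fun _ => z := by
      funext i
      induction i using Fin.lastCases with
      | last => rw [Fin.snoc_last]
      | cast i => exact i.elim0
    have h4 := ratEval_one (c := fun i : Fin 0 => (List.get ([] : List (Modes V × ℂ)) i).1) hw.homog
      v' v (D.isRational_coeffs (D.isSomeField_snoc (fun i => i.elim0) ⟨d, hw⟩) v' v) hz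
    rw [← h4, ← h3]
    rfl
  rw [← hwv, ← h2, ← h1]
  refine iterRes_congr k (norm_pos_iff.2 hz) m fun ξ h0 hlt hanti => ?_
  obtain ⟨hg, hne⟩ := good_add h0 hlt hanti
  rw [List.nil_append, corr_idModes, corr_ofFn]
  · have hmap : (List.ofFn fun j => (c j, ξ j + z)).map Prod.snd ++ [z] =
        List.ofFn (Fin.snoc (α := fun _ => ℂ) (fun j => ξ j + z) z) := by
      rw [List.ofFn_succ_last]
      simp [List.map_ofFn, Function.comp_def]
    rw [hmap, ← good_iff_ofFn]
    refine ⟨fun i => ?_, fun i j hij => ?_⟩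
    · induction i using Fin.lastCases with
      | last => simpa using hz
      | cast i => simpa using hg.1 i
    · induction i using Fin.lastCases with
      | last =>
        induction j using Fin.lastCases with
        | last => rfl
        | cast j => exact absurd (by simpa using hij.symm) (h0 j)
      | cast i =>
        induction j using Fin.lastCases with
        | last => exact absurd (by simpa using hij) (h0 i)
        | cast j =>
          have h5 : ξ i + z = ξ j + z := by simpa using hij
          rw [hg.2 h5]
  · refine D.isRational_coeffs (fun i => ?_) v' v
    have := List.get_mem (List.ofFn fun j => (c j, ξ j + z)) i
    obtain ⟨j, hj⟩ := List.mem_ofFn.1 this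
    rw [← hj]
    exact hc j
  · refine D.isRational_coeffs (D.isSomeField_snoc (fun i => ?_) hid) v' v
    have := List.get_mem (List.ofFn fun j => (c j, ξ j + z)) i
    obtain ⟨j, hj⟩ := List.mem_ofFn.1 this
    rw [← hj]
    exact hc j

namespace IsGeneratingData

variable (h : IsGeneratingData vac φ wt L)
include h

lemma isProductResidueMap : IsProductResidueMap vac φ h.isFormalData.vertexOp := by
  intro k i v v'
  set D := h.isFormalData
  have hc : ∀ j, IsSomeField (fun i => modesOf (wt i) (φ i)) wt L
      ((fun j => modesOf (wt (i j)) (φ (i j))) j) := fun j => ⟨_, D.isField_gen (i j)⟩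
  obtain ⟨P, N, hP⟩ := exists_ratFun (D.isRational_coeffs hc v' v)
  refine ⟨P, N, fun z hz hanti => ?_, fun m z hz => ?_⟩
  · rw [hP z ⟨hz, fun i j hij => hanti.injective (congrArg norm hij)⟩]
    refine (D.hasSum_coeffs hc v' v hz hanti).of_eq fun n => ?_
    rw [h.word_eq, wordM_ofFn]
    rfl
  · rw [h.word_eq, wordM_ofFn, D.vertexOp_prodL hc v' v m hz]
    refine iterRes_congr k (norm_pos_iff.2 hz) m fun ξ h0 hlt hanti => ?_
    exact (hP _ (good_add h0 hlt hanti).1).symm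

/-- The pairs `P`, `N` belonging to the two maps may differ, but both functions are the sum of the
same series for decreasing absolute values; hence they agree wherever the iterated residue looks. -/
lemma eq_of_isProductResidueMap {Y Y' : ℂ → Total V →ₗ[ℂ] Total V →ₗ[ℂ] Completion V}
    (hY : IsProductResidueMap vac φ Y) (hY' : IsProductResidueMap vac φ Y') {z : ℂ} (hz : z ≠ 0) :
    Y z = Y' z := by
  refine LinearMap.ext_on_range h.spanning fun l => LinearMap.ext fun v => completion_ext fun v' => ?_
  have hl : List.ofFn (fun j => ((l.get j).1, (l.get j).2)) = l := List.ofFn_get l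
  obtain ⟨P, N, h1, h2⟩ := hY l.length (fun j => (l.get j).1) v v'
  obtain ⟨P', N', h1', h2'⟩ := hY' l.length (fun j => (l.get j).1) v v'
  have e := h2 (fun j => (l.get j).2) z hz
  have e' := h2' (fun j => (l.get j).2) z hz
  rw [hl] at e e'
  rw [e, e']
  refine iterRes_congr _ (norm_pos_iff.2 hz) _ fun ξ h0 hlt hanti => ?_
  exact ratFun_unique (fun w hw hw' => (h1 w hw hw').unique (h1' w hw hw'))
    (good_add h0 hlt hanti).1

end IsGeneratingData

lemma IsProductResidueMap.congr {Y Y' : ℂ → Total V →ₗ[ℂ] Total V →ₗ[ℂ] Completion V}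
    (hY : IsProductResidueMap vac φ Y) (h : ∀ z, z ≠ 0 → Y' z = Y z) :
    IsProductResidueMap vac φ Y' := by
  intro k i v v'
  obtain ⟨P, N, h1, h2⟩ := hY k i v v'
  refine ⟨P, N, h1, fun m z hz => ?_⟩
  rw [h z hz]
  exact h2 m z hz

end ProductResidues

/-! ### Uniqueness of the vertex superalgebra structure -/

section Uniqueness

/-- Multiplication by `(1 - w)^N` along an antidiagonal. -/
lemma hasSum_mulDiff_iterate {A : ℤ → ℤ → ℂ} {c : ℤ} {w S : ℂ} (hw : w ≠ 0)
    (h : HasSum (fun q : ℤ => A (c - q) q * w ^ (-q - 1)) S) (N : ℕ) :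
    HasSum (fun q : ℤ => mulDiff^[N] A (c - N - q) q * w ^ (-q - 1)) ((1 - w) ^ N * S) := by
  induction N with
  | zero => simpa using h
  | succ N ih =>
    have h1 := (Equiv.hasSum_iff (Equiv.addRight (1 : ℤ))).2 ih
    have h2 := ih.sub (h1.mul_left w)
    rw [show (1 - w) ^ (N + 1) * S = (1 - w) ^ N * S - w * ((1 - w) ^ N * S) by ring]
    refine h2.of_eq fun q => ?_
    simp only [Function.comp_apply, Equiv.coe_addRight]
    rw [Function.iterate_succ_apply', mulDiff]
    have e1 : c - ((N + 1 : ℕ) : ℤ) - q + 1 = c - N - q := by push_cast; ring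
    have e2 : c - ((N + 1 : ℕ) : ℤ) - q = c - N - (q + 1) := by push_cast; ring
    have e3 : w * w ^ (-(q + 1) - 1) = w ^ (-q - 1) := by
      rw [← zpow_one_add₀ hw]; congr 1; ring
    rw [e1, e2]
    linear_combination mulDiff^[N] A (c - N - (q + 1)) (q + 1) * e3

lemma mulDiff_iterate_eq_zero {A : ℤ → ℤ → ℂ} {c : ℤ} (h : ∀ m n, m + n ≠ c → A m n = 0) (N : ℕ) :
    ∀ m n, m + n ≠ c - N → mulDiff^[N] A m n = 0 := by
  induction N with
  | zero => simpa using h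
  | succ N ih =>
    intro m n hmn
    rw [Function.iterate_succ_apply', mulDiff, ih _ _ (by push_cast at hmn; omega),
      ih _ _ (by push_cast at hmn; omega), sub_zero]

lemma hasSum_polynomial (p : Polynomial ℂ) (N : ℕ) :
    ∃ C : ℤ → ℂ, ∀ w : ℂ, w ≠ 0 → HasSum (fun q : ℤ => C q * w ^ (-q - 1)) (p.eval w / w ^ N) := by
  refine ⟨fun q => if q ≤ N - 1 then p.coeff (N - 1 - q).toNat else 0, fun w hw => ?_⟩
  have h1 : HasSum (fun n : ℕ => p.coeff n * w ^ n / w ^ N) (p.eval w / w ^ N) := by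
    have h0 : HasSum (fun n : ℕ => p.coeff n * w ^ n) (p.eval w) := by
      rw [Polynomial.eval_eq_sum, Polynomial.sum]
      exact hasSum_sum_of_ne_finset_zero fun n hn => by
        rw [Polynomial.notMem_support_iff.1 hn, zero_mul]
    exact h0.div_const _
  have hinj : Function.Injective fun n : ℕ => (N : ℤ) - 1 - n := fun n n' h => by
    simp only at h; omega
  refine (hinj.hasSum_iff fun q hq => ?_).1 (h1.of_eq fun n => ?_)
  · beta_reduce
    rw [if_neg, zero_mul]
    intro hle
    exact hq ⟨(N - 1 - q).toNat, by simp only; omega⟩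
  · simp only [Function.comp_apply]
    rw [if_pos (by omega), show ((N : ℤ) - 1 - (N - 1 - n)).toNat = n by omega,
      show -((N : ℤ) - 1 - n) - 1 = (n : ℤ) - N by ring, zpow_sub₀ hw]
    simp [mul_div_assoc]

/-- Two expansions of a rational function in different domains differ by an expansion of the
delta function. -/
lemma exists_mulDiff_iterate_eq {A B : ℤ → ℤ → ℂ} {c : ℤ} (hA : ∀ m n, m + n ≠ c → A m n = 0)
    (hB : ∀ m n, m + n ≠ c → B m n = 0) {P : MvPolynomial (Fin 2) ℂ} {N : ℕ}
    (h1 : ∀ w : ℂ, w ≠ 0 → ‖w‖ < 1 →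
      HasSum (fun q : ℤ => A (c - q) q * w ^ (-q - 1)) (ratFun P N ![1, w]))
    (h2 : ∀ w : ℂ, 1 < ‖w‖ →
      HasSum (fun q : ℤ => B (c - q) q * w ^ (-q - 1)) (ratFun P N ![1, w])) :
    mulDiff^[N] A = mulDiff^[N] B := by
  obtain ⟨C, hC⟩ := hasSum_polynomial
    (MvPolynomial.aeval (![1, Polynomial.X] : Fin 2 → Polynomial ℂ) P) N
  have hev : ∀ w : ℂ, (MvPolynomial.aeval (![1, Polynomial.X] : Fin 2 → Polynomial ℂ) P).eval w =
      MvPolynomial.eval ![1, w] P := by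
    intro w
    clear hC h1 h2
    induction P using MvPolynomial.induction_on with
    | C r => simp
    | add p q hp hq => rw [map_add, Polynomial.eval_add, hp, hq, map_add]
    | mul_X p i hp =>
      rw [map_mul, Polynomial.eval_mul, hp, map_mul, MvPolynomial.aeval_X, MvPolynomial.eval_X]
      fin_cases i <;> simp
  -- Each series lives on one antidiagonal, so `z₁ = 1` loses nothing. The factor `(1 - w)^N` clears
  -- the pole at `w = 1`, and the circles of radius `1/2` and `2` then read the coefficients of the
  -- same Laurent polynomial.
  have hR : ∀ w : ℂ, w ≠ 0 → w ≠ 1 → (1 - w) ^ N * ratFun P N ![1, w] =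
      (MvPolynomial.aeval (![1, Polynomial.X] : Fin 2 → Polynomial ℂ) P).eval w / w ^ N := by
    intro w h0 h1
    have h3 : (1 - w) ≠ 0 := sub_ne_zero.2 (Ne.symm h1)
    rw [hev, ratFun, ← eval_vdm, vdm_two]
    simp only [Fin.prod_univ_two, map_sub, MvPolynomial.eval_X, Matrix.cons_val_zero,
      Matrix.cons_val_one, one_mul, mul_pow]
    field_simp
  have e1 : (fun q => mulDiff^[N] A (c - N - q) q) = C := by
    refine laurent_unique (r := 1 / 2) (by norm_num) (fun w hw => ?_) fun w hw => hC w ?_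
    · have h0 : w ≠ 0 := by rintro rfl; norm_num at hw
      have h3 : w ≠ 1 := by rintro rfl; norm_num at hw
      rw [← hR w h0 h3]
      exact hasSum_mulDiff_iterate h0 (h1 w h0 (by rw [hw]; norm_num)) N
    · rintro rfl; norm_num at hw
  have e2 : (fun q => mulDiff^[N] B (c - N - q) q) = C := by
    refine laurent_unique (r := 2) (by norm_num) (fun w hw => ?_) fun w hw => hC w ?_
    · have h0 : w ≠ 0 := by rintro rfl; norm_num at hw
      have h3 : w ≠ 1 := by rintro rfl; norm_num at hw
      rw [← hR w h0 h3]
      exact hasSum_mulDiff_iterate h0 (h2 w (by rw [hw]; norm_num)) N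
    · rintro rfl; norm_num at hw
  funext m n
  by_cases hmn : m + n = c - N
  · have := congrFun (e1.trans e2.symm) n
    simpa only [show c - N - n = m by omega] using this
  · rw [mulDiff_iterate_eq_zero hA N m n hmn, mulDiff_iterate_eq_zero hB N m n hmn]

variable {V : ℤ → Type u} [∀ k, AddCommGroup (V k)] [∀ k, Module ℂ (V k)] {I : Type v}

/-- Passing from homogeneous components to modes. -/
lemma hasSum_modes_of_comp {e l : ℤ} {b : Modes V} (hb : IsHomog e b) {z : ℂ} (x : V l)
    (Λ : Total V →ₗ[ℂ] ℂ) {S : ℂ}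
    (h : HasSum (fun k : ℤ => Λ (comp k (evalAt e b z (ofDeg l x)))) S) :
    HasSum (fun q : ℤ => Λ (b q (ofDeg l x)) * z ^ (-q - 1)) S := by
  have hinj : Function.Injective fun q : ℤ => l + e - 2 * q - 2 := fun q q' h => by
    simp only at h; omega
  refine ((hinj.hasSum_iff fun k hk => ?_).2 h).of_eq fun q => ?_
  · have : comp k (evalAt e b z (ofDeg l x)) = 0 := by
      rw [comp, evalAt_ofDeg, if_neg, map_zero]
      rintro ⟨m, hm⟩
      exact hk ⟨m - 1, by simp only; omega⟩
    rw [this, map_zero]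
  · have he : Even (e + l - (l + e - 2 * q - 2)) := ⟨q + 1, by ring⟩
    simp only [Function.comp_apply]
    rw [comp, evalAt_ofDeg, if_pos he, show (e + l - (l + e - 2 * q - 2)) / 2 = q + 1 by omega,
      map_smul, map_smul, smul_eq_mul, mul_comm, neg_add', add_sub_cancel_right]
    have h1 : ∀ j, j ≠ l + e - 2 * q - 2 → b q (ofDeg l x) j = 0 := fun j hj =>
      hb q l x j (by omega)
    rw [← eq_ofDeg_of_forall h1]

lemma pair_evalAt_eq {d : ℤ} {a : Modes V} (ha : IsHomog d a) (v' : GradedDual V) (w : Total V)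
    {p : ℤ} (h : ∀ p', p' ≠ p → pair v' (incl (a p' w)) = 0) (z : ℂ) :
    pair v' (evalAt d a z w) = pair v' (incl (a p w)) * z ^ (-p - 1) := by
  refine (hasSum_evalAt ha z w v').unique ?_
  exact hasSum_single p fun p' hp' => by rw [h p' hp', zero_mul]

/-- Weak locality from the convergence of the products in both orders to a common rational
function. -/
lemma isWeakLocal_of_duality {d e : ℤ} {a b : Modes V} (ha : IsHomog d a) (hb : IsHomog e b) {s : ℂ}
    (h : ∀ (v : Total V) (v' : GradedDual V), ∃ (P : MvPolynomial (Fin 2) ℂ) (N : ℕ),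
      (∀ z₁ z₂ : ℂ, ‖z₂‖ < ‖z₁‖ → 0 < ‖z₂‖ →
        HasSum (fun k : ℤ => pair v' (evalAt d a z₁ (comp k (evalAt e b z₂ v))))
          (ratFun P N ![z₁, z₂])) ∧
      (∀ z₁ z₂ : ℂ, ‖z₁‖ < ‖z₂‖ → 0 < ‖z₁‖ →
        HasSum (fun k : ℤ => s * pair v' (evalAt e b z₂ (comp k (evalAt d a z₁ v))))
          (ratFun P N ![z₁, z₂]))) : IsWeakLocal s a b := by
  intro v v'
  induction v using total_induction with
  | h0 => exact ⟨0, by simp⟩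
  | h2 x y hx hy =>
    obtain ⟨N, hN⟩ := hx
    obtain ⟨N', hN'⟩ := hy
    refine ⟨max N N', ?_⟩
    have h1 := mulDiff_iterate_le (le_max_left N N') hN
    have h2 := mulDiff_iterate_le (le_max_right N N') hN'
    have h3 := congrArg₂ (· + ·) h1 h2
    simp only [← mulDiff_iterate_add] at h3
    convert h3 using 2 <;> funext m n <;> simp [incl_add, mul_add]
  | h1 l x =>
    induction v' using gradedDual_induction with
    | h0 => exact ⟨0, by simp⟩
    | h2 x y hx hy =>
      obtain ⟨N, hN⟩ := hx
      obtain ⟨N', hN'⟩ := hy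
      refine ⟨max N N', ?_⟩
      have h1 := mulDiff_iterate_le (le_max_left N N') hN
      have h2 := mulDiff_iterate_le (le_max_right N N') hN'
      have h3 := congrArg₂ (· + ·) h1 h2
      simp only [← mulDiff_iterate_add] at h3
      convert h3 using 2 <;> funext m n <;> simp [mul_add]
    | h1 t f =>
      obtain ⟨P, N, h1, h2⟩ := h (ofDeg l x) (dualOf t f)
      -- The weights of `x` and `f` allow a single value of `p + q`. If the numerator is odd no
      -- value is allowed, so the rounding in the division does no harm.
      have hA : ∀ p q, p + q ≠ (l + d + e - 4 - t) / 2 →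
          pair (dualOf t f) (incl (a p (b q (ofDeg l x)))) = 0 := fun p q hpq => by
        rw [pair_dualOf]
        have h0 : incl (a p (b q (ofDeg l x))) t = 0 :=
          ((ha p).comp (hb q)) l x t (by omega)
        rw [h0, map_zero]
      have hB : ∀ p q, p + q ≠ (l + d + e - 4 - t) / 2 →
          pair (dualOf t f) (incl (b q (a p (ofDeg l x)))) = 0 := fun p q hpq => by
        rw [pair_dualOf]
        have h0 : incl (b q (a p (ofDeg l x))) t = 0 :=
          ((hb q).comp (ha p)) l x t (by omega)
        rw [h0, map_zero]
      generalize (l + d + e - 4 - t) / 2 = c at hA hB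
      refine ⟨N, exists_mulDiff_iterate_eq (c := c) hA
        (fun p q hpq => by rw [hB p q hpq, mul_zero]) (P := P) (fun w hw hlt => ?_)
        fun w hw => ?_⟩
      · have h3 := hasSum_modes_of_comp hb x (pair (dualOf t f) ∘ₗ evalAt d a 1)
          (h1 1 w (by simpa using hlt) (norm_pos_iff.2 hw))
        refine h3.of_eq fun q => ?_
        rw [LinearMap.comp_apply, pair_evalAt_eq ha (dualOf t f) (b q (ofDeg l x)) (p := c - q)
          (fun p' hp' => hA p' q (by omega)), one_zpow, mul_one]
      · have h3 := hasSum_modes_of_comp ha x (s • (pair (dualOf t f) ∘ₗ evalAt e b w))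
          (h2 1 w (by simpa using hw) (by simp))
        have h4 := (Equiv.hasSum_iff (Equiv.subLeft c)).2 h3
        refine h4.of_eq fun q => ?_
        simp only [Function.comp_apply, Equiv.subLeft_apply]
        rw [LinearMap.smul_apply, LinearMap.comp_apply, pair_evalAt_eq hb (dualOf t f)
          (a (c - q) (ofDeg l x)) (p := q) (fun q' hq' => hB _ q' (by omega)), one_zpow, mul_one,
          smul_eq_mul, mul_assoc]

variable {vac : V 0} {φ : I → ℂ → Total V →ₗ[ℂ] Completion V} {wt : I → ℤ}
  {L : Module.End ℂ (Total V)} {Y : ℂ → Total V →ₗ[ℂ] Total V →ₗ[ℂ] Completion V}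

namespace IsVertexSuperalgebra

variable (hY : IsVertexSuperalgebra vac Y)
include hY

lemma eq_evalAt (k : ℤ) (x : V k) {z : ℂ} (hz : z ≠ 0) :
    Y z (ofDeg k x) = evalAt k (modesOf k fun z => Y z (ofDeg k x)) z := by
  refine eq_evalAt_modesOf (ψ := fun z => Y z (ofDeg k x)) (hY.analytic _) (fun v v' z hz => ?_) hz
  have := hY.weight_bracket (ofDeg k x) v v' z hz
  rwa [weight_ofDeg, map_smul, LinearMap.smul_apply, map_smul, smul_eq_mul] at this

/-- Within `V k` the function `Y(x, z) 1` is constant in `z`, with value that of the mode `-1`; the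
creation axiom says that this constant is `x`. -/
lemma modesOf_vacuum (k : ℤ) (x : V k) :
    modesOf k (fun z => Y z (ofDeg k x)) (-1) (vacuum vac) = ofDeg k x := by
  set a := modesOf k fun z => Y z (ofDeg k x) with ha
  have hh : IsHomog k a := isHomog_modesOf _ _
  have h0 : ∀ j, j ≠ k → a (-1) (vacuum vac) j = 0 := fun j hj => hh (-1) 0 vac j (by omega)
  rw [eq_ofDeg_of_forall h0]
  congr 1
  rw [← sub_eq_zero, ← Module.forall_dual_apply_eq_zero_iff ℂ]
  intro f
  rw [map_sub, sub_eq_zero]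
  have h1 := hY.creation (ofDeg k x) (dualOf k f)
  rw [pair_dualOf] at h1
  have h2 : incl (ofDeg k x) k = x := ofDeg_same k x
  rw [h2] at h1
  refine tendsto_nhds_unique (tendsto_const_nhds.congr' ?_) h1
  filter_upwards [self_mem_nhdsWithin] with z hz
  rw [hY.eq_evalAt k x hz, ← ha, pair_dualOf, vacuum, evalAt_ofDeg, if_pos ⟨0, by ring⟩,
    show (k + 0 - k) / 2 = 0 by omega]
  simp

end IsVertexSuperalgebra

/-- The brackets with the generators and the value on the vacuum determine a translation operator on
all words. -/
lemma IsFormalData.eq_of_isCovariant {M : I → Modes V} (D : IsFormalData vac M wt L)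
    {L' : Module.End ℂ (Total V)} (h0 : L' (vacuum vac) = 0) (h : ∀ i, IsCovariant L' (M i)) :
    L' = L := by
  refine LinearMap.ext_on_range D.spanning fun l => ?_
  induction l with
  | nil => exact h0.trans D.L_vacuum.symm
  | cons p l ih =>
    have h1 := h p.1 p.2 (wordM M l (vacuum vac))
    have h2 := D.covariant p.1 p.2 (wordM M l (vacuum vac))
    rw [ih] at h1
    exact sub_left_injective (h1.trans h2.symm)

/-- A vertex superalgebra structure is determined by the generating fields. -/
lemma IsGeneratingData.eq_vertexOp (h : IsGeneratingData vac φ wt L)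
    (hY : IsVertexSuperalgebra vac Y)
    (hφ : ∀ i (z : ℂ), z ≠ 0 → Y z (mode (φ i) (-1) (vacuum vac)) = φ i z) {z : ℂ} (hz : z ≠ 0) :
    Y z = h.isFormalData.vertexOp z := by
  set D := h.isFormalData
  obtain ⟨L', hL', hbr⟩ := hY.translation
  have hL0 : L' (vacuum vac) = 0 := by
    refine total_eq_zero fun v' => tendsto_nhds_unique (hL' (vacuum vac) v')
      (tendsto_const_nhds.congr' ?_)
    filter_upwards [self_mem_nhdsWithin] with w hw
    rw [dcoeff_congr (g := fun _ => incl (vacuum vac)) (fun z hz => hY.identity _ z hz) v' hw]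
    simp [dcoeff]
  have hcov : ∀ k (x : V k), IsCovariant L' (modesOf k fun z => Y z (ofDeg k x)) := fun k x =>
    isCovariant_of_hasSum (isHomog_modesOf _ _) fun v v' z hz => by
      have h1 := (hbr (ofDeg k x) v v' z hz).2
      rw [dcoeff_congr (fun z hz => by rw [hY.eq_evalAt k x hz]) v' hz] at h1
      rwa [hY.eq_evalAt k x hz] at h1
  have hgen : ∀ i, ∃ x : V (wt i), modesOf (wt i) (φ i) (-1) (vacuum vac) = ofDeg (wt i) x :=
    fun i => ⟨_, eq_ofDeg_of_forall (D.field_vacuum (D.isField_gen i))⟩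
  choose x hx using hgen
  have hYφ : ∀ i (z : ℂ), z ≠ 0 → Y z (ofDeg (wt i) (x i)) = φ i z := fun i z hz => by
    rw [← hx, ← h.mode_eq]
    exact hφ i z hz
  -- Goddard's theorem needs both fields covariant for the same operator, while `L'` comes only from
  -- the existence statement in the axioms.
  have hLL : L' = L := D.eq_of_isCovariant hL0 fun i =>
    isCovariant_of_hasSum (isHomog_modesOf _ _) fun v v' z hz => by
      have h1 := (hbr (ofDeg (wt i) (x i)) v v' z hz).2
      rw [dcoeff_congr (fun z hz => by rw [hYφ i z hz, h.eq_evalAt i hz]) v' hz] at h1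
      rwa [hYφ i z hz, h.eq_evalAt i hz] at h1
  refine DirectSum.linearMap_ext ℂ fun k => LinearMap.ext fun y => ?_
  change Y z (ofDeg k y) = D.vertexOp z (ofDeg k y)
  rw [hY.eq_evalAt k y hz, D.vertexOp_ofDeg]
  congr 1
  have hf := D.isField_stateField k y
  refine goddard (fun i => D.isTrunc (D.isField_gen i)) D.L_vacuum D.spanning
    (D.isTrunc_of_homog (isHomog_modesOf _ _)) (D.isTrunc hf) (hLL ▸ hcov k y) hf.covariant
    (s := fun i => sg k (wt i)) (fun i => ?_) (fun i => (hf.isLocal i).isWeakLocal) ?_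
  -- In the duality axiom the order of the pole may depend on `v` and `v'`, so only weak locality is
  -- available; this is why `goddard` assumes no more.
  · refine isWeakLocal_of_duality (isHomog_modesOf _ _) (isHomog_modesOf _ _) fun v v' => ?_
    obtain ⟨P, N, h1, h2, -⟩ := hY.duality _ _ _ (ofDeg_mem_parityPart k y) _
      (ofDeg_mem_parityPart (wt i) (x i)) v v'
    refine ⟨P, N, fun z₁ z₂ hlt hpos => ?_, fun z₁ z₂ hlt hpos => ?_⟩
    · have h3 := h1 z₁ z₂ hlt hpos
      rwa [hY.eq_evalAt k y (norm_pos_iff.1 (hpos.trans hlt)), hYφ i z₂ (norm_pos_iff.1 hpos),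
        h.eq_evalAt i (norm_pos_iff.1 hpos)] at h3
    · have h3 := h2 z₁ z₂ hlt hpos
      rwa [hY.eq_evalAt k y (norm_pos_iff.1 hpos), hYφ i z₂ (norm_pos_iff.1 (hpos.trans hlt)),
        h.eq_evalAt i (norm_pos_iff.1 (hpos.trans hlt)), sg_parity] at h3
  · rw [hY.modesOf_vacuum, D.stateField_vacuum]

namespace IsGeneratingData

variable (h : IsGeneratingData vac φ wt L)
include h

lemma vertexOp_mode (i : I) {z : ℂ} (hz : z ≠ 0) :
    h.isFormalData.vertexOp z (mode (φ i) (-1) (vacuum vac)) = φ i z := by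
  rw [h.mode_eq, h.eq_evalAt i hz]
  exact h.isFormalData.vertexOp_apply (h.isFormalData.isField_gen i) z

lemma isGeneratedBy : IsGeneratedBy vac h.isFormalData.vertexOp
    fun i => mode (φ i) (-1) (vacuum vac) := by
  have e : ∀ l : List (I × ℤ), word (fun i z => h.isFormalData.vertexOp z
      (mode (φ i) (-1) (vacuum vac))) l (vacuum vac) = word φ l (vacuum vac) := by
    intro l
    unfold word
    congr 1
    funext p w
    exact mode_congr (fun z hz => h.vertexOp_mode p.1 hz) _ _
  unfold IsGeneratedBy
  simp only [e]
  exact h.spanning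

/-- With even weight indices all words are even, and words span; a vector that is both even and odd
vanishes. -/
lemma parityPart_one_eq_bot (hwt : ∀ i, Even (wt i)) : parityPart V 1 = ⊥ := by
  have hdeg : ∀ l : List (I × ℤ), ((IsFormalData.wordDeg wt l : ℤ) : ZMod 2) = 0 := by
    intro l
    rw [ZMod.intCast_zmod_eq_zero_iff_dvd]
    refine List.dvd_sum fun n hn => ?_
    obtain ⟨p, _, rfl⟩ := List.mem_map.1 hn
    obtain ⟨m, hm⟩ := hwt p.1
    exact ⟨m - p.2 - 1, by push_cast; omega⟩
  have htop : parityPart V 0 = ⊤ := by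
    rw [eq_top_iff, ← h.isFormalData.spanning, Submodule.span_le]
    rintro _ ⟨l, rfl⟩
    have := h.isFormalData.wordM_mem_parityPart l
    rwa [hdeg] at this
  refine (Submodule.eq_bot_iff _).2 fun v hv => DFinsupp.ext fun k => ?_
  have hv0 : v ∈ parityPart V 0 := htop ▸ Submodule.mem_top
  by_cases hk : (k : ZMod 2) = 0
  · exact hv k (by rw [hk]; decide)
  · exact hv0 k hk

end IsGeneratingData

end Uniqueness

end HalfGraded

end

theorem corollary3p6 (V : ℤ → Type*) [∀ k, AddCommGroup (V k)] [∀ k, Module ℂ (V k)]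
    (I : Type*) (vac : V 0)
    (φ : I → ℂ → HalfGraded.Total V →ₗ[ℂ] HalfGraded.Completion V) (wt : I → ℤ)
    (L : Module.End ℂ (HalfGraded.Total V))
    (h : HalfGraded.IsGeneratingData vac φ wt L) :
    ∃ Y : ℂ → HalfGraded.Total V →ₗ[ℂ] HalfGraded.Total V →ₗ[ℂ] HalfGraded.Completion V,
      -- `Y` is the map defined by residues of products of the generating fields,
      (∀ Y' : ℂ → HalfGraded.Total V →ₗ[ℂ] HalfGraded.Total V →ₗ[ℂ] HalfGraded.Completion V,
        HalfGraded.IsProductResidueMap vac φ Y' ↔ ∀ z : ℂ, z ≠ 0 → Y' z = Y z) ∧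
      -- it makes `V` a grading-restricted vertex (super)algebra
      HalfGraded.IsVertexSuperalgebra vac Y ∧
      ((∀ i, Even (wt i)) → HalfGraded.IsVertexAlgebra vac Y) ∧
      -- generated by the `φ^i_{-1} 1`,
      HalfGraded.IsGeneratedBy vac Y
        (fun i => HalfGraded.mode (φ i) (-1) (HalfGraded.vacuum vac)) ∧
      -- it extends the generating fields and is unique with this property,
      (∀ i (z : ℂ), z ≠ 0 →
        Y z (HalfGraded.mode (φ i) (-1) (HalfGraded.vacuum vac)) = φ i z) ∧
      (∀ Y' : ℂ → HalfGraded.Total V →ₗ[ℂ] HalfGraded.Total V →ₗ[ℂ] HalfGraded.Completion V,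
        HalfGraded.IsVertexSuperalgebra vac Y' →
        (∀ i (z : ℂ), z ≠ 0 →
          Y' z (HalfGraded.mode (φ i) (-1) (HalfGraded.vacuum vac)) = φ i z) →
        ∀ z : ℂ, z ≠ 0 → Y' z = Y z) ∧
      -- and it is the map defined by the residue of the Jacobi identity.
      (∀ Y' : ℂ → HalfGraded.Total V →ₗ[ℂ] HalfGraded.Total V →ₗ[ℂ] HalfGraded.Completion V,
        HalfGraded.IsJacobiResidueMap vac φ Y' ↔ ∀ z : ℂ, z ≠ 0 → Y' z = Y z) := by
  refine ⟨h.isFormalData.vertexOp, fun Y' => ⟨fun hY' z hz => ?_, fun hY' => ?_⟩,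
    h.isFormalData.isVertexSuperalgebra h.finite_dim,
    fun hwt => ⟨h.isFormalData.isVertexSuperalgebra h.finite_dim, h.parityPart_one_eq_bot hwt⟩,
    h.isGeneratedBy, fun i z hz => h.vertexOp_mode i hz,
    fun Y' hY' hφ z hz => h.eq_vertexOp hY' hφ hz,
    fun Y' => ⟨fun hY' z hz => ?_, fun hY' => ?_⟩⟩
  · exact h.eq_of_isProductResidueMap hY' h.isProductResidueMap hz
  · exact h.isProductResidueMap.congr hY'
  · exact h.eq_of_isJacobiResidueMap hY' h.isJacobiResidueMap hz
  · exact h.isJacobiResidueMap.congr hY'
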